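/- Let $(\Omega,\mathcal A,\mathbb P)$ be a probability space, $T:\Omega\to\Omega$ a bijective bimeasurable transformation preserving $\mathbb P$, and $\mathcal F_0\subseteq\mathcal A$ a $\sigma$-algebra with $\mathcal F_0\subseteq T^{-1}(\mathcal F_0)$; put $\mathcal F_i=T^{-i}(\mathcal F_0)$ for $i\in\mathbb Z$. Let $X_0$ be a real random variable, $X_i=X_0\circ T^i$, and suppose that $(X_i)_{i\in\mathbb Z}$ is a martingale differences sequence with respect to $(\mathcal F_i)_{i\in\mathbb Z}$, i.e. each $X_i$ is integrable and $\mathcal F_i$-measurable and $\mathbb E(X_i\mid\mathcal F_{i-1})=0$ almost surely. Let $S_n=X_1+\cdots+X_n$, let $\sigma\ge 0$ be the standard deviation of $X_0$, let $P_{n^{-1/2}S_n}$ be the law of $n^{-1/2}S_n$, and let $G_{\sigma^2}$ be the normal law $N(0,\sigma^2)$ (the Dirac mass at $0$ if $\sigma=0$). For $p>2$ and a real random variable $X$ let $$\Vert X\Vert_{1,\Phi,p}=\int_0^1\bigl(1\vee\Phi^{-1}(1-u/2)\bigr)^{p-2}Q_X(u)\,du ,$$ where $\Phi$ is the distribution function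 of $N(0,1)$ and $Q_X(u)=\inf\{t\ge 0:\mathbb P(|X|>t)\le u\}$ is the quantile function of $|X|$. For probability measures $\mu,\nu$ on $\mathbb R$ and $r>0$ let $$W_r(\mu,\nu)=\inf_P\Bigl(\int|x-y|^r\,P(dx,dy)\Bigr)^{1/\max(1,r)} ,$$ the infimum being over all probability laws $P$ on $\mathbb R^2$ with marginals $\mu$ and $\nu$. Let $p\in(2,3]$ and assume that $\mathbb E|X_0|^p<\infty$, $$\sum_{n=1}^\infty\frac1{n^{2-p/2}}\Bigl\Vert\mathbb E\Bigl(\frac{S_n^2}{n}\Bigm|\mathcal F_0\Bigr)-\sigma^2\Bigr\Vert_{1,\Phi,p}<\infty \quad\text{and}\quad \sum_{n=1}^\infty\frac1{n^{2/p}}\Bigl\Vert\mathbb E\Bigl(\frac{S_n^2}{n}\Bigm|\mathcal F_0\Bigr)-\sigma^2\Bigr\Vert_{p/2}<\infty .$$ Then, for every $r\in[p-2,p]$ with $(r,p)\ne(1,3)$, the distance $W_r(P_{n^{-1/2}S_n},G_{\sigma^2})$ is finite for every $n\ge1$ and, as $n\to\infty$, $$W_r(P_{n^{-1/2}S_n},G_{\sigma^2})=O\bigl(n^{-(p-2)/(2\max(1,r))}\bigr).$$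 -/

import Mathlib

open MeasureTheory ProbabilityTheory Filter Set Asymptotics
open scoped ENNReal NNReal

noncomputable section

namespace MartCLT

/-- The set of laws on `ℝ × ℝ` with marginals `μ` and `ν`. -/
def couplings (μ ν : Measure ℝ) : Set (Measure (ℝ × ℝ)) :=
  {P | P.map Prod.fst = μ ∧ P.map Prod.snd = ν}

/-- The minimal (Wasserstein) distance of order `r > 0`, with values in `[0, ∞]`:
the `1/r`-th power of the cost is taken only when `r ≥ 1`. -/
def wasserstein (r : ℝ) (μ ν : Measure ℝ) : ℝ≥0∞ :=
  if r < 1 then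
    ⨅ P ∈ couplings μ ν, ∫⁻ z, ENNReal.ofReal (|z.1 - z.2| ^ r) ∂P
  else
    ⨅ P ∈ couplings μ ν, (∫⁻ z, ENNReal.ofReal (|z.1 - z.2| ^ r) ∂P) ^ (1 / r)

/-- Quantile function `Φ⁻¹` of the standard normal law, used on `(0, 1)`. -/
def normalQuantile (v : ℝ) : ℝ :=
  sInf {x : ℝ | v ≤ cdf (gaussianReal 0 1) x}

section

variable {Ω : Type*} [mΩ : MeasurableSpace Ω]

/-- Quantile function `Q_X` of `|X|`: the generalized inverse of the tail function
`t ↦ P(|X| > t)`, used on `(0, 1)`. -/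
def absQuantile (μ : Measure Ω) (X : Ω → ℝ) (u : ℝ) : ℝ :=
  sInf {t : ℝ | 0 ≤ t ∧ μ {ω | t < |X ω|} ≤ ENNReal.ofReal u}

/-- The envelope norm `‖X‖_{1,Φ,p} = ∫₀¹ (1 ∨ Φ⁻¹(1 - u/2))^{p-2} Q_X(u) du`,
with values in `[0, ∞]`. -/
def envelopeNorm (p : ℝ) (μ : Measure Ω) (X : Ω → ℝ) : ℝ≥0∞ :=
  ∫⁻ u in Ioo (0 : ℝ) 1,
    ENNReal.ofReal ((max 1 (normalQuantile (1 - u / 2))) ^ (p - 2) * absQuantile μ X u)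

/-- The iterate `T^i`, `i ∈ ℤ`, of a bijective bimeasurable transformation. -/
def iter (T : Ω ≃ᵐ Ω) (i : ℤ) : Ω → Ω :=
  ⇑((T.toEquiv : Equiv.Perm Ω) ^ i)

/-- The `σ`-algebra `F_i = T^{-i}(F₀)`. -/
@[reducible]
def sigmaAlg {Ω : Type*} (F₀ : MeasurableSpace Ω) {mΩ : MeasurableSpace Ω} (T : Ω ≃ᵐ Ω) (i : ℤ) :
    MeasurableSpace Ω :=
  F₀.comap (iter T i)

/-- The stationary sequence `X_i = X₀ ∘ T^i`. -/
def seq (T : Ω ≃ᵐ Ω) (X₀ : Ω → ℝ) (i : ℤ) : Ω → ℝ :=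
  X₀ ∘ iter T i

/-- The partial sum `S_n = X_1 + ⋯ + X_n`. -/
def partialSum (T : Ω ≃ᵐ Ω) (X₀ : Ω → ℝ) (n : ℕ) (ω : Ω) : ℝ :=
  ∑ i ∈ Finset.Icc 1 n, seq T X₀ (i : ℤ) ω

/-- `(X_i)` is a sequence of martingale differences with respect to `(F_i)`. -/
structure IsMartingaleDiff (μ : Measure Ω) (F : ℤ → MeasurableSpace Ω) (X : ℤ → Ω → ℝ) :
    Prop where
  adapted : ∀ i, Measurable[F i] (X i)
  integrable : ∀ i, Integrable (X i) μ
  condExp_eq_zero : ∀ i, μ[X i | F (i - 1)] =ᵐ[μ] 0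

/-- The random variable `E(S_n² / n | F₀) - σ²`. -/
def condVarDev {Ω : Type*} (F₀ : MeasurableSpace Ω) {mΩ : MeasurableSpace Ω} (μ : Measure Ω)
    (T : Ω ≃ᵐ Ω) (X₀ : Ω → ℝ) (σ : ℝ) (n : ℕ) (ω : Ω) : ℝ :=
  (μ[fun ω' => partialSum T X₀ n ω' ^ 2 / (n : ℝ) | F₀]) ω - σ ^ 2

/-- The law of `n^{-1/2} S_n`. -/
def normalizedLaw (μ : Measure Ω) (T : Ω ≃ᵐ Ω) (X₀ : Ω → ℝ) (n : ℕ) : Measure ℝ :=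
  μ.map (fun ω => (n : ℝ) ^ (-(1 / 2) : ℝ) * partialSum T X₀ n ω)

end

end MartCLT

end

/-! Put v = σ². By scaling it is enough to couple S_n with N(0, nv) at cost of order n^((r-p+2)/2);
the case v = 0 is trivial.

Costs are reached through test functions. Under the comonotone coupling on the line, no point is
crossed both by mass moving right and by mass moving left. The extent of each kind of displacement
is a 1-Lipschitz function `gap`. Powers of the two gaps, regularized when a further derivative is
needed, integrate to a function f of Hölder class r such that f(x) - f(y) dominates a multiple of |x
- y|^r along the coupling (`exists_holder_deriv_test`, `exists_holder_deriv_two_test`). For r ≤ 1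
this role is played by Kantorovich-Rubinstein duality. What remains is to compare E h(S_n) with E
h(N(0, nv)) for h of regularity r.

This is done by Lindeberg replacement (`lindeberg_step`). The martingale property kills the first
order terms, and the Taylor remainders are governed by moduli of continuity of the second
derivatives of the smoothed h. Because v is not the conditional variance, second order terms E
φ''(S_q)(X_{q+1}² - v) survive. Summation by parts along dyadic scales (`sum_mul_eq_dyadic`) pairs
the sum of X² - v over a block with the increment of φ'' over the preceding block. Conditioning on
the past turns the former into a conditional variance deviation, weighted by |R|^(p-2) where R is a
sum over at most one block. Coupling R with a Gaussian variable (`lintegral_rpow_mul_le`) splits the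
weight: the Gaussian part gives the envelope norm by rearrangement, and the error gives, by Hölder,
the L^(p/2) norm times the p-cost of R to the power (p-2)/p. Averaged subadditivity of the
conditional variances and a sum over scales then produce exactly the two series of the hypotheses.

The bound for the p-cost up to time 2^N thus involves p-costs at smaller dyadic scales, but only to
a power less than one. An induction on N with a constant K such that C(1 + K^θ) ≤ K therefore closes
(`exists_bound`).

For r ≤ 2 the test functions are too rough, so they are first smoothed by a Gaussian of variance v,
at bounded expense. At time s the second derivative has modulus of order s^((r-2)/2) min(1, d/√s),
whose sum is of the required order; at (r, p) = (1, 3) the corresponding sum is logarithmic. Orders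
r in (2, p] follow by interpolating between the costs of orders 2 and p. -/

noncomputable section

namespace MartCLT

/-! ### Quantile functions and the comonotone coupling -/

/-- The quantile function of a law on the real line. -/
def quantile (μ : Measure ℝ) (u : ℝ) : ℝ := sInf {x : ℝ | u ≤ cdf μ x}

/-- The uniform law on `(0, 1)`. -/
def unif : Measure ℝ := volume.restrict (Ioo (0 : ℝ) 1)

instance : IsProbabilityMeasure unif := ⟨by simp [unif]⟩

lemma exists_cdf_ge (μ : Measure ℝ) {u : ℝ} (hu : u < 1) : ∃ x, u ≤ cdf μ x :=
  (((tendsto_cdf_atTop μ).eventually (lt_mem_nhds hu)).exists).imp fun _ h => h.le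

lemma bddBelow_cdf_ge (μ : Measure ℝ) {u : ℝ} (hu : 0 < u) :
    BddBelow {x : ℝ | u ≤ cdf μ x} := by
  obtain ⟨b, hb⟩ := ((tendsto_cdf_atBot μ).eventually (gt_mem_nhds hu)).exists
  refine ⟨b, fun x hx => ?_⟩
  by_contra h
  exact absurd (monotone_cdf μ (not_le.1 h).le) (not_le.2 (hb.trans_le hx))

/-- Right continuity of the distribution function makes the infimum attained, hence this Galois
connection; every property of quantiles below comes from it. -/
lemma quantile_le_iff (μ : Measure ℝ) {u : ℝ} (hu : u ∈ Ioo (0 : ℝ) 1) (x : ℝ) :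
    quantile μ u ≤ x ↔ u ≤ cdf μ x := by
  constructor
  · intro h
    have key : ∀ y, x < y → u ≤ cdf μ y := by
      intro y hy
      obtain ⟨z, hz, hzy⟩ := exists_lt_of_csInf_lt (exists_cdf_ge μ hu.2) (lt_of_le_of_lt h hy)
      exact le_trans hz (monotone_cdf μ hzy.le)
    have hcont : ContinuousWithinAt (cdf μ) (Ioi x) x :=
      ((cdf μ).right_continuous x).mono Ioi_subset_Ici_self
    exact ge_of_tendsto hcont (eventually_nhdsWithin_of_forall fun y hy => key y hy)
  · intro h
    exact csInf_le (bddBelow_cdf_ge μ hu.1) h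

lemma quantile_monotoneOn (μ : Measure ℝ) : MonotoneOn (quantile μ) (Ioo 0 1) := by
  intro u hu w hw huw
  rw [quantile_le_iff μ hu]
  exact huw.trans ((quantile_le_iff μ hw _).1 le_rfl)

lemma aemeasurable_quantile (μ : Measure ℝ) : AEMeasurable (quantile μ) unif :=
  aemeasurable_restrict_of_monotoneOn measurableSet_Ioo (quantile_monotoneOn μ)

lemma map_quantile (μ : Measure ℝ) [IsProbabilityMeasure μ] :
    unif.map (quantile μ) = μ := by
  have : IsProbabilityMeasure (unif.map (quantile μ)) :=
    Measure.isProbabilityMeasure_map (aemeasurable_quantile μ)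
  refine Measure.ext_of_Iic _ _ fun x => ?_
  rw [Measure.map_apply_of_aemeasurable (aemeasurable_quantile μ) measurableSet_Iic, unif,
    Measure.restrict_apply' measurableSet_Ioo, ← ofReal_cdf]
  have h : quantile μ ⁻¹' Iic x ∩ Ioo 0 1 = Ioc 0 (cdf μ x) ∩ Ioo 0 1 := by
    ext u
    constructor
    · rintro ⟨h1, h2⟩
      exact ⟨⟨h2.1, (quantile_le_iff μ h2 x).1 h1⟩, h2⟩
    · rintro ⟨h1, h2⟩
      exact ⟨(quantile_le_iff μ h2 x).2 h1.2, h2⟩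
  rw [h]
  have h1 : cdf μ x ≤ 1 := cdf_le_one μ x
  apply le_antisymm
  · calc volume (Ioc 0 (cdf μ x) ∩ Ioo 0 1) ≤ volume (Ioc 0 (cdf μ x)) :=
        measure_mono inter_subset_left
      _ = ENNReal.ofReal (cdf μ x) := by simp
  · calc ENNReal.ofReal (cdf μ x) = volume (Ioo 0 (cdf μ x)) := by simp
      _ ≤ _ := measure_mono fun u hu => by
        exact ⟨⟨hu.1, hu.2.le⟩, hu.1, hu.2.trans_le h1⟩

/-- The comonotone coupling of two laws. -/
def monoCoupling (μ ν : Measure ℝ) : Measure (ℝ × ℝ) :=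
  unif.map fun u => (quantile μ u, quantile ν u)

lemma aemeasurable_quantile_prod (μ ν : Measure ℝ) :
    AEMeasurable (fun u => (quantile μ u, quantile ν u)) unif :=
  (aemeasurable_quantile μ).prodMk (aemeasurable_quantile ν)

lemma monoCoupling_mem (μ ν : Measure ℝ) [IsProbabilityMeasure μ] [IsProbabilityMeasure ν] :
    monoCoupling μ ν ∈ couplings μ ν := by
  constructor
  · rw [monoCoupling, AEMeasurable.map_map_of_aemeasurable measurable_fst.aemeasurable
      (aemeasurable_quantile_prod μ ν)]
    exact map_quantile μ
  · rw [monoCoupling, AEMeasurable.map_map_of_aemeasurable measurable_snd.aemeasurable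
      (aemeasurable_quantile_prod μ ν)]
    exact map_quantile ν

/-- The transport cost of order `r` of the comonotone coupling. -/
def monoCost (r : ℝ) (μ ν : Measure ℝ) : ℝ≥0∞ :=
  ∫⁻ u, ENNReal.ofReal (|quantile μ u - quantile ν u| ^ r) ∂unif

lemma lintegral_monoCoupling (r : ℝ) (μ ν : Measure ℝ) :
    ∫⁻ z, ENNReal.ofReal (|z.1 - z.2| ^ r) ∂(monoCoupling μ ν) = monoCost r μ ν := by
  rw [monoCoupling, lintegral_map' (by fun_prop) (aemeasurable_quantile_prod μ ν)]
  rfl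

/-- A nondegenerate Gaussian law charges every half-line. This keeps `cdf ν z` in the domain of the
quantile functions, which is what makes the gaps below finite. -/
lemma cdf_gaussianReal_mem_Ioo {v : ℝ≥0} (hv : v ≠ 0) (m x : ℝ) :
    cdf (gaussianReal m v) x ∈ Ioo (0 : ℝ) 1 := by
  have key : ∀ s : Set ℝ, 0 < volume s → 0 < (gaussianReal m v).real s := by
    intro s hs
    rw [measureReal_def, ENNReal.toReal_pos_iff]
    refine ⟨pos_iff_ne_zero.2 fun h => ?_, measure_lt_top _ _⟩
    exact hs.ne' (gaussianReal_absolutelyContinuous' m hv h)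
  constructor
  · rw [cdf_eq_real]
    exact key _ (by simp)
  · rw [cdf_eq_real]
    have h := key (Ioi x) (by simp)
    have h2 := probReal_compl_eq_one_sub (μ := gaussianReal m v) (s := Iic x) measurableSet_Iic
    rw [compl_Iic] at h2
    linarith

/-! ### Smooth test functions dominating the comonotone cost -/

/-- The tent function on the interval `[a, b]`. -/
def tent (a b z : ℝ) : ℝ := max 0 (min (z - a) (b - z))

lemma tent_nonneg (a b z : ℝ) : 0 ≤ tent a b z := le_max_left _ _

lemma tent_le_add (a b z w : ℝ) : tent a b z ≤ tent a b w + |z - w| := by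
  unfold tent
  have h1 := le_abs_self (z - w)
  have h2 := neg_abs_le (z - w)
  refine max_le (add_nonneg (le_max_left _ _) (abs_nonneg _)) ?_
  rcases le_total (w - a) (b - w) with h | h
  · have := le_max_right 0 (min (w - a) (b - w))
    rw [min_eq_left h] at this ⊢
    have := min_le_left (z - a) (b - z)
    linarith
  · have := le_max_right 0 (min (w - a) (b - w))
    rw [min_eq_right h] at this ⊢
    have := min_le_right (z - a) (b - z)
    linarith

lemma tent_pos_iff {a b z : ℝ} : 0 < tent a b z ↔ a < z ∧ z < b := by
  simp [tent]

/-- The upper envelope of the tents on the intervals `[x u, y u]`, `u ∈ (0, 1)`. -/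
def gap (x y : ℝ → ℝ) (z : ℝ) : ℝ := ⨆ u : Ioo (0 : ℝ) 1, tent (x u) (y u) z

/-- The tents on the intervals `[x u, y u]` are pointwise bounded. -/
def GapBdd (x y : ℝ → ℝ) : Prop :=
  ∀ z, BddAbove (range fun u : Ioo (0 : ℝ) 1 => tent (x u) (y u) z)

instance : Nonempty (Ioo (0 : ℝ) 1) := ⟨⟨1 / 2, by norm_num, by norm_num⟩⟩

lemma gap_nonneg (x y : ℝ → ℝ) (z : ℝ) : 0 ≤ gap x y z :=
  Real.iSup_nonneg fun _ => tent_nonneg _ _ _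

lemma tent_le_gap {x y : ℝ → ℝ} (h : GapBdd x y) {u : ℝ} (hu : u ∈ Ioo (0 : ℝ) 1) (z : ℝ) :
    tent (x u) (y u) z ≤ gap x y z :=
  le_ciSup (h z) (⟨u, hu⟩ : Ioo (0 : ℝ) 1)

lemma gap_le_add {x y : ℝ → ℝ} (h : GapBdd x y) (z w : ℝ) :
    gap x y z ≤ gap x y w + |z - w| :=
  ciSup_le fun u => (tent_le_add _ _ z w).trans
    (add_le_add_left (tent_le_gap h u.2 w) _)

/-- By monotonicity, an index w ≥ u has x w ≥ x u ≥ z and an index w ≤ u has y w ≤ y u ≤ z, so no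
interval (x w, y w) contains z: mass moving left past z excludes mass moving right past z. -/
lemma gap_eq_zero {x y : ℝ → ℝ} (hx : MonotoneOn x (Ioo 0 1)) (hy : MonotoneOn y (Ioo 0 1))
    {u z : ℝ} (hu : u ∈ Ioo (0 : ℝ) 1) (h1 : y u ≤ z) (h2 : z ≤ x u) : gap x y z = 0 := by
  have : ∀ w : Ioo (0 : ℝ) 1, tent (x w) (y w) z = 0 := by
    intro w
    by_contra hne
    have hpos := lt_of_le_of_ne (tent_nonneg _ _ _) (Ne.symm hne)
    rw [tent_pos_iff] at hpos
    rcases le_total u w with h | h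
    · exact absurd (hx hu w.2 h) (not_le.2 (hpos.1.trans_le h2))
    · exact absurd (hy w.2 hu h) (not_le.2 (h1.trans_lt hpos.2))
  simp [gap, this]

/-- A tent is positive at z only if the ν-quantile exceeds z, that is if u > `cdf ν z`; then the
left endpoint is at least the μ-quantile at `cdf ν z`, uniformly in u. -/
lemma gapBdd_quantile (μ ν : Measure ℝ) (hν : ∀ z, cdf ν z ∈ Ioo (0 : ℝ) 1) :
    GapBdd (quantile μ) (quantile ν) := by
  intro z
  refine ⟨max 0 (z - quantile μ (cdf ν z)), ?_⟩
  rintro _ ⟨u, rfl⟩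
  refine max_le (le_max_left _ _) ?_
  rcases le_or_gt (quantile ν u) z with h | h
  · exact le_trans (min_le_right _ _) (le_trans (by linarith) (le_max_left _ _))
  · have hlt : cdf ν z < u := by
      by_contra hc
      exact absurd ((quantile_le_iff ν u.2 z).2 (not_lt.1 hc)) (not_le.2 h)
    have := quantile_monotoneOn μ (hν z) u.2 hlt.le
    exact le_trans (min_le_left _ _) (le_trans (by linarith) (le_max_right _ _))

lemma gapBdd_quantile' (μ ν : Measure ℝ) (hν : ∀ z, cdf ν z ∈ Ioo (0 : ℝ) 1) :
    GapBdd (quantile ν) (quantile μ) := by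
  intro z
  refine ⟨max 0 (quantile μ (cdf ν z) - z), ?_⟩
  rintro _ ⟨u, rfl⟩
  refine max_le (le_max_left _ _) ?_
  rcases le_or_gt (quantile ν u) z with h | h
  · have := quantile_monotoneOn μ u.2 (hν z) ((quantile_le_iff ν u.2 z).1 h)
    exact le_trans (min_le_right _ _) (le_trans (by linarith) (le_max_right _ _))
  · exact le_trans (min_le_left _ _) (le_trans (by linarith) (le_max_left _ _))

/-- On the middle third of [a, b] the tent is at least (b - a)/3. -/
lemma le_integral_of_tent_le {g : ℝ → ℝ} (hg : Continuous g) (hg0 : ∀ z, 0 ≤ g z) {c ρ a b : ℝ}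
    (hc : 0 ≤ c) (hρ : 0 ≤ ρ) (hab : a ≤ b) (h : ∀ z, c * tent a b z ^ ρ ≤ g z) :
    c * ((b - a) / 3) ^ (ρ + 1) ≤ ∫ z in a..b, g z := by
  set d := (b - a) / 3 with hd
  have hd0 : 0 ≤ d := by rw [hd]; linarith
  have h1 : ∫ z in (a + d)..(b - d), c * d ^ ρ ≤ ∫ z in (a + d)..(b - d), g z := by
    refine intervalIntegral.integral_mono_on (by linarith) (by simp) (hg.intervalIntegrable _ _) ?_
    intro z hz
    refine le_trans ?_ (h z)
    have : d ≤ tent a b z :=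
      le_max_of_le_right (le_min (by linarith [hz.1]) (by linarith [hz.2]))
    gcongr
  have h2 : ∫ z in (a + d)..(b - d), g z ≤ ∫ z in a..b, g z :=
    intervalIntegral.integral_mono_interval (by linarith) (by linarith) (by linarith)
      (ae_of_all _ hg0) (hg.intervalIntegrable _ _)
  refine le_trans (le_of_eq ?_) (h1.trans h2)
  rw [intervalIntegral.integral_const, smul_eq_mul, Real.rpow_add_one' hd0 (by linarith)]
  have : b - d - (a + d) = d := by rw [hd]; ring
  rw [this]; ring

/-- Lower bound for increments of a primitive of `gp - gm` along comonotone pairs. -/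
lemma rpow_abs_sub_le_primitive {x y gp gm : ℝ → ℝ} (hx : MonotoneOn x (Ioo 0 1))
    (hy : MonotoneOn y (Ioo 0 1)) (hxy : GapBdd x y) (hyx : GapBdd y x)
    (hgp : Continuous gp) (hgm : Continuous gm) (hgp0 : ∀ z, 0 ≤ gp z) (hgm0 : ∀ z, 0 ≤ gm z)
    {c ρ : ℝ} (hc : 0 ≤ c) (hρ : 0 ≤ ρ)
    (hp : ∀ z, c * gap x y z ^ ρ ≤ gp z) (hm : ∀ z, c * gap y x z ^ ρ ≤ gm z)
    (hp0 : ∀ z, gap x y z = 0 → gp z = 0) (hm0 : ∀ z, gap y x z = 0 → gm z = 0)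
    {u : ℝ} (hu : u ∈ Ioo (0 : ℝ) 1) :
    c * (|x u - y u| / 3) ^ (ρ + 1) ≤ ∫ z in (x u)..(y u), (gp z - gm z) := by
  rcases le_total (x u) (y u) with h | h
  · rw [abs_sub_comm, abs_of_nonneg (by linarith)]
    refine (le_integral_of_tent_le hgp hgp0 hc hρ h fun z => ?_).trans (le_of_eq ?_)
    · refine le_trans ?_ (hp z)
      have := tent_le_gap hxy hu z
      have := tent_nonneg (x u) (y u) z
      gcongr
    -- Between x u and y u the gap of the opposite direction vanishes, so nothing is lost by
    -- subtracting `gm`.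
    · refine intervalIntegral.integral_congr fun z hz => ?_
      rw [uIcc_of_le h] at hz
      simp [hm0 z (gap_eq_zero hy hx hu hz.1 hz.2)]
  · rw [abs_of_nonneg (by linarith)]
    rw [intervalIntegral.integral_symm, ← intervalIntegral.integral_neg]
    refine (le_integral_of_tent_le hgm hgm0 hc hρ h fun z => ?_).trans (le_of_eq ?_)
    · refine le_trans ?_ (hm z)
      have := tent_le_gap hyx hu z
      have := tent_nonneg (y u) (x u) z
      gcongr
    · refine intervalIntegral.integral_congr fun z hz => ?_
      rw [uIcc_of_le h] at hz
      simp [hp0 z (gap_eq_zero hx hy hu hz.1 hz.2)]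

lemma abs_rpow_sub_rpow_le {a b ρ : ℝ} (ha : 0 ≤ a) (hb : 0 ≤ b) (hρ : 0 < ρ) (hρ1 : ρ ≤ 1) :
    |a ^ ρ - b ^ ρ| ≤ |a - b| ^ ρ := by
  wlog hab : b ≤ a generalizing a b
  · rw [abs_sub_comm, abs_sub_comm a b]
    exact this hb ha (not_le.1 hab).le
  rw [abs_of_nonneg (sub_nonneg.2 (Real.rpow_le_rpow hb hab hρ.le)), abs_of_nonneg (by linarith)]
  have := Real.rpow_add_le_add_rpow (sub_nonneg.2 hab) hb hρ.le hρ1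
  rw [sub_add_cancel] at this
  linarith

lemma abs_gap_sub_le {x y : ℝ → ℝ} (h : GapBdd x y) (z w : ℝ) :
    |gap x y z - gap x y w| ≤ |z - w| := by
  have h1 := gap_le_add h z w
  have h2 := gap_le_add h w z
  rw [abs_sub_comm w z] at h2
  exact abs_le.2 ⟨by linarith, by linarith⟩

lemma continuous_gap {x y : ℝ → ℝ} (h : GapBdd x y) : Continuous (gap x y) := by
  have : LipschitzWith 1 (gap x y) := LipschitzWith.of_dist_le_mul fun z w => by
    simpa [Real.dist_eq] using abs_gap_sub_le h z w
  exact this.continuous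

/-- For `1 < r ≤ 2`, a function with `(r - 1)`-Hölder derivative whose increments dominate
the cost of the comonotone coupling. -/
theorem exists_holder_deriv_test {r : ℝ} (hr : r ∈ Ioc (1 : ℝ) 2) (μ ν : Measure ℝ)
    (hν : ∀ z, cdf ν z ∈ Ioo (0 : ℝ) 1) :
    ∃ f g : ℝ → ℝ, (∀ z, HasDerivAt f (g z) z) ∧
      (∀ z w, |g z - g w| ≤ 2 * |z - w| ^ (r - 1)) ∧
      ∀ u ∈ Ioo (0 : ℝ) 1, (|quantile μ u - quantile ν u| / 3) ^ r ≤
        f (quantile μ u) - f (quantile ν u) := by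
  have hr0 : 0 < r - 1 := by linarith [hr.1]
  have hr1 : r - 1 ≤ 1 := by linarith [hr.2]
  have h1 := gapBdd_quantile μ ν hν
  have h2 := gapBdd_quantile' μ ν hν
  set x := quantile μ
  set y := quantile ν
  set gp := fun z => gap x y z ^ (r - 1)
  set gm := fun z => gap y x z ^ (r - 1)
  have cgp : Continuous gp := (continuous_gap h1).rpow_const fun _ => Or.inr hr0.le
  have cgm : Continuous gm := (continuous_gap h2).rpow_const fun _ => Or.inr hr0.le
  have hcont : Continuous fun z => gp z - gm z := cgp.sub cgm
  -- The minus sign makes f(x u) - f(y u) the integral of `gp - gm` from x u to y u.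
  refine ⟨fun z => -∫ t in (0 : ℝ)..z, (gp t - gm t), fun z => -(gp z - gm z), fun z => ?_,
    fun z w => ?_, fun u hu => ?_⟩
  · exact (hcont.integral_hasStrictDerivAt 0 z).hasDerivAt.neg
  · have a1 := abs_rpow_sub_rpow_le (gap_nonneg x y z) (gap_nonneg x y w) hr0 hr1
    have a2 := abs_rpow_sub_rpow_le (gap_nonneg y x z) (gap_nonneg y x w) hr0 hr1
    have b1 := Real.rpow_le_rpow (abs_nonneg _) (abs_gap_sub_le h1 z w) hr0.le
    have b2 := Real.rpow_le_rpow (abs_nonneg _) (abs_gap_sub_le h2 z w) hr0.le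
    calc |-(gp z - gm z) - -(gp w - gm w)| = |(gm z - gm w) - (gp z - gp w)| := by ring_nf
      _ ≤ |gm z - gm w| + |gp z - gp w| := abs_sub _ _
      _ ≤ _ := by linarith
  · have key := rpow_abs_sub_le_primitive (quantile_monotoneOn μ) (quantile_monotoneOn ν) h1 h2
      cgp cgm (fun z => Real.rpow_nonneg (gap_nonneg _ _ _) _)
      (fun z => Real.rpow_nonneg (gap_nonneg _ _ _) _) (c := 1) zero_le_one hr0.le
      (fun z => by simp [gp, x, y]) (fun z => by simp [gm, x, y])
      (fun z hz => by simp only [gp, x, y, hz]; exact Real.zero_rpow hr0.ne')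
      (fun z hz => by simp only [gm, x, y, hz]; exact Real.zero_rpow hr0.ne') hu
    rw [one_mul, sub_add_cancel] at key
    refine key.trans (le_of_eq ?_)
    rw [← intervalIntegral.integral_interval_sub_left (hcont.intervalIntegrable 0 _)
      (hcont.intervalIntegrable 0 _)]
    ring

/-! ### Regularization of nonnegative Lipschitz functions -/

/-- A continuously differentiable bump supported in `[-1, 1]`. -/
def bump (s : ℝ) : ℝ := max 0 (1 - s ^ 2) ^ 2

/-- The derivative of `bump`. -/
def bumpDeriv (s : ℝ) : ℝ := -4 * (s * max 0 (1 - s ^ 2))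

lemma hasDerivAt_max_zero_sq (t : ℝ) : HasDerivAt (fun t : ℝ => max 0 t ^ 2) (2 * max 0 t) t := by
  rcases lt_trichotomy t 0 with h | h | h
  · rw [max_eq_left h.le, mul_zero]
    refine (hasDerivAt_const t (0 : ℝ)).congr_of_eventuallyEq ?_
    filter_upwards [Iio_mem_nhds h] with s hs
    simp [max_eq_left (le_of_lt (mem_Iio.1 hs))]
  · subst h
    rw [hasDerivAt_iff_isLittleO]
    simp only [max_self, ne_eq, OfNat.ofNat_ne_zero, not_false_eq_true, zero_pow, sub_zero, mul_zero,
      smul_zero]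
    refine IsBigO.trans_isLittleO (g := fun s : ℝ => s ^ 2) ?_ ?_
    · refine IsBigO.of_bound 1 (Eventually.of_forall fun s => ?_)
      rw [one_mul, Real.norm_eq_abs, Real.norm_eq_abs, abs_of_nonneg (sq_nonneg _),
        abs_of_nonneg (sq_nonneg _)]
      rcases le_total 0 s with h | h
      · rw [max_eq_right h]
      · rw [max_eq_left h]; nlinarith [sq_nonneg s]
    · exact isLittleO_pow_id one_lt_two
  · rw [max_eq_right h.le]
    have : HasDerivAt (fun s : ℝ => s ^ 2) (2 * t) t := by simpa using hasDerivAt_pow 2 t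
    refine this.congr_of_eventuallyEq ?_
    filter_upwards [Ioi_mem_nhds h] with s hs
    rw [max_eq_right (le_of_lt (mem_Ioi.1 hs))]

lemma hasDerivAt_bump (s : ℝ) : HasDerivAt bump (bumpDeriv s) s := by
  have h1 : HasDerivAt (fun s : ℝ => 1 - s ^ 2) (-(2 * s)) s := by
    simpa using (hasDerivAt_pow 2 s).const_sub 1
  have := (hasDerivAt_max_zero_sq (1 - s ^ 2)).comp s h1
  refine this.congr_deriv ?_
  unfold bumpDeriv
  ring

lemma bump_nonneg (s : ℝ) : 0 ≤ bump s := sq_nonneg _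

lemma bump_eq_zero {s : ℝ} (h : 1 ≤ |s|) : bump s = 0 := by
  have : 1 ≤ s ^ 2 := by rw [← sq_abs]; nlinarith
  simp [bump, max_eq_left (sub_nonpos.2 this)]

lemma bumpDeriv_eq_zero {s : ℝ} (h : 1 ≤ |s|) : bumpDeriv s = 0 := by
  have : 1 ≤ s ^ 2 := by rw [← sq_abs]; nlinarith
  simp [bumpDeriv, max_eq_left (sub_nonpos.2 this)]

lemma bumpDeriv_of_abs_le {s : ℝ} (h : |s| ≤ 1) : bumpDeriv s = -4 * (s * (1 - s ^ 2)) := by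
  have : s ^ 2 ≤ 1 := by rw [← sq_abs]; nlinarith [abs_nonneg s]
  simp [bumpDeriv, max_eq_right (sub_nonneg.2 this)]

lemma abs_bumpDeriv_le (s : ℝ) : |bumpDeriv s| ≤ 4 := by
  rcases le_total 1 |s| with h | h
  · rw [bumpDeriv_eq_zero h]; norm_num
  · have h2 : s ^ 2 ≤ 1 := by rw [← sq_abs]; nlinarith [abs_nonneg s]
    rw [bumpDeriv_of_abs_le h, abs_mul, abs_mul, abs_of_nonneg (sub_nonneg.2 h2)]
    norm_num
    nlinarith [abs_nonneg s, sq_nonneg s]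

lemma abs_bumpDeriv_sub_le_mul (s t : ℝ) : |bumpDeriv s - bumpDeriv t| ≤ 8 * |s - t| := by
  wlog hst : |s| ≤ |t| generalizing s t
  · rw [abs_sub_comm, abs_sub_comm s t]
    exact this t s (le_of_not_ge hst)
  rcases le_total |t| 1 with h | h
  · have hs := hst.trans h
    rw [bumpDeriv_of_abs_le h, bumpDeriv_of_abs_le hs]
    have : -4 * (s * (1 - s ^ 2)) - -4 * (t * (1 - t ^ 2)) =
        4 * ((s ^ 2 + s * t + t ^ 2 - 1) * (s - t)) := by ring
    rw [this, abs_mul, abs_mul]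
    have h1 := abs_le.1 h
    have h2 := abs_le.1 hs
    have h3 : |s ^ 2 + s * t + t ^ 2 - 1| ≤ 2 := abs_le.2 ⟨by nlinarith [sq_nonneg (s + t)],
      by nlinarith⟩
    have := mul_le_mul_of_nonneg_right h3 (abs_nonneg (s - t))
    norm_num
    linarith
  · rw [bumpDeriv_eq_zero h, sub_zero]
    rcases le_total 1 |s| with hs | hs
    · rw [bumpDeriv_eq_zero hs, abs_zero]; positivity
    · have h2 : s ^ 2 ≤ 1 := by rw [← sq_abs]; nlinarith [abs_nonneg s]
      rw [bumpDeriv_of_abs_le hs, abs_mul, abs_mul, abs_of_nonneg (sub_nonneg.2 h2)]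
      have h3 : |t| - |s| ≤ |s - t| := by
        rw [abs_sub_comm]; exact abs_sub_abs_le_abs_sub t s
      have h4 : |s| * (1 - s ^ 2) ≤ 2 * (1 - |s|) := by
        rw [← sq_abs]
        nlinarith [abs_nonneg s, mul_nonneg (abs_nonneg s) (sub_nonneg.2 hs)]
      norm_num
      linarith

lemma abs_bumpDeriv_sub_le {α : ℝ} (hα : α ∈ Ioc (0 : ℝ) 1) (s t : ℝ) :
    |bumpDeriv s - bumpDeriv t| ≤ 8 * |s - t| ^ α := by
  rcases le_total |s - t| 1 with h | h
  · refine (abs_bumpDeriv_sub_le_mul s t).trans ?_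
    gcongr
    calc |s - t| = |s - t| ^ (1 : ℝ) := (Real.rpow_one _).symm
      _ ≤ _ := Real.rpow_le_rpow_of_exponent_ge' (abs_nonneg _) h hα.1.le hα.2
  · have h1 := abs_sub (bumpDeriv s) (bumpDeriv t)
    have h2 := abs_bumpDeriv_le s
    have h3 := abs_bumpDeriv_le t
    have h4 := Real.one_le_rpow h hα.1.le
    linarith

/-- Mean value inequality for `bump` minus its tangent at s, whose derivative is controlled by the
Hölder bound for `bumpDeriv`. -/
lemma abs_bump_taylor_le {α : ℝ} (hα : α ∈ Ioc (0 : ℝ) 1) (s t : ℝ) :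
    |bump t - bump s - (t - s) * bumpDeriv s| ≤ 8 * |t - s| ^ (1 + α) := by
  have h := Convex.norm_image_sub_le_of_norm_hasDerivWithin_le
    (f := fun z => bump z - z * bumpDeriv s) (f' := fun z => bumpDeriv z - bumpDeriv s)
    (s := uIcc s t) (C := 8 * |t - s| ^ α) (x := s) (y := t)
    (fun z _ => ((hasDerivAt_bump z).sub
      ((hasDerivAt_id z).mul_const _ |>.congr_deriv (one_mul _))).hasDerivWithinAt)
    (fun z hz => ?_) (convex_uIcc s t) left_mem_uIcc right_mem_uIcc
  · rw [Real.norm_eq_abs, Real.norm_eq_abs] at h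
    calc _ = |bump t - t * bumpDeriv s - (bump s - s * bumpDeriv s)| := by ring_nf
      _ ≤ _ := h
      _ = _ := by
        rw [add_comm, Real.rpow_add_one' (abs_nonneg _) (by linarith [hα.1])]; ring
  · refine (abs_bumpDeriv_sub_le hα z s).trans ?_
    have : |z - s| ≤ |t - s| := by
      rw [abs_sub_comm t s, abs_sub_comm z s]
      have := abs_sub_left_of_mem_uIcc hz
      rwa [abs_sub_comm z s, abs_sub_comm t s] at this
    have := hα.1
    gcongr

/-- A nonnegative function with Lipschitz constant one. -/
structure IsLipGap (δ : ℝ → ℝ) : Prop where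
  nonneg : ∀ z, 0 ≤ δ z
  le_add : ∀ z w, δ z ≤ δ w + |z - w|

namespace IsLipGap

variable {δ : ℝ → ℝ} (hδ : IsLipGap δ)

/-- The points `c` whose rescaled bump sees `x`. -/
def nbhd (δ : ℝ → ℝ) (x : ℝ) : Set ℝ := {c | |x - c| < δ c / 2}

include hδ

lemma continuous : Continuous δ := by
  have : LipschitzWith 1 δ := LipschitzWith.of_dist_le_mul fun z w => by
    rw [Real.dist_eq, Real.dist_eq, NNReal.coe_one, one_mul]
    have h1 := hδ.le_add z w
    have h2 := hδ.le_add w z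
    rw [abs_sub_comm w z] at h2
    exact abs_le.2 ⟨by linarith, by linarith⟩
  exact this.continuous

lemma measurableSet_nbhd (x : ℝ) : MeasurableSet (nbhd δ x) := by
  have := hδ.continuous
  exact (isOpen_lt (by fun_prop) (by fun_prop)).measurableSet

/-- The Lipschitz property makes δ(c) and δ(x) comparable as soon as the bump at c sees x, so every
estimate can be made at the single scale δ(x). -/
lemma of_mem_nbhd {x c : ℝ} (h : c ∈ nbhd δ x) :
    0 < δ x ∧ 2 / 3 * δ x ≤ δ c ∧ δ c ≤ 2 * δ x ∧ c ∈ Icc (x - δ x) (x + δ x) := by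
  have h0 : |x - c| < δ c / 2 := h
  have h1 := hδ.le_add x c
  have h2 := hδ.le_add c x
  rw [abs_sub_comm c x] at h2
  have h3 := abs_nonneg (x - c)
  have h4 := abs_lt.1 h0
  refine ⟨by linarith, by linarith, by linarith, by linarith, by linarith⟩

lemma measureReal_nbhd_le (x : ℝ) : volume.real (nbhd δ x) ≤ 2 * δ x := by
  have : nbhd δ x ⊆ Icc (x - δ x) (x + δ x) := fun c hc => (hδ.of_mem_nbhd hc).2.2.2
  refine (measureReal_mono this (by simp)).trans (le_of_eq ?_)
  rw [Real.volume_real_Icc_of_le (by linarith [hδ.nonneg x])]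
  ring

lemma volume_nbhd_lt_top (x : ℝ) : volume (nbhd δ x) < ∞ := by
  have : nbhd δ x ⊆ Icc (x - δ x) (x + δ x) := fun c hc => (hδ.of_mem_nbhd hc).2.2.2
  exact (measure_mono this).trans_lt (by simp)

lemma div_le_of_mem_nbhd {x c M : ℝ} (hM : 0 ≤ M) (h : c ∈ nbhd δ x) :
    M / δ c ≤ M * (3 / (2 * δ x)) := by
  obtain ⟨h0, h1, -, -⟩ := hδ.of_mem_nbhd h
  rw [div_eq_mul_inv]
  refine mul_le_mul_of_nonneg_left ?_ hM
  rw [inv_le_comm₀ (by linarith) (by positivity)]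
  refine le_trans (le_of_eq ?_) h1
  field_simp

/-- The relevant c fill a set of length at most 2 δ(x) on which 1/δ(c) ≤ 3/(2 δ(x)). The scale
cancels, so a pointwise bound M/δ(c) integrates to a multiple of M. -/
lemma norm_setIntegral_le {Ψ : ℝ → ℝ} {M : ℝ} (hM : 0 ≤ M) (x : ℝ) {s : Set ℝ}
    (hs : s ⊆ nbhd δ x) (hΨ : ∀ c ∈ s, |Ψ c| ≤ M / δ c) : ‖∫ c in s, Ψ c‖ ≤ 3 * M := by
  rcases (hδ.nonneg x).eq_or_lt with h0 | h0
  · have : s = ∅ := by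
      refine eq_empty_of_forall_notMem fun c hc => ?_
      have := (hδ.of_mem_nbhd (hs hc)).1
      linarith
    simp only [this, Measure.restrict_empty, integral_zero_measure, norm_zero]
    positivity
  · refine (norm_setIntegral_le_of_norm_le_const (C := M * (3 / (2 * δ x)))
      ((measure_mono hs).trans_lt (hδ.volume_nbhd_lt_top x)) fun c hc =>
        (hΨ c hc).trans (hδ.div_le_of_mem_nbhd hM (hs hc))).trans ?_
    have : volume.real s ≤ 2 * δ x :=
      (measureReal_mono hs (hδ.volume_nbhd_lt_top x).ne).trans (hδ.measureReal_nbhd_le x)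
    calc M * (3 / (2 * δ x)) * volume.real s ≤ M * (3 / (2 * δ x)) * (2 * δ x) := by gcongr
      _ = 3 * M := by field_simp

lemma integrable_of_support {Ψ : ℝ → ℝ} (hm : Measurable Ψ) {M : ℝ} (x : ℝ)
    (hsupp : ∀ c ∉ nbhd δ x, Ψ c = 0) (hb : ∀ c ∈ nbhd δ x, |Ψ c| ≤ M) : Integrable Ψ := by
  have : IntegrableOn Ψ (nbhd δ x) :=
    Measure.integrableOn_of_bounded (M := M) (hδ.volume_nbhd_lt_top x).ne
      hm.aestronglyMeasurable ((ae_restrict_iff' (hδ.measurableSet_nbhd x)).2 (ae_of_all _ hb))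
  exact (integrableOn_iff_integrable_of_support_subset fun c hc => by
    by_contra h; exact hc (hsupp c h)).1 this

lemma norm_integral_le {Ψ : ℝ → ℝ} (hint : Integrable Ψ) {M : ℝ} (hM : 0 ≤ M) (x y : ℝ)
    (hΨ : ∀ c ∈ nbhd δ x ∪ nbhd δ y, |Ψ c| ≤ M / δ c)
    (hsupp : ∀ c ∉ nbhd δ x ∪ nbhd δ y, Ψ c = 0) : ‖∫ c, Ψ c‖ ≤ 6 * M := by
  have hmx := hδ.measurableSet_nbhd x
  have hmy := hδ.measurableSet_nbhd y
  have h1 : ∫ c, Ψ c = ∫ c in nbhd δ x ∪ nbhd δ y, Ψ c :=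
    (setIntegral_eq_integral_of_forall_compl_eq_zero hsupp).symm
  have h2 : nbhd δ x ∪ nbhd δ y = nbhd δ x ∪ (nbhd δ y \ nbhd δ x) := by simp
  rw [h1, h2, setIntegral_union disjoint_sdiff_right (hmy.diff hmx) hint.integrableOn
    hint.integrableOn]
  refine (norm_add_le _ _).trans ?_
  have a1 := hδ.norm_setIntegral_le hM x subset_rfl fun c hc => hΨ c (Or.inl hc)
  have a2 := hδ.norm_setIntegral_le hM y (sdiff_subset (t := nbhd δ x))
    fun c hc => hΨ c (Or.inr hc.1)
  linarith

omit hδ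

/-- The regularization, of order `δ ^ (α + 1)`. -/
def reg (δ : ℝ → ℝ) (α x : ℝ) : ℝ := ∫ c, δ c ^ α * bump (2 * (x - c) / δ c)

/-- The derivative of the regularization. -/
def regDeriv (δ : ℝ → ℝ) (α x : ℝ) : ℝ :=
  ∫ c, 2 * δ c ^ (α - 1) * bumpDeriv (2 * (x - c) / δ c)

variable {α : ℝ} (hα : α ∈ Ioc (0 : ℝ) 1)

lemma one_le_abs_of_notMem {x c : ℝ} (h : c ∉ nbhd δ x) (hc : 0 < δ c) :
    1 ≤ |2 * (x - c) / δ c| := by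
  rw [abs_div, abs_mul, abs_of_pos hc, le_div_iff₀ hc, abs_two]
  have : ¬ |x - c| < δ c / 2 := h
  linarith

include hδ hα

lemma reg_integrand_eq_zero {x c : ℝ} (h : c ∉ nbhd δ x) :
    δ c ^ α * bump (2 * (x - c) / δ c) = 0 := by
  rcases (hδ.nonneg c).eq_or_lt with h0 | h0
  · rw [← h0, Real.zero_rpow hα.1.ne', zero_mul]
  · rw [bump_eq_zero (one_le_abs_of_notMem h h0), mul_zero]

omit hα in
lemma regDeriv_integrand_eq_zero {x c : ℝ} (h : c ∉ nbhd δ x) :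
    2 * δ c ^ (α - 1) * bumpDeriv (2 * (x - c) / δ c) = 0 := by
  rcases (hδ.nonneg c).eq_or_lt with h0 | h0
  · simp [← h0, bumpDeriv]
  · rw [bumpDeriv_eq_zero (one_le_abs_of_notMem h h0), mul_zero]

lemma integrable_reg (x : ℝ) : Integrable fun c => δ c ^ α * bump (2 * (x - c) / δ c) := by
  have hm : Measurable δ := hδ.continuous.measurable
  refine hδ.integrable_of_support (M := (2 * δ x) ^ α) ?_ x
    (fun c hc => hδ.reg_integrand_eq_zero hα hc) fun c hc => ?_
  · unfold bump; fun_prop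
  · obtain ⟨h0, h1, h2, -⟩ := hδ.of_mem_nbhd hc
    have hb : bump (2 * (x - c) / δ c) ≤ 1 := by
      unfold bump
      refine pow_le_one₀ (le_max_left _ _) (max_le zero_le_one ?_)
      linarith [sq_nonneg (2 * (x - c) / δ c)]
    have h3 := bump_nonneg (2 * (x - c) / δ c)
    have h4 := Real.rpow_nonneg (hδ.nonneg c) α
    rw [abs_of_nonneg (mul_nonneg h4 h3)]
    have h5 := Real.rpow_le_rpow (hδ.nonneg c) h2 hα.1.le
    nlinarith

lemma integrable_regDeriv (x : ℝ) :
    Integrable fun c => 2 * δ c ^ (α - 1) * bumpDeriv (2 * (x - c) / δ c) := by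
  have hm : Measurable δ := hδ.continuous.measurable
  refine hδ.integrable_of_support (M := 2 * (2 / 3 * δ x) ^ (α - 1) * 4) ?_ x
    (fun c hc => hδ.regDeriv_integrand_eq_zero hc) fun c hc => ?_
  · unfold bumpDeriv; fun_prop
  · obtain ⟨h0, h1, h2, -⟩ := hδ.of_mem_nbhd hc
    have h5 := Real.rpow_le_rpow_of_nonpos (by positivity) h1 (by linarith [hα.2] : α - 1 ≤ 0)
    have h6 := abs_bumpDeriv_le (2 * (x - c) / δ c)
    have h4 := Real.rpow_nonneg (hδ.nonneg c) (α - 1)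
    rw [abs_mul, abs_mul, abs_of_nonneg h4, abs_two]
    gcongr

omit hδ hα in
lemma pos_of_mem_union {x y c : ℝ} (h : c ∈ nbhd δ x ∪ nbhd δ y) : 0 < δ c := by
  have : ∀ z, c ∈ nbhd δ z → 0 < δ c := fun z hz => by
    have : |z - c| < δ c / 2 := hz
    linarith [abs_nonneg (z - c)]
  exact h.elim (this x) (this y)

/-- The α-Hölder bound for `bumpDeriv` at scale δ(c) gives 2 δ(c)^(α-1) · 8 · (2|x - y|/δ(c))^α ≤ 32
|x - y|^α/δ(c), and `norm_integral_le` contributes the factor 6. -/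
lemma abs_regDeriv_sub_le (x y : ℝ) :
    |regDeriv δ α x - regDeriv δ α y| ≤ 192 * |x - y| ^ α := by
  unfold regDeriv
  rw [← integral_sub (hδ.integrable_regDeriv hα x) (hδ.integrable_regDeriv hα y)]
  refine (hδ.norm_integral_le ((hδ.integrable_regDeriv hα x).sub (hδ.integrable_regDeriv hα y))
    (M := 32 * |x - y| ^ α) (by positivity) x y (fun c hc => ?_) fun c hc => ?_).trans
      (le_of_eq (by ring))
  · have h0 := pos_of_mem_union hc
    rw [Pi.sub_apply, ← mul_sub, abs_mul, abs_mul, abs_two,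
      abs_of_nonneg (Real.rpow_nonneg h0.le _)]
    have h1 := abs_bumpDeriv_sub_le hα (2 * (x - c) / δ c) (2 * (y - c) / δ c)
    have h2 : |2 * (x - c) / δ c - 2 * (y - c) / δ c| = 2 * |x - y| / δ c := by
      rw [← sub_div, abs_div, abs_of_pos h0, ← mul_sub, abs_mul, abs_two]
      congr 3; ring
    rw [h2, Real.div_rpow (by positivity) h0.le, Real.mul_rpow zero_le_two (abs_nonneg _)] at h1
    have h3 : (2 : ℝ) ^ α ≤ 2 := by
      calc (2 : ℝ) ^ α ≤ 2 ^ (1 : ℝ) := Real.rpow_le_rpow_of_exponent_le one_le_two hα.2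
        _ = 2 := Real.rpow_one 2
    have h4 : (0 : ℝ) ≤ |x - y| ^ α := by positivity
    have h5 : (0 : ℝ) < δ c ^ α := by positivity
    calc 2 * δ c ^ (α - 1) * |bumpDeriv (2 * (x - c) / δ c) - bumpDeriv (2 * (y - c) / δ c)|
        ≤ 2 * δ c ^ (α - 1) * (8 * (2 ^ α * |x - y| ^ α / δ c ^ α)) := by gcongr
      _ ≤ 2 * δ c ^ (α - 1) * (8 * (2 * |x - y| ^ α / δ c ^ α)) := by gcongr
      _ = 32 * |x - y| ^ α / δ c := by
        rw [Real.rpow_sub_one h0.ne']; field_simp; ring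
  · rw [mem_union, not_or] at hc
    rw [Pi.sub_apply, hδ.regDeriv_integrand_eq_zero hc.1, hδ.regDeriv_integrand_eq_zero hc.2,
      sub_zero]

/-- The same estimate for the Taylor remainder of each bump. It yields the derivative of `reg`
directly, without differentiating under an integral whose integrand is singular where δ vanishes. -/
lemma abs_reg_taylor_le (x y : ℝ) :
    |reg δ α y - reg δ α x - (y - x) * regDeriv δ α x| ≤ 192 * |y - x| ^ (1 + α) := by
  unfold reg regDeriv
  have i1 := hδ.integrable_reg hα x
  have i2 := hδ.integrable_reg hα y
  have i3 := (hδ.integrable_regDeriv hα x).const_mul (y - x)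
  rw [← integral_const_mul, ← integral_sub i2 i1, ← integral_sub (by exact i2.sub i1) i3]
  refine (hδ.norm_integral_le ((i2.sub i1).sub i3)
    (M := 32 * |y - x| ^ (1 + α)) (by positivity) x y (fun c hc => ?_) fun c hc => ?_).trans
      (le_of_eq (by ring))
  · have h0 := pos_of_mem_union hc
    have h1 := abs_bump_taylor_le hα (2 * (x - c) / δ c) (2 * (y - c) / δ c)
    have h2 : 2 * (y - c) / δ c - 2 * (x - c) / δ c = 2 * (y - x) / δ c := by
      rw [← sub_div]; ring
    have h2' : |2 * (y - x) / δ c| = 2 * |y - x| / δ c := by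
      rw [abs_div, abs_of_pos h0, abs_mul, abs_two]
    rw [h2, h2', Real.div_rpow (by positivity) h0.le, Real.mul_rpow zero_le_two (abs_nonneg _)] at h1
    have h3 : (2 : ℝ) ^ (1 + α) ≤ 4 := by
      calc (2 : ℝ) ^ (1 + α) ≤ 2 ^ (2 : ℝ) :=
            Real.rpow_le_rpow_of_exponent_le one_le_two (by linarith [hα.2])
        _ = 4 := by norm_num
    have h4 : (0 : ℝ) ≤ |y - x| ^ (1 + α) := by positivity
    have h5 : (0 : ℝ) < δ c ^ α := by positivity
    have e : δ c ^ α * bump (2 * (y - c) / δ c) - δ c ^ α * bump (2 * (x - c) / δ c) -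
        (y - x) * (2 * δ c ^ (α - 1) * bumpDeriv (2 * (x - c) / δ c)) =
        δ c ^ α * (bump (2 * (y - c) / δ c) - bump (2 * (x - c) / δ c) -
          2 * (y - x) / δ c * bumpDeriv (2 * (x - c) / δ c)) := by
      rw [Real.rpow_sub_one h0.ne']; field_simp
    simp only [Pi.sub_apply]
    rw [e, abs_mul, abs_of_pos h5]
    calc _ ≤ δ c ^ α * (8 * (2 ^ (1 + α) * |y - x| ^ (1 + α) / δ c ^ (1 + α))) := by gcongr
      _ ≤ δ c ^ α * (8 * (4 * |y - x| ^ (1 + α) / δ c ^ (1 + α))) := by gcongr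
      _ = 32 * |y - x| ^ (1 + α) / δ c := by
        rw [Real.rpow_add h0 1 α, Real.rpow_one]; field_simp; ring
  · rw [mem_union, not_or] at hc
    simp only [Pi.sub_apply]
    rw [hδ.regDeriv_integrand_eq_zero hc.1, hδ.reg_integrand_eq_zero hα hc.1,
      hδ.reg_integrand_eq_zero hα hc.2]
    simp

lemma hasDerivAt_reg (x : ℝ) : HasDerivAt (reg δ α) (regDeriv δ α x) x := by
  rw [hasDerivAt_iff_isLittleO]
  refine IsBigO.trans_isLittleO (g := fun y : ℝ => |y - x| ^ (1 + α)) ?_ ?_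
  · refine IsBigO.of_bound 192 (Eventually.of_forall fun y => ?_)
    rw [Real.norm_eq_abs, Real.norm_eq_abs, smul_eq_mul,
      abs_of_nonneg (by positivity : (0 : ℝ) ≤ |y - x| ^ (1 + α))]
    exact hδ.abs_reg_taylor_le hα x y
  · have h : Tendsto (fun y : ℝ => |y - x| ^ α) (nhds x) (nhds 0) := by
      have : ContinuousAt (fun y : ℝ => |y - x| ^ α) x :=
        ContinuousAt.rpow_const (by fun_prop) (Or.inr hα.1.le)
      simpa [ContinuousAt, Real.zero_rpow hα.1.ne'] using this
    have h2 : (fun y : ℝ => |y - x| ^ (1 + α)) = fun y => |y - x| ^ α * |y - x| := by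
      ext y
      rw [add_comm, Real.rpow_add_one' (abs_nonneg _) (by linarith [hα.1])]
    rw [h2]
    have h3 : (fun y : ℝ => |y - x| ^ α) =o[nhds x] fun _ => (1 : ℝ) :=
      (isLittleO_one_iff ℝ).2 h
    have h4 : (fun y : ℝ => |y - x|) =O[nhds x] fun y => y - x :=
      (isBigO_refl _ _).abs_left
    simpa using h3.mul_isBigO h4

omit hα in
lemma reg_nonneg (x : ℝ) : 0 ≤ reg δ α x :=
  integral_nonneg fun c => mul_nonneg (Real.rpow_nonneg (hδ.nonneg c) _) (bump_nonneg _)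

lemma reg_eq_zero {x : ℝ} (hx : δ x = 0) : reg δ α x = 0 := by
  unfold reg
  rw [integral_eq_zero_of_ae (ae_of_all _ fun c => ?_)]
  refine hδ.reg_integrand_eq_zero hα fun hc => ?_
  have := (hδ.of_mem_nbhd hc).1
  linarith

/-- For |x - c| ≤ δ(x)/8 one has δ(c) ≥ 7δ(x)/8 and the bump is at least 1/2, so the integrand is at
least δ(x)^α/4 on an interval of length δ(x)/4. -/
lemma rpow_le_reg (x : ℝ) : 1 / 16 * δ x ^ (α + 1) ≤ reg δ α x := by
  rcases (hδ.nonneg x).eq_or_lt with h0 | h0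
  · rw [← h0, Real.zero_rpow (by linarith [hα.1]), mul_zero]
    exact hδ.reg_nonneg x
  have h1 : ∫ c in Icc (x - δ x / 8) (x + δ x / 8), (1 / 4 * δ x ^ α : ℝ) ≤
      ∫ c in Icc (x - δ x / 8) (x + δ x / 8), δ c ^ α * bump (2 * (x - c) / δ c) := by
    refine setIntegral_mono_on (integrableOn_const (by simp)) (hδ.integrable_reg hα x).integrableOn
      measurableSet_Icc fun c hc => ?_
    have hxc : |x - c| ≤ δ x / 8 := abs_le.2 ⟨by linarith [hc.2], by linarith [hc.1]⟩
    have h2 : 7 / 8 * δ x ≤ δ c := by linarith [hδ.le_add x c]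
    have h3 : (1 / 2 : ℝ) * δ x ^ α ≤ δ c ^ α := by
      calc (1 / 2 : ℝ) * δ x ^ α ≤ (1 / 2 : ℝ) ^ α * δ x ^ α := by
            gcongr
            calc (1 / 2 : ℝ) = (1 / 2) ^ (1 : ℝ) := (Real.rpow_one _).symm
              _ ≤ _ := Real.rpow_le_rpow_of_exponent_ge (by norm_num) (by norm_num) hα.2
        _ = (1 / 2 * δ x) ^ α := (Real.mul_rpow (by norm_num) h0.le).symm
        _ ≤ δ c ^ α := Real.rpow_le_rpow (by positivity) (by linarith) hα.1.le
    have hc0 : 0 < δ c := by linarith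
    have h4 : |2 * (x - c) / δ c| ≤ 2 / 7 := by
      rw [abs_div, abs_of_pos hc0, abs_mul, abs_two, div_le_iff₀ hc0]
      linarith
    have h5 : (2 * (x - c) / δ c) ^ 2 ≤ 4 / 49 := by
      rw [← sq_abs]; nlinarith [abs_nonneg (2 * (x - c) / δ c)]
    have h6 : 1 / 2 ≤ bump (2 * (x - c) / δ c) := by
      unfold bump
      rw [max_eq_right (by linarith)]
      nlinarith
    have h7 : (0 : ℝ) ≤ δ x ^ α := by positivity
    nlinarith [mul_le_mul h3 h6 (by norm_num) (Real.rpow_nonneg hc0.le α)]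
  have h2 : ∫ c in Icc (x - δ x / 8) (x + δ x / 8), δ c ^ α * bump (2 * (x - c) / δ c) ≤
      reg δ α x :=
    setIntegral_le_integral (hδ.integrable_reg hα x) (ae_of_all _ fun c =>
      mul_nonneg (Real.rpow_nonneg (hδ.nonneg c) _) (bump_nonneg _))
  refine le_trans (le_of_eq ?_) (h1.trans h2)
  rw [setIntegral_const, Real.volume_real_Icc_of_le (by linarith), smul_eq_mul,
    Real.rpow_add_one h0.ne']
  ring

end IsLipGap

lemma isLipGap_gap {x y : ℝ → ℝ} (h : GapBdd x y) : IsLipGap (gap x y) :=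
  ⟨gap_nonneg x y, gap_le_add h⟩

/-- For `0 < α ≤ 1`, a function with `α`-Hölder second derivative whose increments dominate
the cost of order `α + 2` of the comonotone coupling. -/
theorem exists_holder_deriv_two_test {α : ℝ} (hα : α ∈ Ioc (0 : ℝ) 1) (μ ν : Measure ℝ)
    (hν : ∀ z, cdf ν z ∈ Ioo (0 : ℝ) 1) :
    ∃ f g k : ℝ → ℝ, (∀ z, HasDerivAt f (g z) z) ∧ (∀ z, HasDerivAt g (k z) z) ∧
      (∀ z w, |k z - k w| ≤ 384 * |z - w| ^ α) ∧
      ∀ u ∈ Ioo (0 : ℝ) 1, 1 / 16 * (|quantile μ u - quantile ν u| / 3) ^ (α + 2) ≤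
        f (quantile μ u) - f (quantile ν u) := by
  have h1 := gapBdd_quantile μ ν hν
  have h2 := gapBdd_quantile' μ ν hν
  set x := quantile μ
  set y := quantile ν
  have l1 := isLipGap_gap h1
  have l2 := isLipGap_gap h2
  set gp := IsLipGap.reg (gap x y) α
  set gm := IsLipGap.reg (gap y x) α
  have dgp : ∀ z, HasDerivAt gp (IsLipGap.regDeriv (gap x y) α z) z := l1.hasDerivAt_reg hα
  have dgm : ∀ z, HasDerivAt gm (IsLipGap.regDeriv (gap y x) α z) z := l2.hasDerivAt_reg hα
  have cgp : Continuous gp := continuous_iff_continuousAt.2 fun z => (dgp z).continuousAt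
  have cgm : Continuous gm := continuous_iff_continuousAt.2 fun z => (dgm z).continuousAt
  have hcont : Continuous fun z => gp z - gm z := cgp.sub cgm
  refine ⟨fun z => -∫ t in (0 : ℝ)..z, (gp t - gm t), fun z => -(gp z - gm z), _, fun z => ?_,
    fun z => ((dgp z).sub (dgm z)).neg, fun z w => ?_, fun u hu => ?_⟩
  · exact (hcont.integral_hasStrictDerivAt 0 z).hasDerivAt.neg
  · have a1 := l1.abs_regDeriv_sub_le hα z w
    have a2 := l2.abs_regDeriv_sub_le hα z w
    set kp := IsLipGap.regDeriv (gap x y) α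
    set km := IsLipGap.regDeriv (gap y x) α
    calc |-(kp z - km z) - -(kp w - km w)| = |(km z - km w) - (kp z - kp w)| := by ring_nf
      _ ≤ |km z - km w| + |kp z - kp w| := abs_sub _ _
      _ ≤ _ := by linarith
  · have key := rpow_abs_sub_le_primitive (quantile_monotoneOn μ) (quantile_monotoneOn ν) h1 h2
      cgp cgm l1.reg_nonneg l2.reg_nonneg (c := 1 / 16) (by norm_num)
      (by linarith [hα.1] : 0 ≤ α + 1)
      (l1.rpow_le_reg hα) (l2.rpow_le_reg hα) (fun z hz => l1.reg_eq_zero hα hz)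
      (fun z hz => l2.reg_eq_zero hα hz) hu
    rw [show α + 1 + 1 = α + 2 by ring] at key
    refine key.trans (le_of_eq ?_)
    rw [← intervalIntegral.integral_interval_sub_left (hcont.intervalIntegrable 0 _)
      (hcont.intervalIntegrable 0 _)]
    ring

/-! ### Kantorovich-Rubinstein duality on the line -/

open scoped Pointwise in
/-- Duality for the transport problem between two laws on a finite set. -/
theorem exists_finite_coupling {ι : Type*} [Fintype ι] (d : ι → ι → ℝ) (a b : ι → ℝ)
    (ha : ∀ i, 0 ≤ a i) (hb : ∀ i, 0 ≤ b i) (ha1 : ∑ i, a i = 1) (hb1 : ∑ i, b i = 1) (c : ℝ)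
    (hc : ∀ f g : ι → ℝ, (∀ i j, f i + g j ≤ d i j) → ∑ i, f i * a i + ∑ j, g j * b j ≤ c) :
    ∃ q : ι × ι → ℝ, (∀ z, 0 ≤ q z) ∧ (∀ i, ∑ j, q (i, j) = a i) ∧ (∀ j, ∑ i, q (i, j) = b j) ∧
      ∑ z, q z * d z.1 z.2 ≤ c := by
  classical
  let L : (ι × ι → ℝ) →ₗ[ℝ] (ι → ℝ) × (ι → ℝ) × ℝ :=
    LinearMap.prod (LinearMap.pi fun i => ∑ j, LinearMap.proj (i, j))
      (LinearMap.prod (LinearMap.pi fun j => ∑ i, LinearMap.proj (i, j))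
        (∑ z, d z.1 z.2 • LinearMap.proj z))
  have hL : ∀ q, L q = (fun i => ∑ j, q (i, j), fun j => ∑ i, q (i, j),
      ∑ z, d z.1 z.2 * q z) := by
    intro q
    ext <;> simp [L]
  -- `M` collects the triples (first marginal, second marginal, any number at least the cost) of
  -- finite couplings. It is closed and convex, and the claim is that (a, b, c) belongs to it;
  -- otherwise a separating functional contradicts the dual bound.
  let ray : Set ((ι → ℝ) × (ι → ℝ) × ℝ) := {0} ×ˢ {0} ×ˢ Ici 0
  let M := L '' stdSimplex ℝ (ι × ι) + ray
  have hMc : IsClosed M := by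
    refine IsClosed.add_left_of_isCompact ?_ ?_
    · exact isClosed_singleton.prod (isClosed_singleton.prod isClosed_Ici)
    · exact (isCompact_stdSimplex ℝ _).image (LinearMap.continuous_of_finiteDimensional L)
  have hMv : Convex ℝ M := by
    refine Convex.add ((convex_stdSimplex ℝ _).linear_image L) ?_
    exact (convex_singleton _).prod ((convex_singleton _).prod (convex_Ici _))
  by_cases hmem : ((a, b, c) : (ι → ℝ) × (ι → ℝ) × ℝ) ∈ M
  · obtain ⟨_, ⟨q, hq, rfl⟩, ⟨y1, y2, y3⟩, hy, hsum⟩ := Set.mem_add.1 hmem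
    simp only [ray, mem_prod, mem_singleton_iff, mem_Ici] at hy
    obtain ⟨rfl, rfl, hy3⟩ := hy
    rw [hL] at hsum
    simp only [Prod.mk_add_mk, add_zero, Prod.mk.injEq] at hsum
    refine ⟨q, hq.1, fun i => congrFun hsum.1 i, fun j => congrFun hsum.2.1 j, ?_⟩
    have := hsum.2.2
    simp_rw [mul_comm (q _)]
    linarith
  exfalso
  obtain ⟨φ, u, hφ, hu⟩ := geometric_hahn_banach_closed_point hMv hMc hmem
  let F : ι → ℝ := fun i => φ (Pi.single i 1, 0, 0)
  let G : ι → ℝ := fun i => φ (0, Pi.single i 1, 0)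
  let l : ℝ := φ (0, 0, 1)
  have hrep : ∀ x y z, φ (x, y, z) = ∑ i, F i * x i + ∑ i, G i * y i + l * z := by
    intro x y z
    have e : ((x, y, z) : (ι → ℝ) × (ι → ℝ) × ℝ) =
        ∑ i, x i • ((Pi.single i 1, 0, 0) : (ι → ℝ) × (ι → ℝ) × ℝ) +
        ∑ i, y i • ((0, Pi.single i 1, 0) : (ι → ℝ) × (ι → ℝ) × ℝ) +
        z • ((0, 0, 1) : (ι → ℝ) × (ι → ℝ) × ℝ) := by
      ext k
      · simp [Prod.fst_sum, Finset.sum_apply, Pi.single_apply]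
      · simp [Prod.fst_sum, Prod.snd_sum, Finset.sum_apply, Pi.single_apply]
      · simp [Prod.snd_sum]
    rw [e, map_add, map_add, map_sum, map_sum, map_smul]
    simp only [map_smul, smul_eq_mul, F, G, l]
    congr 1
    · congr 1 <;> exact Finset.sum_congr rfl fun i _ => mul_comm _ _
    · exact mul_comm _ _
  have hdirac : ∀ i j s, 0 ≤ s → F i + G j + l * (d i j + s) < u := by
    intro i j s hs
    have hm : L (Pi.single (i, j) 1) + ((0, 0, s) : (ι → ℝ) × (ι → ℝ) × ℝ) ∈ M := by
      refine Set.add_mem_add ⟨_, single_mem_stdSimplex ℝ (i, j), rfl⟩ ?_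
      simp [ray, hs]
    have := hφ _ hm
    rw [hL] at this
    simp only [Prod.mk_add_mk, add_zero, hrep] at this
    have e1 : ∀ k, ∑ j', (Pi.single (i, j) (1 : ℝ) : ι × ι → ℝ) (k, j') = if k = i then 1 else 0 := by
      intro k
      simp [Pi.single_apply, Prod.ext_iff, ite_and]
    have e2 : ∀ k, ∑ i', (Pi.single (i, j) (1 : ℝ) : ι × ι → ℝ) (i', k) = if k = j then 1 else 0 := by
      intro k
      simp [Pi.single_apply, Prod.ext_iff, ite_and]
    have e3 : ∑ z : ι × ι, d z.1 z.2 * (Pi.single (i, j) (1 : ℝ) : ι × ι → ℝ) z = d i j := by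
      simp [Pi.single_apply]
    simp only [e1, e2, e3] at this
    simpa using this
  rw [hrep] at hu
  have hne : Nonempty ι := by
    by_contra h
    rw [not_nonempty_iff] at h
    simp at ha1
  obtain ⟨i₀⟩ := hne
  have hl : l ≤ 0 := by
    by_contra h
    push Not at h
    have h1 := hdirac i₀ i₀ (max 0 ((u - F i₀ - G i₀ - l * d i₀ i₀) / l)) (le_max_left _ _)
    have h2 := mul_le_mul_of_nonneg_left
      (le_max_right 0 ((u - F i₀ - G i₀ - l * d i₀ i₀) / l)) h.le
    rw [mul_div_cancel₀ _ h.ne'] at h2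
    rw [mul_add] at h1
    linarith
  -- With zero slope in the cost coordinate, averaging the separation over the product weights a ⊗ b
  -- is contradictory; with negative slope, division by -l produces an admissible dual pair of value
  -- greater than c.
  rcases hl.eq_or_lt with h0 | hneg
  · have h1 : ∑ i, F i * a i + ∑ j, G j * b j = ∑ i, ∑ j, (F i + G j) * (a i * b j) := by
      simp only [add_mul, Finset.sum_add_distrib]
      congr 1
      · refine Finset.sum_congr rfl fun i _ => ?_
        rw [← Finset.mul_sum, ← Finset.mul_sum, hb1, mul_one]
      · rw [Finset.sum_comm]
        refine Finset.sum_congr rfl fun i _ => ?_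
        rw [← Finset.mul_sum, ← Finset.sum_mul, ha1, one_mul]
    have h2 : ∑ i, ∑ j, (F i + G j) * (a i * b j) ≤ ∑ i, ∑ j, u * (a i * b j) := by
      refine Finset.sum_le_sum fun i _ => Finset.sum_le_sum fun j _ => ?_
      have := hdirac i j 0 le_rfl
      rw [h0, zero_mul, add_zero] at this
      exact mul_le_mul_of_nonneg_right this.le (mul_nonneg (ha i) (hb j))
    have h3 : ∑ i, ∑ j, u * (a i * b j) = u := by
      simp_rw [← Finset.mul_sum, hb1, mul_one, ha1, mul_one]
    rw [h0, zero_mul, add_zero, h1] at hu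
    linarith
  · have hl' : 0 < -l := by linarith
    have := hc (fun i => (F i - u) / -l) (fun j => G j / -l) fun i j => by
      rw [← add_div, div_le_iff₀ hl']
      have := hdirac i j 0 le_rfl
      rw [add_zero] at this
      linarith
    simp_rw [div_mul_eq_mul_div, ← Finset.sum_div, sub_mul] at this
    rw [← add_div, div_le_iff₀ hl', Finset.sum_sub_distrib, ← Finset.mul_sum, ha1] at this
    linarith

lemma abs_rpow_le_add {r : ℝ} (hr : r ∈ Ioc (0 : ℝ) 1) (x y : ℝ) :
    |x + y| ^ r ≤ |x| ^ r + |y| ^ r :=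
  (Real.rpow_le_rpow (abs_nonneg _) (abs_add_le x y) hr.1.le).trans
    (Real.rpow_add_le_add_rpow (abs_nonneg _) (abs_nonneg _) hr.1.le hr.2)

lemma continuous_of_holder {f : ℝ → ℝ} {r C : ℝ} (hr : 0 < r)
    (h : ∀ x y, |f x - f y| ≤ C * |x - y| ^ r) : Continuous f := by
  refine continuous_iff_continuousAt.2 fun x => ?_
  have h0 : Tendsto (fun y => C * |y - x| ^ r) (nhds x) (nhds 0) := by
    have : ContinuousAt (fun y : ℝ => C * |y - x| ^ r) x :=
      ContinuousAt.mul continuousAt_const (ContinuousAt.rpow_const (by fun_prop) (Or.inr hr.le))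
    simpa [ContinuousAt, Real.zero_rpow hr.ne'] using this
  exact tendsto_iff_norm_sub_tendsto_zero.2
    (squeeze_zero (fun _ => norm_nonneg _) (fun y => h y x) h0)

/-- A coupling assembled from a coupling of two quantized laws. -/
lemma exists_coupling_of_finite {ι : Type*} [Fintype ι] [MeasurableSpace ι]
    [DiscreteMeasurableSpace ι] (μ ν : Measure ℝ) [IsProbabilityMeasure μ]
    [IsProbabilityMeasure ν] {X : ℝ → ι} (hX : Measurable X) (q : ι × ι → ℝ)
    (hq : ∀ z, 0 ≤ q z) (h1 : ∀ i, ∑ j, q (i, j) = μ.real (X ⁻¹' {i}))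
    (h2 : ∀ j, ∑ i, q (i, j) = ν.real (X ⁻¹' {j})) :
    ∃ P ∈ couplings μ ν, ∀ φ : ι × ι → ℝ≥0∞,
      ∫⁻ z, φ (X z.1, X z.2) ∂P ≤ ∑ z, ENNReal.ofReal (q z) * φ z := by
  classical
  let A : ι → Measure ℝ := fun i => μ[|X ⁻¹' {i}]
  let B : ι → Measure ℝ := fun i => ν[|X ⁻¹' {i}]
  -- Given the pair of cells, the two points are drawn independently from the conditional laws. On a
  -- null cell the conditional measure is zero, but there the weights q vanish as well.
  let P : Measure (ℝ × ℝ) := ∑ z : ι × ι, ENNReal.ofReal (q z) • (A z.1).prod (B z.2)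
  have hqA : ∀ i j, ENNReal.ofReal (q (i, j)) * A i univ = ENNReal.ofReal (q (i, j)) := by
    intro i j
    by_cases h : μ (X ⁻¹' {i}) = 0
    · have h3 : ∑ j, q (i, j) = 0 := by rw [h1, measureReal_def, h]; rfl
      have := (Finset.sum_eq_zero_iff_of_nonneg fun j _ => hq (i, j)).1 h3 j (Finset.mem_univ _)
      simp [this]
    · have : IsProbabilityMeasure (A i) := cond_isProbabilityMeasure h
      rw [measure_univ, mul_one]
  have hqB : ∀ i j, ENNReal.ofReal (q (i, j)) * B j univ = ENNReal.ofReal (q (i, j)) := by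
    intro i j
    by_cases h : ν (X ⁻¹' {j}) = 0
    · have h3 : ∑ i, q (i, j) = 0 := by rw [h2, measureReal_def, h]; rfl
      have := (Finset.sum_eq_zero_iff_of_nonneg fun i _ => hq (i, j)).1 h3 i (Finset.mem_univ _)
      simp [this]
    · have : IsProbabilityMeasure (B j) := cond_isProbabilityMeasure h
      rw [measure_univ, mul_one]
  refine ⟨P, ⟨?_, ?_⟩, fun φ => ?_⟩
  · rw [Measure.map_finset_sum measurable_fst.aemeasurable]
    simp_rw [Measure.map_smul, Measure.map_fst_prod, smul_smul]
    rw [Fintype.sum_prod_type]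
    simp_rw [hqB]
    conv_rhs => rw [← sum_meas_smul_cond_fiber hX μ]
    refine Finset.sum_congr rfl fun i _ => ?_
    rw [← Finset.sum_smul, ← ENNReal.ofReal_sum_of_nonneg fun j _ => hq (i, j), h1,
      ofReal_measureReal]
  · rw [Measure.map_finset_sum measurable_snd.aemeasurable]
    simp_rw [Measure.map_smul, Measure.map_snd_prod, smul_smul]
    rw [Fintype.sum_prod_type_right]
    simp_rw [hqA]
    conv_rhs => rw [← sum_meas_smul_cond_fiber hX ν]
    refine Finset.sum_congr rfl fun j _ => ?_
    rw [← Finset.sum_smul, ← ENNReal.ofReal_sum_of_nonneg fun i _ => hq (i, j), h2,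
      ofReal_measureReal]
  · rw [lintegral_finsetSum_measure]
    refine Finset.sum_le_sum fun z _ => ?_
    rw [lintegral_smul_measure, smul_eq_mul]
    gcongr
    have hz : ∀ᵐ w ∂((A z.1).prod (B z.2)), φ (X w.1, X w.2) = φ z := by
      have e1 : ∀ᵐ w ∂(A z.1), w ∈ X ⁻¹' {z.1} := ae_cond_mem (hX (measurableSet_singleton _))
      have e2 : ∀ᵐ w ∂(B z.2), w ∈ X ⁻¹' {z.2} := ae_cond_mem (hX (measurableSet_singleton _))
      filter_upwards [Measure.quasiMeasurePreserving_fst.ae e1,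
        Measure.quasiMeasurePreserving_snd.ae e2] with w hw1 hw2
      rw [show X w.1 = z.1 from hw1, show X w.2 = z.2 from hw2]
    rw [lintegral_congr_ae hz, lintegral_const, ← univ_prod_univ, Measure.prod_prod]
    have hA : A z.1 univ ≤ 1 := prob_le_one
    have hB : B z.2 univ ≤ 1 := prob_le_one
    calc φ z * (A z.1 univ * B z.2 univ) ≤ φ z * (1 * 1) := by gcongr
      _ = φ z := by simp

lemma exists_simpleFunc_approx {r : ℝ} (hr : 0 < r) (μ : Measure ℝ)
    (hμ : ∫⁻ x, ENNReal.ofReal (|x| ^ r) ∂μ < ∞) {ε : ℝ≥0∞} (hε : 0 < ε) :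
    ∃ π : SimpleFunc ℝ ℝ, ∫⁻ x, ENNReal.ofReal (|π x - x| ^ r) ∂μ ≤ ε := by
  have hr0 : ENNReal.ofReal r ≠ 0 := by simpa using hr
  have hconv : ∀ g : ℝ → ℝ, ∫⁻ x, ENNReal.ofReal (|g x| ^ r) ∂μ =
      eLpNorm g (ENNReal.ofReal r) μ ^ r := by
    intro g
    rw [eLpNorm_eq_lintegral_rpow_enorm_toReal hr0 ENNReal.ofReal_ne_top,
      ENNReal.toReal_ofReal hr.le, ← ENNReal.rpow_mul, one_div, inv_mul_cancel₀ hr.ne',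
      ENNReal.rpow_one]
    refine lintegral_congr fun x => ?_
    rw [Real.enorm_eq_ofReal_abs, ENNReal.ofReal_rpow_of_nonneg (abs_nonneg _) hr.le]
  have hlt : eLpNorm (id : ℝ → ℝ) (ENNReal.ofReal r) μ < ∞ := by
    have := hconv id
    simp only [id] at this
    rw [this] at hμ
    exact (ENNReal.rpow_lt_top_iff_of_pos hr).1 hμ
  have ht := SimpleFunc.tendsto_approxOn_Lp_eLpNorm (μ := μ) (f := (id : ℝ → ℝ)) measurable_id
    (s := univ) (y₀ := 0) (mem_univ _) (p := ENNReal.ofReal r) ENNReal.ofReal_ne_top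
    (by simp) (by simp only [sub_zero]; exact hlt)
  have ht2 := (ENNReal.continuous_rpow_const (y := r)).continuousAt.tendsto.comp ht
  rw [ENNReal.zero_rpow_of_pos hr] at ht2
  obtain ⟨n, hn⟩ := (ht2.eventually (gt_mem_nhds hε)).exists
  refine ⟨SimpleFunc.approxOn id measurable_id univ 0 (mem_univ _) n, ?_⟩
  rw [hconv fun x => SimpleFunc.approxOn id measurable_id univ 0 (mem_univ _) n x - x]
  exact hn.le

/-- **Kantorovich-Rubinstein**: for `0 < r ≤ 1`, if every `r`-Hölder function has integrals under
`μ` and `ν` differing by at most `c`, then there are couplings of cost arbitrarily close to `c`. -/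
theorem exists_coupling_lintegral_le {r : ℝ} (hr : r ∈ Ioc (0 : ℝ) 1) (μ ν : Measure ℝ)
    [IsProbabilityMeasure μ] [IsProbabilityMeasure ν] (hμ : Integrable (fun x => |x| ^ r) μ)
    (hν : Integrable (fun x => |x| ^ r) ν) (c : ℝ)
    (hc : ∀ f : ℝ → ℝ, (∀ x y, |f x - f y| ≤ |x - y| ^ r) → ∫ x, f x ∂μ - ∫ x, f x ∂ν ≤ c)
    {ε : ℝ} (hε : 0 < ε) :
    ∃ P ∈ couplings μ ν, ∫⁻ z, ENNReal.ofReal (|z.1 - z.2| ^ r) ∂P ≤ ENNReal.ofReal (c + ε) := by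
  classical
  have hnn : ∀ x : ℝ, 0 ≤ |x| ^ r := fun x => by positivity
  -- The quantization error is paid twice, in the dual bound for the quantized laws and in the
  -- return from the quantized points to the true ones, hence ε / 2.
  obtain ⟨π, hπ⟩ := exists_simpleFunc_approx hr.1 (μ + ν)
    (by
      rw [lintegral_add_measure, ENNReal.add_lt_top]
      exact ⟨(hasFiniteIntegral_iff_ofReal (ae_of_all _ hnn)).1 hμ.2,
        (hasFiniteIntegral_iff_ofReal (ae_of_all _ hnn)).1 hν.2⟩)
    (ε := ENNReal.ofReal (ε / 2)) (by simpa using hε)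
  rw [lintegral_add_measure] at hπ
  have hπm : Measurable π := π.measurable
  have hint : ∀ (m : Measure ℝ) [IsProbabilityMeasure m], Integrable (fun x => |x| ^ r) m →
      Integrable (fun x => |π x - x| ^ r) m := by
    intro m _ hm
    obtain ⟨C, hC⟩ := π.exists_forall_norm_le
    refine Integrable.mono' ((integrable_const (C ^ r)).add hm)
      (Measurable.aestronglyMeasurable (by fun_prop)) (ae_of_all _ fun x => ?_)
    rw [Real.norm_eq_abs, abs_of_nonneg (hnn _), sub_eq_add_neg]
    refine (abs_rpow_le_add hr _ _).trans ?_
    rw [abs_neg]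
    exact add_le_add_left (Real.rpow_le_rpow (abs_nonneg _) (hC x) hr.1.le) _
  have iμ := hint μ hμ
  have iν := hint ν hν
  rw [← ofReal_integral_eq_lintegral_ofReal iμ (ae_of_all _ fun _ => hnn _),
    ← ofReal_integral_eq_lintegral_ofReal iν (ae_of_all _ fun _ => hnn _),
    ← ENNReal.ofReal_add (integral_nonneg fun _ => hnn _) (integral_nonneg fun _ => hnn _),
    ENNReal.ofReal_le_ofReal_iff (by positivity)] at hπ
  set eμ := ∫ x, |π x - x| ^ r ∂μ
  set eν := ∫ x, |π x - x| ^ r ∂ν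
  let ι := π.range
  let X : ℝ → ι := fun x => ⟨π x, SimpleFunc.mem_range_self π x⟩
  have hX : Measurable X := hπm.subtype_mk
  have hsum : ∀ (m : Measure ℝ) [IsProbabilityMeasure m], ∀ h : ι → ℝ,
      ∑ i, h i * m.real (X ⁻¹' {i}) = ∫ x, h (X x) ∂m := by
    intro m _ h
    have : IsProbabilityMeasure (m.map X) := Measure.isProbabilityMeasure_map hX.aemeasurable
    rw [← integral_map (φ := X) hX.aemeasurable (f := h)
      (Measurable.of_discrete).aestronglyMeasurable,
      integral_fintype .of_finite]
    refine Finset.sum_congr rfl fun i _ => ?_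
    rw [map_measureReal_apply hX (measurableSet_singleton i), smul_eq_mul, mul_comm]
  have hone : ∀ (m : Measure ℝ) [IsProbabilityMeasure m], ∑ i, m.real (X ⁻¹' {i}) = 1 := by
    intro m _
    simpa using hsum m fun _ => 1
  have : Nonempty ι := ⟨X 0⟩
  obtain ⟨q, hq0, hq1, hq2, hqc⟩ := exists_finite_coupling (fun i j : ι => |(i : ℝ) - j| ^ r)
    (fun i => μ.real (X ⁻¹' {i})) (fun i => ν.real (X ⁻¹' {i})) (fun _ => measureReal_nonneg)
    (fun _ => measureReal_nonneg) (hone μ) (hone ν) (c + eμ + eν) (by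
      intro f g hfg
      -- The c-transform of g. It is r-Hölder because |·|^r is subadditive, and on the grid f ≤ F
      -- and g ≤ -F, so a dual pair is dominated by one Hölder function.
      let F : ℝ → ℝ := fun z => Finset.univ.inf' Finset.univ_nonempty
        fun j : ι => |z - j| ^ r - g j
      have hF : ∀ x y, |F x - F y| ≤ |x - y| ^ r := by
        have key : ∀ x y, F x ≤ F y + |x - y| ^ r := by
          intro x y
          obtain ⟨j, -, hj⟩ := Finset.exists_mem_eq_inf' Finset.univ_nonempty
            fun j : ι => |y - j| ^ r - g j
          have h1 : F x ≤ |x - j| ^ r - g j := Finset.inf'_le _ (Finset.mem_univ j)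
          have h2 := abs_rpow_le_add hr (x - y) (y - j)
          rw [sub_add_sub_cancel] at h2
          have h3 : F y = |y - j| ^ r - g j := hj
          linarith
        intro x y
        have h1 := key x y
        have h2 := key y x
        rw [abs_sub_comm y x] at h2
        exact abs_le.2 ⟨by linarith, by linarith⟩
      have hFc : Continuous F := continuous_of_holder (C := 1) hr.1 fun x y => by
        rw [one_mul]; exact hF x y
      have hFint : ∀ (m : Measure ℝ) [IsProbabilityMeasure m], Integrable (fun x => |x| ^ r) m →
          Integrable F m := by
        intro m _ hm
        refine Integrable.mono' ((integrable_const |F 0|).add hm) hFc.aestronglyMeasurable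
          (ae_of_all _ fun x => ?_)
        have h1 := hF x 0
        rw [sub_zero] at h1
        have h2 := abs_sub_abs_le_abs_sub (F x) (F 0)
        rw [Real.norm_eq_abs, Pi.add_apply]
        linarith
      have hFπ : ∀ (m : Measure ℝ) [IsProbabilityMeasure m], Integrable (fun x => F (π x)) m :=
        fun m _ => by
          have := SimpleFunc.integrable_of_isFiniteMeasure (μ := m) (π.map F)
          rwa [SimpleFunc.coe_map] at this
      have hdiff : ∀ (m : Measure ℝ) [IsProbabilityMeasure m], Integrable (fun x => |x| ^ r) m →
          |∫ x, F (π x) ∂m - ∫ x, F x ∂m| ≤ ∫ x, |π x - x| ^ r ∂m := by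
        intro m _ hm
        rw [← integral_sub (hFπ m) (hFint m hm)]
        refine (abs_integral_le_integral_abs).trans ?_
        exact integral_mono ((hFπ m).sub (hFint m hm)).abs (hint m hm) fun x => hF _ _
      have h1 : ∑ i, f i * μ.real (X ⁻¹' {i}) ≤ ∑ i : ι, F i * μ.real (X ⁻¹' {i}) := by
        refine Finset.sum_le_sum fun i _ => mul_le_mul_of_nonneg_right ?_ measureReal_nonneg
        refine (Finset.le_inf'_iff _ _).2 fun j _ => ?_
        have := hfg i j
        linarith
      have h2 : ∑ i, g i * ν.real (X ⁻¹' {i}) ≤ ∑ i : ι, (-F i) * ν.real (X ⁻¹' {i}) := by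
        refine Finset.sum_le_sum fun i _ => mul_le_mul_of_nonneg_right ?_ measureReal_nonneg
        have : F i ≤ |(i : ℝ) - i| ^ r - g i := Finset.inf'_le _ (Finset.mem_univ i)
        rw [sub_self, abs_zero, Real.zero_rpow hr.1.ne'] at this
        linarith
      rw [hsum μ fun i : ι => F i] at h1
      simp_rw [neg_mul] at h2
      rw [Finset.sum_neg_distrib, hsum ν fun i : ι => F i] at h2
      have h3 := (abs_le.1 (hdiff μ hμ)).2
      have h4 := (abs_le.1 (hdiff ν hν)).1
      have h5 := hc F hF
      simp only [X] at h1 h2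
      linarith)
  obtain ⟨P, hP, hPφ⟩ := exists_coupling_of_finite μ ν hX q hq0 hq1 hq2
  refine ⟨P, hP, ?_⟩
  have hle : ∀ z : ℝ × ℝ, ENNReal.ofReal (|z.1 - z.2| ^ r) ≤
      ENNReal.ofReal (|π z.1 - z.1| ^ r) + ENNReal.ofReal (|(X z.1 : ℝ) - X z.2| ^ r) +
        ENNReal.ofReal (|π z.2 - z.2| ^ r) := by
    intro z
    rw [← ENNReal.ofReal_add (hnn _) (hnn _), ← ENNReal.ofReal_add
      (add_nonneg (hnn _) (hnn _)) (hnn _)]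
    refine ENNReal.ofReal_le_ofReal ?_
    have h1 := abs_rpow_le_add hr (z.1 - π z.1) (π z.1 - z.2)
    have h2 := abs_rpow_le_add hr (π z.1 - π z.2) (π z.2 - z.2)
    rw [sub_add_sub_cancel] at h1 h2
    rw [abs_sub_comm z.1 (π z.1)] at h1
    simp only [X]
    linarith
  have m1 : ∫⁻ z, ENNReal.ofReal (|π z.1 - z.1| ^ r) ∂P = ENNReal.ofReal eμ := by
    rw [ofReal_integral_eq_lintegral_ofReal iμ (ae_of_all _ fun _ => hnn _), ← hP.1,
      lintegral_map (by fun_prop) measurable_fst]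
  have m2 : ∫⁻ z, ENNReal.ofReal (|π z.2 - z.2| ^ r) ∂P = ENNReal.ofReal eν := by
    rw [ofReal_integral_eq_lintegral_ofReal iν (ae_of_all _ fun _ => hnn _), ← hP.2,
      lintegral_map (by fun_prop) measurable_snd]
  have m3 := hPφ fun z => ENNReal.ofReal (|(z.1 : ℝ) - z.2| ^ r)
  have m4 : ∑ z : ι × ι, ENNReal.ofReal (q z) * ENNReal.ofReal (|(z.1 : ℝ) - z.2| ^ r) ≤
      ENNReal.ofReal (c + eμ + eν) := by
    simp_rw [← ENNReal.ofReal_mul (hq0 _)]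
    rw [← ENNReal.ofReal_sum_of_nonneg fun z _ => mul_nonneg (hq0 z) (hnn _)]
    exact ENNReal.ofReal_le_ofReal hqc
  have c0 : 0 ≤ c := by simpa using hc (fun _ => 0) fun x y => by simpa using hnn (x - y)
  have e1 : 0 ≤ eμ := integral_nonneg fun _ => hnn _
  have e2 : 0 ≤ eν := integral_nonneg fun _ => hnn _
  calc ∫⁻ z, ENNReal.ofReal (|z.1 - z.2| ^ r) ∂P
      ≤ ∫⁻ z, (ENNReal.ofReal (|π z.1 - z.1| ^ r) + ENNReal.ofReal (|(X z.1 : ℝ) - X z.2| ^ r) +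
        ENNReal.ofReal (|π z.2 - z.2| ^ r)) ∂P := lintegral_mono hle
    _ ≤ ENNReal.ofReal eμ + ENNReal.ofReal (c + eμ + eν) + ENNReal.ofReal eν := by
      rw [lintegral_add_right _ (by fun_prop), lintegral_add_left (by fun_prop), m1, m2]
      gcongr
      exact m3.trans m4
    _ = ENNReal.ofReal (eμ + (c + eμ + eν) + eν) := by
      rw [ENNReal.ofReal_add (add_nonneg e1 (by positivity)) e2,
        ENNReal.ofReal_add e1 (by positivity)]
    _ ≤ ENNReal.ofReal (c + ε) := ENNReal.ofReal_le_ofReal (by linarith)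

/-! ### Gaussian smoothing -/

/-- Polynomial growth of order `a`. -/
def Grows (a : ℝ) (f : ℝ → ℝ) : Prop := ∃ A, 0 ≤ A ∧ ∀ x, |f x| ≤ A * (1 + |x|) ^ a

lemma Grows.mono {a b : ℝ} {f : ℝ → ℝ} (h : Grows a f) (hab : a ≤ b) : Grows b f := by
  obtain ⟨A, hA, h⟩ := h
  refine ⟨A, hA, fun x => (h x).trans ?_⟩
  have : 1 ≤ 1 + |x| := by linarith [abs_nonneg x]
  gcongr

lemma one_add_abs_add_le (x y : ℝ) : 1 + |x + y| ≤ (1 + |x|) * (1 + |y|) := by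
  nlinarith [abs_add_le x y, mul_nonneg (abs_nonneg x) (abs_nonneg y)]

lemma Grows.le_mul {a A : ℝ} {f : ℝ → ℝ} (ha : 0 ≤ a) (hA : 0 ≤ A)
    (h : ∀ x, |f x| ≤ A * (1 + |x|) ^ a) (x y : ℝ) :
    |f (x + y)| ≤ A * (1 + |x|) ^ a * (1 + |y|) ^ a := by
  rw [mul_assoc, ← Real.mul_rpow (by positivity) (by positivity)]
  exact (h _).trans (mul_le_mul_of_nonneg_left (Real.rpow_le_rpow (by positivity)
    (one_add_abs_add_le x y) ha) hA)

lemma memLp_one_add_abs (t : ℝ≥0) (p : ℝ≥0∞) (hp : p ≠ ∞) :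
    MemLp (fun y : ℝ => 1 + |y|) p (gaussianReal 0 t) := by
  have h1 : MemLp (fun _ : ℝ => (1 : ℝ)) p (gaussianReal 0 t) := memLp_const 1
  have h2 : MemLp (fun y : ℝ => ‖id y‖) p (gaussianReal 0 t) := (memLp_id_gaussianReal' p hp).norm
  exact h1.add h2

lemma integrable_one_add_abs_rpow (t : ℝ≥0) {a : ℝ} (ha : 0 ≤ a) :
    Integrable (fun y : ℝ => (1 + |y|) ^ a) (gaussianReal 0 t) := by
  have := (memLp_one_add_abs t (ENNReal.ofReal a) ENNReal.ofReal_ne_top).integrable_norm_rpow'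
  refine this.congr (ae_of_all _ fun y => ?_)
  simp only [Real.norm_eq_abs, ENNReal.toReal_ofReal ha]
  rw [abs_of_nonneg (by positivity)]

lemma integrable_abs_rpow_gaussian (t : ℝ≥0) {a : ℝ} (ha : 0 ≤ a) :
    Integrable (fun y : ℝ => |y| ^ a) (gaussianReal 0 t) := by
  refine (integrable_one_add_abs_rpow t ha).mono' (Measurable.aestronglyMeasurable (by fun_prop))
    (ae_of_all _ fun y => ?_)
  rw [Real.norm_eq_abs, abs_of_nonneg (by positivity)]
  exact Real.rpow_le_rpow (abs_nonneg _) (by linarith) ha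

/-- The average of `f` with respect to a centred Gaussian perturbation of variance `t`. -/
def gsm (t : ℝ≥0) (f : ℝ → ℝ) (x : ℝ) : ℝ := ∫ y, f (x + y) ∂gaussianReal 0 t

lemma Grows.integrable {a : ℝ} (ha : 0 ≤ a) {f : ℝ → ℝ} (hf : Measurable f) (h : Grows a f)
    (t : ℝ≥0) (x : ℝ) : Integrable (fun y => f (x + y)) (gaussianReal 0 t) := by
  obtain ⟨A, hA, h⟩ := h
  refine ((integrable_one_add_abs_rpow t ha).const_mul (A * (1 + |x|) ^ a)).mono'
    (Measurable.aestronglyMeasurable (by fun_prop)) (ae_of_all _ fun y => ?_)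
  exact Grows.le_mul ha hA h x y

lemma Grows.gsm {a : ℝ} (ha : 0 ≤ a) {f : ℝ → ℝ} (h : Grows a f) (t : ℝ≥0) :
    Grows a (gsm t f) := by
  obtain ⟨A, hA, h⟩ := h
  have hnn : 0 ≤ ∫ y, (1 + |y|) ^ a ∂gaussianReal 0 t := integral_nonneg fun y => by positivity
  refine ⟨A * ∫ y, (1 + |y|) ^ a ∂gaussianReal 0 t, by positivity, fun x => ?_⟩
  refine (norm_integral_le_of_norm_le (f := fun y => f (x + y))
    ((integrable_one_add_abs_rpow t ha).const_mul (A * (1 + |x|) ^ a)) (ae_of_all _ fun y => Grows.le_mul ha hA h x y)).trans (le_of_eq ?_)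
  rw [integral_const_mul]; ring

lemma measurable_gsm {f : ℝ → ℝ} (hf : Measurable f) (t : ℝ≥0) : Measurable (gsm t f) := by
  have : StronglyMeasurable (fun z : ℝ × ℝ => f (z.1 + z.2)) :=
    (by fun_prop : Measurable fun z : ℝ × ℝ => f (z.1 + z.2)).stronglyMeasurable
  exact this.integral_prod_right.measurable

/-- The semigroup property of Gaussian convolution; it makes the Lindeberg telescoping possible. -/
lemma gsm_gsm {a : ℝ} (ha : 0 ≤ a) {f : ℝ → ℝ} (hf : Measurable f) (h : Grows a f)
    (s t : ℝ≥0) : gsm s (gsm t f) = gsm (s + t) f := by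
  ext x
  have hconv := gaussianReal_conv_gaussianReal (m₁ := 0) (m₂ := 0) (v₁ := s) (v₂ := t)
  rw [add_zero] at hconv
  have hi := h.integrable ha hf (s + t) x
  unfold gsm
  rw [← hconv] at hi ⊢
  rw [integral_conv hi]
  simp_rw [add_assoc]

lemma hasDerivAt_gsm {a b : ℝ} (ha : 0 ≤ a) (hb : 0 ≤ b) {f g : ℝ → ℝ}
    (hfg : ∀ x, HasDerivAt f (g x) x) (hg : Measurable g) (hfa : Grows a f) (hgb : Grows b g)
    (t : ℝ≥0) (x : ℝ) : HasDerivAt (gsm t f) (gsm t g x) x := by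
  have hfm : Measurable f :=
    (continuous_iff_continuousAt.2 fun x => (hfg x).continuousAt).measurable
  obtain ⟨B, hB, hgB⟩ := hgb
  refine (hasDerivAt_integral_of_dominated_loc_of_deriv_le (F := fun z y => f (z + y))
    (F' := fun z y => g (z + y)) (bound := fun y => B * (2 + |x|) ^ b * (1 + |y|) ^ b)
    (Metric.ball_mem_nhds x one_pos) (Eventually.of_forall fun z => Measurable.aestronglyMeasurable (by fun_prop))
    (hfa.integrable ha hfm t x) (Measurable.aestronglyMeasurable (by fun_prop)) (ae_of_all _ fun y z hz => ?_)
    ((integrable_one_add_abs_rpow t hb).const_mul _) (ae_of_all _ fun y z _ => ?_)).2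
  · refine (Grows.le_mul hb hB hgB z y).trans ?_
    have : |z| ≤ 1 + |x| := by
      have h1 : |z - x| < 1 := by simpa [Real.dist_eq] using hz
      have := abs_add_le (z - x) x
      rw [sub_add_cancel] at this
      linarith
    have h2 : 1 + |z| ≤ 2 + |x| := by linarith
    gcongr
  · simpa using (hfg (z + y)).comp_add_const z y

lemma Grows.of_deriv {b : ℝ} (hb : 0 ≤ b) {f g : ℝ → ℝ} (hfg : ∀ x, HasDerivAt f (g x) x)
    (hg : Grows b g) : Grows (b + 1) f := by
  obtain ⟨B, hB, hgB⟩ := hg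
  refine ⟨|f 0| + B, by positivity, fun x => ?_⟩
  have h := Convex.norm_image_sub_le_of_norm_hasDerivWithin_le (f := f) (f' := g)
    (s := uIcc 0 x) (C := B * (1 + |x|) ^ b) (x := 0) (y := x)
    (fun z _ => (hfg z).hasDerivWithinAt)
    (fun z hz => ?_) (convex_uIcc 0 x) left_mem_uIcc right_mem_uIcc
  · rw [Real.norm_eq_abs, Real.norm_eq_abs, sub_zero] at h
    have h1 := abs_sub_abs_le_abs_sub (f x) (f 0)
    have h2 : (1 : ℝ) ≤ (1 + |x|) ^ (b + 1) :=
      Real.one_le_rpow (by linarith [abs_nonneg x]) (by linarith)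
    have h3 : B * (1 + |x|) ^ b * |x| ≤ B * (1 + |x|) ^ (b + 1) := by
      rw [Real.rpow_add_one (by positivity), mul_assoc]
      gcongr
      linarith
    nlinarith [abs_nonneg (f 0)]
  · refine (hgB z).trans ?_
    have : |z| ≤ |x| := by simpa using abs_sub_left_of_mem_uIcc hz
    gcongr

lemma Grows.of_holder {b C : ℝ} (hb : 0 ≤ b) (hC : 0 ≤ C) {f : ℝ → ℝ}
    (h : ∀ x y, |f x - f y| ≤ C * |x - y| ^ b) : Grows b f := by
  refine ⟨|f 0| + C, by positivity, fun x => ?_⟩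
  have h1 := h x 0
  rw [sub_zero] at h1
  have h2 := abs_sub_abs_le_abs_sub (f x) (f 0)
  have h3 : (1 : ℝ) ≤ (1 + |x|) ^ b := Real.one_le_rpow (by linarith [abs_nonneg x]) hb
  have h4 : |x| ^ b ≤ (1 + |x|) ^ b := Real.rpow_le_rpow (abs_nonneg _) (by linarith) hb
  have h5 := mul_le_mul_of_nonneg_left h4 hC
  have h6 := mul_le_mul_of_nonneg_left h3 (abs_nonneg (f 0))
  linarith

/-! #### Derivatives of smoothed Hölder functions -/

/-- Gaussian domination of a kernel. -/
def GaussDom (C : ℝ) (K : ℝ → ℝ) : Prop := ∀ u, |K u| ≤ C * Real.exp (-(1 / 4) * u ^ 2)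

lemma integrable_one_add_abs_mul_exp {b : ℝ} (hb : 0 < b) :
    Integrable fun u : ℝ => (1 + |u|) * Real.exp (-b * u ^ 2) := by
  have h1 := integrable_exp_neg_mul_sq hb
  have h2 := (integrable_mul_exp_neg_mul_sq hb).norm
  refine (h1.add h2).congr (ae_of_all _ fun u => ?_)
  simp only [Pi.add_apply, norm_mul, Real.norm_eq_abs, Real.abs_exp]
  ring

lemma integrable_kernel {F K : ℝ → ℝ} {A C : ℝ} (hA : 0 ≤ A) (hF : Measurable F)
    (hFA : ∀ z, |F z| ≤ A * (1 + |z|)) (hK : Measurable K) (hKC : GaussDom C K) (x : ℝ) :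
    Integrable fun z => F z * K (z - x) := by
  have hi := (((integrable_one_add_abs_mul_exp (b := 1 / 4) (by norm_num)).comp_sub_right x).const_mul
    (A * (1 + |x|) * C))
  refine hi.mono' (Measurable.aestronglyMeasurable (by fun_prop)) (ae_of_all _ fun z => ?_)
  rw [norm_mul, Real.norm_eq_abs, Real.norm_eq_abs]
  have h1 : 1 + |z| ≤ (1 + |x|) * (1 + |z - x|) := by
    have := one_add_abs_add_le x (z - x)
    rwa [add_sub_cancel] at this
  calc |F z| * |K (z - x)|
      ≤ (A * ((1 + |x|) * (1 + |z - x|))) * (C * Real.exp (-(1 / 4) * (z - x) ^ 2)) := by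
        refine mul_le_mul ((hFA z).trans (by gcongr)) (hKC _) (abs_nonneg _) (by positivity)
    _ = _ := by ring

lemma hasDerivAt_kernel {F K K' : ℝ → ℝ} {A C : ℝ} (hA : 0 ≤ A) (hF : Measurable F)
    (hFA : ∀ z, |F z| ≤ A * (1 + |z|)) (hK : ∀ u, HasDerivAt K (-K' u) u) (hK'm : Measurable K')
    (hKC : GaussDom C K) (hKC' : GaussDom C K') (x : ℝ) :
    HasDerivAt (fun x => ∫ z, F z * K (z - x)) (∫ z, F z * K' (z - x)) x := by
  have hKm : Measurable K := (continuous_iff_continuousAt.2 fun x => (hK x).continuousAt).measurable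
  have hC : 0 ≤ C := by simpa using (abs_nonneg _).trans (hKC 0)
  have hi := (((integrable_one_add_abs_mul_exp (b := 1 / 8) (by norm_num)).comp_sub_right x).const_mul
    (A * (1 + |x|) * (C * Real.exp (1 / 4))))
  refine (hasDerivAt_integral_of_dominated_loc_of_deriv_le (F := fun x z => F z * K (z - x))
    (F' := fun x z => F z * K' (z - x)) (Metric.ball_mem_nhds x one_pos)
    (Eventually.of_forall fun y => Measurable.aestronglyMeasurable (by fun_prop))
    (integrable_kernel hA hF hFA hKm hKC x) (Measurable.aestronglyMeasurable (by fun_prop)) (ae_of_all _ fun z y hy => ?_) hi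
    (ae_of_all _ fun z y _ => ?_)).2
  · have hyx : |y - x| < 1 := by simpa [Real.dist_eq] using hy
    rw [norm_mul, Real.norm_eq_abs, Real.norm_eq_abs]
    have h1 : 1 + |z| ≤ (1 + |x|) * (1 + |z - x|) := by
      have := one_add_abs_add_le x (z - x)
      rwa [add_sub_cancel] at this
    -- From (z - x)² ≤ 2(z - y)² + 2(y - x)² with |y - x| ≤ 1: the Gaussian rate is halved to get a
    -- bound uniform in y.
    have h2 : Real.exp (-(1 / 4) * (z - y) ^ 2) ≤
        Real.exp (1 / 4) * Real.exp (-(1 / 8) * (z - x) ^ 2) := by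
      rw [← Real.exp_add, Real.exp_le_exp]
      have h3 : (y - x) ^ 2 ≤ 1 := by rw [← sq_abs]; nlinarith [abs_nonneg (y - x)]
      nlinarith [sq_nonneg (z - y - (y - x))]
    calc |F z| * |K' (z - y)|
        ≤ (A * ((1 + |x|) * (1 + |z - x|))) *
            (C * (Real.exp (1 / 4) * Real.exp (-(1 / 8) * (z - x) ^ 2))) := by
          refine mul_le_mul ((hFA z).trans (by gcongr)) ((hKC' _).trans (by gcongr))
            (abs_nonneg _) (by positivity)
      _ = _ := by ring
  · have h1 : HasDerivAt (fun y : ℝ => z - y) (-1) y := by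
      simpa using (hasDerivAt_id y).const_sub z
    have := ((hK (z - y)).comp y h1).const_mul (F z)
    simpa using this

/-- The standard Gaussian density. -/
def gdens (u : ℝ) : ℝ := (√(2 * Real.pi))⁻¹ * Real.exp (-(u ^ 2 / 2))

lemma hasDerivAt_gdens (u : ℝ) : HasDerivAt gdens (-(u * gdens u)) u := by
  have h1 : HasDerivAt (fun u : ℝ => -(u ^ 2 / 2)) (-u) u := by
    refine ((hasDerivAt_pow 2 u).div_const 2).neg.congr_deriv ?_
    simp
  have := (h1.exp).const_mul (√(2 * Real.pi))⁻¹
  refine this.congr_deriv ?_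
  unfold gdens; ring

lemma continuous_gdens : Continuous gdens :=
  continuous_iff_continuousAt.2 fun x => (hasDerivAt_gdens x).continuousAt

/-- Half of the Gaussian exponent absorbs the polynomial: u² ≤ 4 exp(u²/4) and u⁴ ≤ 32 exp(u²/4),
whence 10 · (1 + 4 + 32) = 370. -/
lemma gaussDom_mul_gdens {P : ℝ → ℝ} (hP : ∀ u, |P u| ≤ 10 * (1 + u ^ 2 + u ^ 4)) :
    GaussDom 370 fun u => P u * gdens u := by
  intro u
  have h1 : u ^ 2 / 4 ≤ Real.exp (u ^ 2 / 4) := by linarith [Real.add_one_le_exp (u ^ 2 / 4)]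
  have h2 : (u ^ 2 / 4) ^ 2 / 2 ≤ Real.exp (u ^ 2 / 4) := by
    linarith [Real.quadratic_le_exp_of_nonneg (by positivity : 0 ≤ u ^ 2 / 4),
      (by positivity : 0 ≤ u ^ 2 / 4)]
  have h3 : 1 ≤ Real.exp (u ^ 2 / 4) := Real.one_le_exp (by positivity)
  have h4 : (√(2 * Real.pi))⁻¹ ≤ 1 := by
    refine inv_le_one_of_one_le₀ ?_
    rw [Real.one_le_sqrt]
    linarith [Real.pi_gt_three]
  have h5 : gdens u ≤ Real.exp (-(u ^ 2 / 2)) := by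
    unfold gdens
    nlinarith [Real.exp_pos (-(u ^ 2 / 2))]
  have h6 : 0 ≤ gdens u := by unfold gdens; positivity
  rw [abs_mul, abs_of_nonneg h6]
  calc |P u| * gdens u ≤ (370 * Real.exp (u ^ 2 / 4)) * Real.exp (-(u ^ 2 / 2)) := by
        refine mul_le_mul ((hP u).trans ?_) h5 h6 (by positivity)
        nlinarith
    _ = _ := by
        rw [mul_assoc, ← Real.exp_add]; ring_nf

lemma gsm_one_eq (F : ℝ → ℝ) (x : ℝ) : gsm 1 F x = ∫ z, F z * gdens (z - x) := by
  unfold gsm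
  rw [integral_gaussianReal_eq_integral_smul one_ne_zero]
  rw [← integral_sub_right_eq_self _ x]
  refine integral_congr_ae (ae_of_all _ fun z => ?_)
  simp only [gaussianPDFReal, gdens, smul_eq_mul, NNReal.coe_one, mul_one, sub_zero]
  rw [add_sub_cancel, mul_comm, neg_div]

/-- Bounds for the first three derivatives of a Hölder function smoothed at scale one. -/
theorem exists_deriv_gsm_one : ∃ C : ℝ, 0 ≤ C ∧ ∀ (ρ l : ℝ) (F : ℝ → ℝ), ρ ∈ Ioc (0 : ℝ) 1 →
    0 ≤ l → (∀ x y, |F x - F y| ≤ l * |x - y| ^ ρ) → ∃ F1 F2 F3 : ℝ → ℝ,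
      (∀ x, HasDerivAt (gsm 1 F) (F1 x) x) ∧ (∀ x, HasDerivAt F1 (F2 x) x) ∧
      (∀ x, HasDerivAt F2 (F3 x) x) ∧
      (∀ x, |F1 x| ≤ C * l) ∧ (∀ x, |F2 x| ≤ C * l) ∧ (∀ x, |F3 x| ≤ C * l) := by
  set J := ∫ u : ℝ, (1 + |u|) * Real.exp (-(1 / 4) * u ^ 2)
  have hJ : 0 ≤ J := integral_nonneg fun u => by positivity
  let K0 : ℝ → ℝ := fun u => 1 * gdens u
  let K1 : ℝ → ℝ := fun u => u * gdens u
  let K2 : ℝ → ℝ := fun u => (u ^ 2 - 1) * gdens u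
  let K3 : ℝ → ℝ := fun u => (u ^ 3 - 3 * u) * gdens u
  have d0 : GaussDom 370 K0 := gaussDom_mul_gdens fun u => by
    rw [abs_one]; nlinarith [sq_nonneg u, sq_nonneg (u ^ 2)]
  have d1 : GaussDom 370 K1 := gaussDom_mul_gdens fun u => by
    rw [abs_le]; constructor <;> nlinarith [sq_nonneg (u - 1), sq_nonneg (u + 1), sq_nonneg (u ^ 2)]
  have d2 : GaussDom 370 K2 := gaussDom_mul_gdens fun u => by
    rw [abs_le]; constructor <;> nlinarith [sq_nonneg u, sq_nonneg (u ^ 2)]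
  have d3 : GaussDom 370 K3 := gaussDom_mul_gdens fun u => by
    rw [abs_le]; constructor <;> nlinarith [sq_nonneg (u - 1), sq_nonneg (u + 1), sq_nonneg (u ^ 2),
      sq_nonneg (u ^ 2 - u), sq_nonneg (u ^ 2 + u)]
  have h0 : ∀ u, HasDerivAt K0 (-K1 u) u := fun u => by
    simpa [K0, K1] using (hasDerivAt_gdens u)
  have h1 : ∀ u, HasDerivAt K1 (-K2 u) u := fun u => by
    have := (hasDerivAt_id u).mul (hasDerivAt_gdens u)
    refine this.congr_deriv ?_
    simp only [K2, id]; ring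
  have h2 : ∀ u, HasDerivAt K2 (-K3 u) u := fun u => by
    have := ((hasDerivAt_pow 2 u).sub_const 1).mul (hasDerivAt_gdens u)
    refine this.congr_deriv ?_
    simp only [K3]; norm_num; ring
  have hc := continuous_gdens
  have m1 : Measurable K1 := Continuous.measurable (by fun_prop)
  have m2 : Measurable K2 := Continuous.measurable (by fun_prop)
  have m3 : Measurable K3 := Continuous.measurable (by fun_prop)
  have m0 : Measurable K0 := Continuous.measurable (by fun_prop)
  -- The integral of K(z - x) in z does not depend on x, so the derived kernel has integral zero.
  have zero : ∀ K K' : ℝ → ℝ, (∀ u, HasDerivAt K (-K' u) u) → Measurable K' → GaussDom 370 K →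
      GaussDom 370 K' → ∫ z, K' z = 0 := by
    intro K K' hK hm hd hd'
    have := hasDerivAt_kernel (F := fun _ => 1) (A := 1) zero_le_one measurable_const
      (fun z => by rw [abs_one, one_mul]; linarith [abs_nonneg z]) hK hm hd hd' 0
    simp only [one_mul, sub_zero] at this
    have h2 : (fun x : ℝ => ∫ z, K (z - x)) = fun _ => ∫ z, K z := by
      ext x; exact integral_sub_right_eq_self K x
    rw [h2] at this
    exact this.unique (hasDerivAt_const _ _)
  refine ⟨370 * J, by positivity, fun ρ l F hρ hl hF => ?_⟩
  have hFc : Continuous F := continuous_of_holder hρ.1 hF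
  obtain ⟨A, hA, hFA'⟩ := (Grows.of_holder hρ.1.le hl hF).mono hρ.2
  have hFA : ∀ z, |F z| ≤ A * (1 + |z|) := fun z => by simpa using hFA' z
  have bound : ∀ K : ℝ → ℝ, Measurable K → GaussDom 370 K → ∫ z, K z = 0 →
      ∀ x, |∫ z, F z * K (z - x)| ≤ 370 * J * l := by
    intro K hK hd hz x
    -- Subtracting F x costs nothing because K has zero integral; the bound then depends only on the
    -- Hölder constant of F and not on its size.
    have e1 : ∫ z, F z * K (z - x) = ∫ z, (F z - F x) * K (z - x) := by
      have hi := integrable_kernel hA hFc.measurable hFA hK hd x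
      have hi2 : Integrable fun z => F x * K (z - x) := by
        have := integrable_kernel (F := fun _ => F x) (A := |F x|) (abs_nonneg _) measurable_const
          (fun z => le_mul_of_one_le_right (abs_nonneg _) (by linarith [abs_nonneg z])) hK hd x
        exact this
      simp_rw [sub_mul]
      rw [integral_sub hi hi2, integral_const_mul, integral_sub_right_eq_self K x, hz, mul_zero,
        sub_zero]
    rw [e1]
    have hi := (((integrable_one_add_abs_mul_exp (b := 1 / 4) (by norm_num)).comp_sub_right
      x).const_mul (370 * l))
    refine (norm_integral_le_of_norm_le (f := fun z => (F z - F x) * K (z - x)) hi (ae_of_all _ fun z => ?_)).trans (le_of_eq ?_)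
    · rw [norm_mul, Real.norm_eq_abs, Real.norm_eq_abs]
      have h3 : |z - x| ^ ρ ≤ 1 + |z - x| := by
        rcases le_total |z - x| 1 with h | h
        · have := Real.rpow_le_one (abs_nonneg _) h hρ.1.le
          linarith [abs_nonneg (z - x)]
        · have := Real.rpow_le_rpow_of_exponent_le h hρ.2
          rw [Real.rpow_one] at this
          linarith
      calc |F z - F x| * |K (z - x)|
          ≤ (l * (1 + |z - x|)) * (370 * Real.exp (-(1 / 4) * (z - x) ^ 2)) := by
            refine mul_le_mul ((hF z x).trans (by gcongr)) (hd _) (abs_nonneg _) (by positivity)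
        _ = _ := by ring
    · rw [integral_const_mul]
      rw [integral_sub_right_eq_self (fun u : ℝ => (1 + |u|) * Real.exp (-(1 / 4) * u ^ 2)) x]
      ring
  have e0 : gsm 1 F = fun x => ∫ z, F z * K0 (z - x) := by
    ext x; rw [gsm_one_eq]; simp [K0]
  refine ⟨_, _, _, fun x => ?_, hasDerivAt_kernel hA hFc.measurable hFA h1 m2 d1 d2,
    hasDerivAt_kernel hA hFc.measurable hFA h2 m3 d2 d3, bound K1 m1 d1 (zero K0 K1 h0 m1 d0 d1),
    bound K2 m2 d2 (zero K1 K2 h1 m2 d1 d2), bound K3 m3 d3 (zero K2 K3 h2 m3 d2 d3)⟩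
  rw [e0]
  exact hasDerivAt_kernel hA hFc.measurable hFA h0 m1 d0 d1 x

lemma gaussianReal_eq_map_sqrt (t : ℝ≥0) :
    gaussianReal 0 t = (gaussianReal 0 1).map fun y => √(t : ℝ) * y := by
  rw [gaussianReal_map_const_mul, mul_zero]
  congr 1
  ext
  simp

lemma gsm_eq_gsm_one {f : ℝ → ℝ} (hf : Measurable f) {t : ℝ≥0} (ht : t ≠ 0) (x : ℝ) :
    gsm t f x = gsm 1 (fun y => f (√(t : ℝ) * y)) (x / √(t : ℝ)) := by
  have h0 : √(t : ℝ) ≠ 0 := by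
    rw [Real.sqrt_ne_zero']
    exact_mod_cast pos_iff_ne_zero.2 ht
  unfold gsm
  rw [gaussianReal_eq_map_sqrt t, integral_map (by fun_prop)
    (Measurable.aestronglyMeasurable (by fun_prop))]
  refine integral_congr_ae (ae_of_all _ fun y => ?_)
  simp only
  rw [mul_add, mul_div_cancel₀ _ h0]

/-- Bounds for the first three derivatives of a Hölder function smoothed at scale `√t`. -/
theorem exists_deriv_gsm : ∃ C : ℝ, 0 ≤ C ∧ ∀ (ρ l : ℝ) (f : ℝ → ℝ) (t : ℝ≥0),
    ρ ∈ Ioc (0 : ℝ) 1 → 0 ≤ l → t ≠ 0 → (∀ x y, |f x - f y| ≤ l * |x - y| ^ ρ) →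
    ∃ f1 f2 f3 : ℝ → ℝ,
      (∀ x, HasDerivAt (gsm t f) (f1 x) x) ∧ (∀ x, HasDerivAt f1 (f2 x) x) ∧
      (∀ x, HasDerivAt f2 (f3 x) x) ∧ (∀ x, |f1 x| ≤ C * l * (t : ℝ) ^ ((ρ - 1) / 2)) ∧
      (∀ x, |f2 x| ≤ C * l * (t : ℝ) ^ ((ρ - 2) / 2)) ∧
      (∀ x, |f3 x| ≤ C * l * (t : ℝ) ^ ((ρ - 3) / 2)) := by
  obtain ⟨C, hC, H⟩ := exists_deriv_gsm_one
  refine ⟨C, hC, fun ρ l f t hρ hl ht hf => ?_⟩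
  have ht0 : (0 : ℝ) < t := by exact_mod_cast pos_iff_ne_zero.2 ht
  set s := √(t : ℝ) with hs
  have hs0 : 0 < s := Real.sqrt_pos.2 ht0
  have hfm : Measurable f := (continuous_of_holder hρ.1 hf).measurable
  obtain ⟨F1, F2, F3, h1, h2, h3, b1, b2, b3⟩ := H ρ (l * s ^ ρ) (fun y => f (s * y)) hρ
    (by positivity) (fun x y => by
      refine (hf _ _).trans (le_of_eq ?_)
      rw [← mul_sub, abs_mul, abs_of_pos hs0, Real.mul_rpow hs0.le (abs_nonneg _), mul_assoc])
  have hdiv : ∀ x, HasDerivAt (fun x : ℝ => x / s) (1 / s) x := fun x => (hasDerivAt_id x).div_const s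
  have hpow : ∀ k : ℕ, s ^ ρ * (1 / s) ^ k = (t : ℝ) ^ ((ρ - k) / 2) := by
    intro k
    have hinv : 1 / s = (t : ℝ) ^ (-(1 / 2) : ℝ) := by
      rw [hs, Real.sqrt_eq_rpow, Real.rpow_neg ht0.le, one_div]
    rw [hinv, hs, Real.sqrt_eq_rpow, ← Real.rpow_mul ht0.le,
      ← Real.rpow_mul_natCast ht0.le, ← Real.rpow_add ht0]
    congr 1; ring
  have bd : ∀ (k : ℕ) (G : ℝ → ℝ), (∀ x, |G x| ≤ C * (l * s ^ ρ)) → ∀ x,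
      |(1 / s) ^ k * G (x / s)| ≤ C * l * (t : ℝ) ^ ((ρ - k) / 2) := by
    intro k G hG x
    rw [abs_mul, abs_of_nonneg (by positivity), ← hpow k]
    calc (1 / s) ^ k * |G (x / s)| ≤ (1 / s) ^ k * (C * (l * s ^ ρ)) := by gcongr; exact hG _
      _ = _ := by ring
  refine ⟨fun x => (1 / s) ^ 1 * F1 (x / s), fun x => (1 / s) ^ 2 * F2 (x / s),
    fun x => (1 / s) ^ 3 * F3 (x / s), fun x => ?_, fun x => ?_, fun x => ?_,
    by simpa using bd 1 F1 b1, by simpa using bd 2 F2 b2, by simpa using bd 3 F3 b3⟩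
  · rw [show gsm t f = fun x => gsm 1 (fun y => f (s * y)) (x / s) from
      funext fun x => gsm_eq_gsm_one hfm ht x]
    refine ((h1 (x / s)).comp x (hdiv x)).congr_deriv ?_
    ring
  · exact (((h2 (x / s)).comp x (hdiv x)).const_mul _).congr_deriv (by ring)
  · exact (((h3 (x / s)).comp x (hdiv x)).const_mul _).congr_deriv (by ring)

lemma abs_sub_le_min_of_deriv {f g : ℝ → ℝ} {M s : ℝ} (hM : 0 ≤ M) (hs : 0 < s)
    (hfg : ∀ x, HasDerivAt f (g x) x) (hf : ∀ x, |f x| ≤ M) (hg : ∀ x, |g x| ≤ M / s) (x y : ℝ) :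
    |f x - f y| ≤ 2 * M * min 1 (|x - y| / s) := by
  have h1 : |f x - f y| ≤ M / s * |x - y| := by
    have := Convex.norm_image_sub_le_of_norm_hasDerivWithin_le (f := f) (f' := g)
      (s := univ) (C := M / s) (x := y) (y := x)
      (fun z _ => (hfg z).hasDerivWithinAt) (fun z _ => hg z) convex_univ (mem_univ _) (mem_univ _)
    simpa using this
  have h2 : |f x - f y| ≤ 2 * M := by linarith [abs_sub (f x) (f y), hf x, hf y]
  rcases le_total 1 (|x - y| / s) with h | h
  · rw [min_eq_left h]; linarith
  · rw [min_eq_right h]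
    have : 0 ≤ M / s * |x - y| := by positivity
    calc |f x - f y| ≤ M / s * |x - y| := h1
      _ ≤ 2 * (M / s * |x - y|) := by linarith
      _ = _ := by ring

/-- Test functions of regularity `r`, described through their Gaussian smoothings. -/
structure Smoothable (r C : ℝ) (f : ℝ → ℝ) : Prop where
  measurable : Measurable f
  grows : Grows 2 f
  deriv : ∀ t : ℝ≥0, t ≠ 0 → ∃ f1 f2 : ℝ → ℝ, (∀ x, HasDerivAt (gsm t f) (f1 x) x) ∧
    (∀ x, HasDerivAt f1 (f2 x) x) ∧ (∀ x, |f2 x| ≤ C * (t : ℝ) ^ ((r - 2) / 2)) ∧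
    Continuous f2 ∧
    -- The second derivative has size t^((r-2)/2) and varies over the length √t; the minimum retains
    -- both facts, and both are needed in the borderline case r = p - 2.
    ∀ x y, |f2 x - f2 y| ≤ C * (t : ℝ) ^ ((r - 2) / 2) * min 1 (|x - y| / √(t : ℝ))
  approx : ∀ (t : ℝ≥0) x, |gsm t f x - f x| ≤ 2 * ∫ y, |y| ^ r ∂gaussianReal 0 t

lemma rpow_div_sqrt {t : ℝ} (ht : 0 < t) (a : ℝ) : t ^ (a / 2) / √t = t ^ ((a - 1) / 2) := by
  rw [Real.sqrt_eq_rpow, ← Real.rpow_sub ht]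
  congr 1; ring

/-- Hölder functions are smoothable, and so are functions with Hölder derivative. -/
theorem exists_smoothable : ∃ C : ℝ, 0 ≤ C ∧
    (∀ r ∈ Ioc (0 : ℝ) 1, ∀ f : ℝ → ℝ, (∀ x y, |f x - f y| ≤ |x - y| ^ r) → Smoothable r C f) ∧
    (∀ r ∈ Ioc (1 : ℝ) 2, ∀ f g : ℝ → ℝ, (∀ x, HasDerivAt f (g x) x) →
      (∀ x y, |g x - g y| ≤ 2 * |x - y| ^ (r - 1)) → Smoothable r C f) := by
  obtain ⟨C, hC, H⟩ := exists_deriv_gsm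
  refine ⟨4 * C, by positivity, fun r hr f hf => ?_, fun r hr f g hfg hg => ?_⟩
  · have hf' : ∀ x y, |f x - f y| ≤ 1 * |x - y| ^ r := fun x y => by rw [one_mul]; exact hf x y
    have hfm : Measurable f := (continuous_of_holder hr.1 hf').measurable
    have hgr := Grows.of_holder hr.1.le zero_le_one hf'
    refine ⟨hfm, hgr.mono (by linarith [hr.2]), fun t ht => ?_, fun t x => ?_⟩
    · obtain ⟨f1, f2, f3, h1, h2, h3, -, b2, b3⟩ := H r 1 f t hr zero_le_one ht hf'
      have ht0 : (0 : ℝ) < t := by exact_mod_cast pos_iff_ne_zero.2 ht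
      set M := C * (t : ℝ) ^ ((r - 2) / 2)
      have hM : 0 ≤ M := by positivity
      have b3' : ∀ x, |f3 x| ≤ M / √(t : ℝ) := fun x => by
        refine (b3 x).trans (le_of_eq ?_)
        rw [mul_div_assoc, rpow_div_sqrt ht0]
        ring_nf
      have b2' : ∀ x, |f2 x| ≤ M := fun x => by simpa [M] using b2 x
      refine ⟨f1, f2, h1, h2, fun x => (b2' x).trans ?_,
        continuous_iff_continuousAt.2 fun x => (h3 x).continuousAt, fun x y => ?_⟩
      · rw [mul_assoc]; change M ≤ 4 * M; linarith
      · refine (abs_sub_le_min_of_deriv hM (Real.sqrt_pos.2 ht0) h3 b2' b3' x y).trans ?_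
        have : 4 * C * (t : ℝ) ^ ((r - 2) / 2) = 4 * M := by rw [mul_assoc]
        rw [this]
        have : 0 ≤ min 1 (|x - y| / √(t : ℝ)) := by positivity
        gcongr
        norm_num
    · have hi := integrable_abs_rpow_gaussian t hr.1.le
      have e : gsm t f x - f x = ∫ y, (f (x + y) - f x) ∂gaussianReal 0 t := by
        rw [integral_sub (hgr.integrable hr.1.le hfm t x) (integrable_const _)]
        simp [gsm]
      rw [e]
      refine (norm_integral_le_of_norm_le (f := fun y => f (x + y) - f x) hi
        (ae_of_all _ fun y => ?_)).trans ?_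
      · simpa using hf (x + y) x
      · have : 0 ≤ ∫ y, |y| ^ r ∂gaussianReal 0 t := integral_nonneg fun y => by positivity
        linarith
  · have hρ : r - 1 ∈ Ioc (0 : ℝ) 1 := ⟨by linarith [hr.1], by linarith [hr.2]⟩
    have hgc : Continuous g := continuous_of_holder hρ.1 hg
    have hgm : Measurable g := hgc.measurable
    have hgg := Grows.of_holder hρ.1.le zero_le_two hg
    have hgf := Grows.of_deriv hρ.1.le hfg hgg
    have hfm : Measurable f :=
      (continuous_iff_continuousAt.2 fun x => (hfg x).continuousAt).measurable
    refine ⟨hfm, hgf.mono (by linarith [hr.2]), fun t ht => ?_, fun t x => ?_⟩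
    -- Since differentiation commutes with smoothing, the second and third derivatives of the
    -- smoothed f are the first and second ones of the smoothed g, a function of Hölder exponent r -
    -- 1.
    · obtain ⟨g1, g2, g3, h1, h2, -, b1, b2, -⟩ := H (r - 1) 2 g t hρ zero_le_two ht hg
      have ht0 : (0 : ℝ) < t := by exact_mod_cast pos_iff_ne_zero.2 ht
      set M := 2 * C * (t : ℝ) ^ ((r - 2) / 2) with hMdef
      have hM : 0 ≤ M := by positivity
      have b2' : ∀ x, |g2 x| ≤ M / √(t : ℝ) := fun x => by
        refine (b2 x).trans (le_of_eq ?_)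
        rw [hMdef, mul_div_assoc, rpow_div_sqrt ht0]
        ring_nf
      have b1' : ∀ x, |g1 x| ≤ M := fun x => by
        refine (b1 x).trans (le_of_eq ?_)
        rw [hMdef]
        ring_nf
      refine ⟨gsm t g, g1, fun x => hasDerivAt_gsm (by linarith [hr.1]) hρ.1.le hfg hgm hgf hgg t x,
        h1, fun x => (b1' x).trans ?_,
        continuous_iff_continuousAt.2 fun x => (h2 x).continuousAt, fun x y => ?_⟩
      · rw [hMdef]
        have : 0 ≤ C * (t : ℝ) ^ ((r - 2) / 2) := by positivity
        linarith
      · refine (abs_sub_le_min_of_deriv hM (Real.sqrt_pos.2 ht0) h2 b1' b2' x y).trans (le_of_eq ?_)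
        rw [hMdef]; ring
    · have hr0 : 0 ≤ r := by linarith [hr.1]
      have hi := (integrable_abs_rpow_gaussian t hr0).const_mul 2
      have iy : Integrable (fun y : ℝ => y) (gaussianReal 0 t) :=
        memLp_one_iff_integrable.1 (memLp_id_gaussianReal' 1 (by simp))
      have i1 := hgf.integrable (by linarith [hr.1]) hfm t x
      -- The linear term has zero Gaussian mean; inserting it gains the order r instead of 1.
      have e : gsm t f x - f x = ∫ y, (f (x + y) - f x - g x * y) ∂gaussianReal 0 t := by
        rw [integral_sub (by exact i1.sub (integrable_const (f x))) (iy.const_mul (g x)),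
          integral_sub i1 (integrable_const _), integral_const_mul, integral_id_gaussianReal]
        simp [gsm]
      rw [e]
      refine (norm_integral_le_of_norm_le (f := fun y => f (x + y) - f x - g x * y) hi
        (ae_of_all _ fun y => ?_)).trans (le_of_eq (integral_const_mul _ _))
      have h := Convex.norm_image_sub_le_of_norm_hasDerivWithin_le
        (f := fun z => f z - g x * z) (f' := fun z => g z - g x)
        (s := uIcc x (x + y)) (C := 2 * |y| ^ (r - 1)) (x := x) (y := x + y)
        (fun z _ => ((hfg z).sub
          (((hasDerivAt_id z).const_mul (g x)).congr_deriv (mul_one _))).hasDerivWithinAt)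
        (fun z hz => ?_) (convex_uIcc _ _) left_mem_uIcc right_mem_uIcc
      · rw [Real.norm_eq_abs, Real.norm_eq_abs] at h
        calc |f (x + y) - f x - g x * y| = |f (x + y) - g x * (x + y) - (f x - g x * x)| := by
              ring_nf
          _ ≤ _ := h
          _ = 2 * |y| ^ r := by
            have : |y| ^ r = |y| ^ (r - 1) * |y| := by
              rw [← Real.rpow_add_one' (abs_nonneg _) (by linarith [hr.1]), sub_add_cancel]
            rw [add_sub_cancel_left, this]; ring
      · refine (hg z x).trans ?_
        have h3 : |z - x| ≤ |y| := by simpa using abs_sub_left_of_mem_uIcc hz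
        have := hρ.1.le
        gcongr

/-! ### Conditional expectations and weights -/

section CondExp

set_option linter.unusedSectionVars false

variable {Ω : Type*} {m mΩ : MeasurableSpace Ω} {μ : Measure Ω} [IsProbabilityMeasure μ]

/-- Conditional Jensen on measurable sets, extended to arbitrary weights by monotone approximation.
With values in [0, ∞], no integrability of the product is needed. -/
lemma lintegral_mul_condExp_le (hm : m ≤ mΩ) {g : Ω → ℝ} (hg : Integrable g μ)
    {w : Ω → ℝ≥0∞} (hw : Measurable[m] w) :
    ∫⁻ ω, w ω * ‖(μ[g | m]) ω‖ₑ ∂μ ≤ ∫⁻ ω, w ω * ‖g ω‖ₑ ∂μ := by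
  have hcm : Measurable fun ω => ‖(μ[g | m]) ω‖ₑ :=
    ((stronglyMeasurable_condExp.mono hm).measurable).enorm
  have hset : ∀ s, MeasurableSet[m] s → ∫⁻ ω in s, ‖(μ[g | m]) ω‖ₑ ∂μ ≤ ∫⁻ ω in s, ‖g ω‖ₑ ∂μ := by
    intro s hs
    have h := setIntegral_norm_condExp_le (μ := μ) hs g
    rw [← ofReal_integral_norm_eq_lintegral_enorm integrable_condExp.integrableOn,
      ← ofReal_integral_norm_eq_lintegral_enorm hg.integrableOn]
    exact ENNReal.ofReal_le_ofReal h
  have hgm : AEMeasurable (fun ω => ‖g ω‖ₑ) μ := hg.1.enorm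
  refine @Measurable.ennreal_induction Ω m
    (fun w => ∫⁻ ω, w ω * ‖(μ[g | m]) ω‖ₑ ∂μ ≤ ∫⁻ ω, w ω * ‖g ω‖ₑ ∂μ) ?_ ?_ ?_ w hw
  · intro c s hs
    have e : ∀ h : Ω → ℝ≥0∞, AEMeasurable h μ → ∫⁻ ω, s.indicator (fun _ => c) ω * h ω ∂μ =
        c * ∫⁻ ω in s, h ω ∂μ := by
      intro h hh
      rw [← lintegral_const_mul'' c hh.restrict, ← lintegral_indicator (hm s hs)]
      refine lintegral_congr fun ω => ?_
      by_cases hω : ω ∈ s <;> simp [hω]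
    rw [e _ hcm.aemeasurable, e _ hgm]
    exact mul_le_mul_right (hset s hs) c
  · intro f g' _ hf hg' h1 h2
    simp_rw [Pi.add_apply, add_mul]
    have hf' := hf.mono hm le_rfl
    rw [lintegral_add_left (by exact hf'.mul hcm),
      lintegral_add_left' (by exact hf'.aemeasurable.mul hgm)]
    exact add_le_add h1 h2
  · intro f hf hmono h
    simp_rw [ENNReal.iSup_mul]
    rw [lintegral_iSup (f := fun n ω => f n ω * ‖(μ[g | m]) ω‖ₑ)
      (fun n => ((hf n).mono hm le_rfl).mul hcm)
      (fun i j hij ω => mul_le_mul_left (hmono hij ω) _)]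
    refine iSup_le fun n => (h n).trans (lintegral_mono fun ω => ?_)
    exact le_iSup (fun n => f n ω * ‖g ω‖ₑ) n

lemma integral_mul_condExp (hm : m ≤ mΩ) {g w : Ω → ℝ} (hg : Integrable g μ)
    (hw : StronglyMeasurable[m] w) (hwg : Integrable (fun ω => w ω * g ω) μ) :
    ∫ ω, w ω * g ω ∂μ = ∫ ω, w ω * (μ[g | m]) ω ∂μ := by
  have h := condExp_mul_of_stronglyMeasurable_left (μ := μ) hw hwg hg
  rw [← integral_condExp hm (f := fun ω => w ω * g ω)]
  exact integral_congr_ae h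

end CondExp

/-! ### Stationary martingale differences -/

section Dynamics

variable {Ω : Type*} {F₀ mΩ : MeasurableSpace Ω}

lemma iter_zero (T : Ω ≃ᵐ Ω) : iter T 0 = id := by simp [iter]

lemma iter_one (T : Ω ≃ᵐ Ω) : iter T 1 = T := by simp [iter]

lemma iter_add (T : Ω ≃ᵐ Ω) (i j : ℤ) : iter T (i + j) = iter T i ∘ iter T j := by
  ext ω
  simp [iter, zpow_add]

lemma iter_iter (T : Ω ≃ᵐ Ω) (i j : ℤ) (ω : Ω) : iter T i (iter T j ω) = iter T (i + j) ω := by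
  rw [iter_add]; rfl

lemma iter_neg_one (T : Ω ≃ᵐ Ω) : iter T (-1) = T.symm := by
  ext ω
  simp [iter]

lemma measurePreserving_iter {μ : Measure Ω} {T : Ω ≃ᵐ Ω} (hT : MeasurePreserving T μ μ) (i : ℤ) :
    MeasurePreserving (iter T i) μ μ := by
  induction i using Int.induction_on with
  | zero => rw [iter_zero]; exact MeasurePreserving.id μ
  | succ i ih => rw [iter_add, iter_one]; exact ih.comp hT
  | pred i ih => rw [sub_eq_add_neg, iter_add, iter_neg_one]; exact ih.comp hT.symm

lemma seq_iter (T : Ω ≃ᵐ Ω) (X₀ : Ω → ℝ) (i j : ℤ) (ω : Ω) :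
    seq T X₀ i (iter T j ω) = seq T X₀ (i + j) ω := by
  simp [seq, iter_iter]

lemma sigmaAlg_zero (T : Ω ≃ᵐ Ω) : sigmaAlg F₀ T 0 = F₀ := by
  rw [sigmaAlg, iter_zero, MeasurableSpace.comap_id]

lemma sigmaAlg_add (T : Ω ≃ᵐ Ω) (i j : ℤ) :
    sigmaAlg F₀ T (i + j) = (sigmaAlg F₀ T i).comap (iter T j) := by
  rw [sigmaAlg, sigmaAlg, iter_add, MeasurableSpace.comap_comp]

lemma sigmaAlg_le_succ {T : Ω ≃ᵐ Ω} (h : F₀ ≤ F₀.comap T) (i : ℤ) :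
    sigmaAlg F₀ T i ≤ sigmaAlg F₀ T (i + 1) := by
  rw [add_comm, sigmaAlg_add]
  conv_lhs => rw [sigmaAlg]
  refine MeasurableSpace.comap_mono ?_
  rw [sigmaAlg, iter_one]
  exact h

lemma sigmaAlg_mono {T : Ω ≃ᵐ Ω} (h : F₀ ≤ F₀.comap T) : Monotone (sigmaAlg F₀ T) :=
  monotone_int_of_le_succ (sigmaAlg_le_succ h)

/-- The standing assumptions: a stationary martingale difference sequence in `L^p`, with
variance `v`. -/
structure Stationary {Ω : Type*} (F₀ : MeasurableSpace Ω) {mΩ : MeasurableSpace Ω} (μ : Measure Ω)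
    (T : Ω ≃ᵐ Ω) (X₀ : Ω → ℝ) (v : ℝ≥0) (p : ℝ) : Prop where
  pres : MeasurePreserving T μ μ
  le : F₀ ≤ mΩ
  inv : F₀ ≤ F₀.comap T
  mart : IsMartingaleDiff μ (sigmaAlg F₀ T) (seq T X₀)
  memLp : MemLp X₀ (ENNReal.ofReal p) μ
  hp : p ∈ Ioc (2 : ℝ) 3
  var : ∫ ω, X₀ ω ^ 2 ∂μ = v

/-- The sum `X_{1-l} + ⋯ + X_0`. -/
def pastSum (T : Ω ≃ᵐ Ω) (X₀ : Ω → ℝ) (l : ℕ) (ω : Ω) : ℝ :=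
  ∑ i ∈ Finset.range l, seq T X₀ (-(i : ℤ)) ω

/-- The centred sum of squares over a block of length `l`. -/
def sqSum (T : Ω ≃ᵐ Ω) (X₀ : Ω → ℝ) (v : ℝ≥0) (l : ℕ) (ω : Ω) : ℝ :=
  ∑ i ∈ Finset.range l, (seq T X₀ ((i : ℤ) + 1) ω ^ 2 - v)

lemma partialSum_eq (T : Ω ≃ᵐ Ω) (X₀ : Ω → ℝ) (n : ℕ) (ω : Ω) :
    partialSum T X₀ n ω = ∑ i ∈ Finset.range n, seq T X₀ ((i : ℤ) + 1) ω := by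
  unfold partialSum
  rw [← Finset.Ico_add_one_right_eq_Icc, Finset.sum_Ico_eq_sum_range]
  refine Finset.sum_congr (by simp) fun i _ => ?_
  rw [add_comm 1 i]; push_cast; rfl

lemma partialSum_succ (T : Ω ≃ᵐ Ω) (X₀ : Ω → ℝ) (n : ℕ) (ω : Ω) :
    partialSum T X₀ (n + 1) ω = partialSum T X₀ n ω + seq T X₀ ((n : ℤ) + 1) ω := by
  simp_rw [partialSum_eq]
  rw [Finset.sum_range_succ]

lemma partialSum_zero (T : Ω ≃ᵐ Ω) (X₀ : Ω → ℝ) (ω : Ω) : partialSum T X₀ 0 ω = 0 := by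
  simp [partialSum]

lemma pastSum_iter (T : Ω ≃ᵐ Ω) (X₀ : Ω → ℝ) {l q : ℕ} (h : l ≤ q) (ω : Ω) :
    pastSum T X₀ l (iter T q ω) = partialSum T X₀ q ω - partialSum T X₀ (q - l) ω := by
  induction l with
  | zero => simp [pastSum]
  | succ l ih =>
    have h1 : q - l = (q - (l + 1)) + 1 := by omega
    have h2 : pastSum T X₀ (l + 1) (iter T q ω) =
        pastSum T X₀ l (iter T q ω) + seq T X₀ (-(l : ℤ) + q) ω := by
      simp only [pastSum, Finset.sum_range_succ, seq_iter]
    rw [h2, ih (by omega), h1, partialSum_succ]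
    have h3 : -(l : ℤ) + q = ((q - (l + 1) : ℕ) : ℤ) + 1 := by omega
    rw [h3]; ring

lemma pastSum_comp_iter (T : Ω ≃ᵐ Ω) (X₀ : Ω → ℝ) (l : ℕ) :
    pastSum T X₀ l ∘ iter T l = partialSum T X₀ l := by
  ext ω
  simp [pastSum_iter T X₀ (le_refl l), partialSum_zero]

lemma sqSum_add (T : Ω ≃ᵐ Ω) (X₀ : Ω → ℝ) (v : ℝ≥0) (k l : ℕ) (ω : Ω) :
    sqSum T X₀ v (k + l) ω = sqSum T X₀ v k ω + sqSum T X₀ v l (iter T k ω) := by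
  simp only [sqSum, Finset.sum_range_add, seq_iter]
  congr 1
  refine Finset.sum_congr rfl fun i _ => ?_
  congr 3; push_cast; ring

set_option linter.unusedSectionVars false

namespace Stationary

variable {μ : Measure Ω} [IsProbabilityMeasure μ] {T : Ω ≃ᵐ Ω} {X₀ : Ω → ℝ} {v : ℝ≥0} {p : ℝ}
  (H : Stationary F₀ μ T X₀ v p)

include H

lemma sigmaAlg_le (i : ℤ) : sigmaAlg F₀ T i ≤ mΩ :=
  (MeasurableSpace.comap_mono H.le).trans
    (measurePreserving_iter H.pres i).measurable.comap_le

lemma iter_pres (i : ℤ) : MeasurePreserving (iter T i) μ μ := measurePreserving_iter H.pres i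

lemma measurable_seq (i : ℤ) : Measurable (seq T X₀ i) := (H.mart.adapted i).mono (H.sigmaAlg_le i) le_rfl

lemma measurable_seq_of_le {i j : ℤ} (h : i ≤ j) : Measurable[sigmaAlg F₀ T j] (seq T X₀ i) :=
  (H.mart.adapted i).mono (sigmaAlg_mono H.inv h) le_rfl

lemma memLp_seq (i : ℤ) : MemLp (seq T X₀ i) (ENNReal.ofReal p) μ :=
  H.memLp.comp_measurePreserving (H.iter_pres i)

lemma two_le : (2 : ℝ≥0∞) ≤ ENNReal.ofReal p := by
  rw [← ENNReal.ofReal_ofNat]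
  exact ENNReal.ofReal_le_ofReal H.hp.1.le

lemma memLp_two_seq (i : ℤ) : MemLp (seq T X₀ i) 2 μ := (H.memLp_seq i).mono_exponent H.two_le

lemma memLp_partialSum (n : ℕ) : MemLp (partialSum T X₀ n) (ENNReal.ofReal p) μ := by
  have : partialSum T X₀ n = ∑ i ∈ Finset.range n, seq T X₀ ((i : ℤ) + 1) := by
    ext ω; rw [partialSum_eq, Finset.sum_apply]
  rw [this]
  exact memLp_finsetSum' _ fun i _ => H.memLp_seq _

lemma memLp_two_partialSum (n : ℕ) : MemLp (partialSum T X₀ n) 2 μ :=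
  (H.memLp_partialSum n).mono_exponent H.two_le

lemma measurable_partialSum (n : ℕ) : Measurable[sigmaAlg F₀ T n] (partialSum T X₀ n) := by
  have : partialSum T X₀ n = fun ω => ∑ i ∈ Finset.range n, seq T X₀ ((i : ℤ) + 1) ω := by
    ext ω; rw [partialSum_eq]
  rw [this]
  refine Finset.measurable_fun_sum _ fun i hi => H.measurable_seq_of_le ?_
  have := Finset.mem_range.1 hi
  omega

lemma measurable_partialSum' (n : ℕ) : Measurable (partialSum T X₀ n) :=
  (H.measurable_partialSum n).mono (H.sigmaAlg_le n) le_rfl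

lemma measurable_pastSum (l : ℕ) : Measurable[F₀] (pastSum T X₀ l) := by
  have h := sigmaAlg_zero (F₀ := F₀) T
  refine Finset.measurable_fun_sum _ fun i hi => ?_
  have := H.measurable_seq_of_le (i := -(i : ℤ)) (j := 0) (by omega)
  rwa [h] at this

lemma measurable_pastSum' (l : ℕ) : Measurable (pastSum T X₀ l) :=
  (H.measurable_pastSum l).mono H.le le_rfl

lemma map_pastSum (l : ℕ) : μ.map (pastSum T X₀ l) = μ.map (partialSum T X₀ l) := by
  rw [← pastSum_comp_iter T X₀ l, ← Measure.map_map (H.measurable_pastSum' l)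
    (H.iter_pres l).measurable, (H.iter_pres l).map_eq]

lemma integrable_sq (i : ℤ) : Integrable (fun ω => seq T X₀ i ω ^ 2) μ :=
  (H.memLp_two_seq i).integrable_sq

lemma integrable_sqSum (l : ℕ) : Integrable (sqSum T X₀ v l) μ :=
  integrable_finsetSum _ fun _ _ => (H.integrable_sq _).sub (integrable_const _)

lemma integral_sq (i : ℤ) : ∫ ω, seq T X₀ i ω ^ 2 ∂μ = v := by
  rw [← H.var]
  have hm : AEStronglyMeasurable (fun ω => X₀ ω ^ 2) (μ.map (iter T i)) := by
    rw [(H.iter_pres i).map_eq]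
    exact H.memLp.1.pow 2
  rw [← (H.iter_pres i).map_eq, integral_map (H.iter_pres i).measurable.aemeasurable hm,
    (H.iter_pres i).map_eq]
  rfl

lemma condExp_mul_seq {W : Ω → ℝ} (k : ℤ) (hW : Measurable[sigmaAlg F₀ T k] W)
    (hi : Integrable (fun ω => W ω * seq T X₀ (k + 1) ω) μ) :
    μ[fun ω => W ω * seq T X₀ (k + 1) ω | sigmaAlg F₀ T k] =ᵐ[μ] 0 := by
  have h1 := condExp_mul_of_stronglyMeasurable_left (μ := μ) (m := sigmaAlg F₀ T k)
    hW.stronglyMeasurable hi (H.mart.integrable (k + 1))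
  have h2 := H.mart.condExp_eq_zero (k + 1)
  rw [add_sub_cancel_right] at h2
  refine h1.trans ?_
  filter_upwards [h2] with ω hω
  simp [hω]

lemma integral_mul_seq {W : Ω → ℝ} (k : ℤ) (hW : Measurable[sigmaAlg F₀ T k] W)
    (hi : Integrable (fun ω => W ω * seq T X₀ (k + 1) ω) μ) :
    ∫ ω, W ω * seq T X₀ (k + 1) ω ∂μ = 0 := by
  rw [← integral_condExp (H.sigmaAlg_le k), integral_congr_ae (H.condExp_mul_seq k hW hi)]
  simp

/-- Expanding the square, the cross terms S_n X_{n+1} have zero conditional expectation given F_n,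
hence given F₀. -/
lemma condExp_sq_partialSum (n : ℕ) :
    μ[fun ω => partialSum T X₀ n ω ^ 2 - n * v | F₀] =ᵐ[μ] μ[sqSum T X₀ v n | F₀] := by
  induction n with
  | zero =>
    refine condExp_congr_ae (ae_of_all _ fun ω => ?_)
    simp [partialSum_zero, sqSum]
  | succ n ih =>
    have i1 : Integrable (fun ω => partialSum T X₀ n ω ^ 2 - n * v) μ :=
      (H.memLp_two_partialSum n).integrable_sq.sub (integrable_const _)
    have i2 : Integrable (fun ω => partialSum T X₀ n ω * seq T X₀ ((n : ℤ) + 1) ω) μ :=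
      MemLp.integrable_mul (p := 2) (q := 2) (H.memLp_two_partialSum n) (H.memLp_two_seq _)
    have i3 : Integrable (fun ω => seq T X₀ ((n : ℤ) + 1) ω ^ 2 - v) μ :=
      (H.integrable_sq _).sub (integrable_const _)
    have e1 : (fun ω => partialSum T X₀ (n + 1) ω ^ 2 - ((n + 1 : ℕ) : ℝ) * v) =
        ((fun ω => partialSum T X₀ n ω ^ 2 - n * v) +
          (2 : ℝ) • fun ω => partialSum T X₀ n ω * seq T X₀ ((n : ℤ) + 1) ω) +
          fun ω => seq T X₀ ((n : ℤ) + 1) ω ^ 2 - v := by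
      ext ω
      simp only [partialSum_succ, Pi.add_apply, Pi.smul_apply, smul_eq_mul]
      push_cast; ring
    have e2 : sqSum T X₀ v (n + 1) =
        sqSum T X₀ v n + fun ω => seq T X₀ ((n : ℤ) + 1) ω ^ 2 - v := by
      ext ω
      simp only [sqSum, Finset.sum_range_succ, Pi.add_apply]
    have hz : μ[fun ω => partialSum T X₀ n ω * seq T X₀ ((n : ℤ) + 1) ω | F₀] =ᵐ[μ] 0 := by
      have hle : F₀ ≤ sigmaAlg F₀ T n := by
        have := sigmaAlg_mono H.inv (Int.natCast_nonneg n)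
        rwa [sigmaAlg_zero] at this
      refine (condExp_condExp_of_le hle (H.sigmaAlg_le n)).symm.trans ?_
      refine (condExp_congr_ae (H.condExp_mul_seq n (H.measurable_partialSum n) i2)).trans ?_
      rw [condExp_zero]
    rw [e1, e2]
    filter_upwards [ih, hz, condExp_add (m := F₀) (i1.add (i2.smul (2 : ℝ))) i3,
      condExp_add (m := F₀) i1 (i2.smul (2 : ℝ)),
      condExp_smul (2 : ℝ) (fun ω => partialSum T X₀ n ω * seq T X₀ ((n : ℤ) + 1) ω) F₀ (μ := μ),
      condExp_add (m := F₀) (H.integrable_sqSum n) i3] with ω h1 h2 h3 h4 h5 h6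
    rw [h3, h6, Pi.add_apply, Pi.add_apply, h4, Pi.add_apply, h5, Pi.smul_apply, h1, h2]
    simp

lemma condVarDev_eq {σ : ℝ} (hσ : σ ^ 2 = v) {n : ℕ} (hn : 1 ≤ n) :
    μ[sqSum T X₀ v n | F₀] =ᵐ[μ] fun ω => n * condVarDev F₀ μ T X₀ σ n ω := by
  have hn0 : (n : ℝ) ≠ 0 := by positivity
  have i1 : Integrable (fun ω => partialSum T X₀ n ω ^ 2 / n) μ :=
    (H.memLp_two_partialSum n).integrable_sq.div_const _
  have e : (fun ω => partialSum T X₀ n ω ^ 2 - n * v) =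
      (n : ℝ) • ((fun ω => partialSum T X₀ n ω ^ 2 / n) - fun _ => (v : ℝ)) := by
    ext ω
    simp only [Pi.smul_apply, Pi.sub_apply, smul_eq_mul]
    field_simp
  have h := H.condExp_sq_partialSum n
  rw [e] at h
  filter_upwards [h, condExp_smul (n : ℝ)
      ((fun ω => partialSum T X₀ n ω ^ 2 / n) - fun _ => (v : ℝ)) F₀ (μ := μ),
    condExp_sub (m := F₀) i1 (integrable_const (μ := μ) (v : ℝ))] with ω h1 h2 h3
  rw [← h1, h2, Pi.smul_apply, h3, Pi.sub_apply, condExp_const H.le, condVarDev, hσ, smul_eq_mul]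

/-- A set s of F₀ is the preimage under T^k of a set s' in F_{-k} ⊆ F₀. Invariance of μ moves both
integrals over s to s', where h and its conditional expectation given F₀ agree. -/
lemma condExp_comp_iter {h : Ω → ℝ} (hh : Integrable h μ) (k : ℕ) :
    μ[h ∘ iter T k | F₀] =ᵐ[μ] μ[μ[h | F₀] ∘ iter T k | F₀] := by
  have hk := H.iter_pres k
  have i1 : Integrable (h ∘ iter T k) μ := hk.integrable_comp_of_integrable hh
  have i2 : Integrable (μ[h | F₀] ∘ iter T k) μ := hk.integrable_comp_of_integrable integrable_condExp
  refine (ae_eq_condExp_of_forall_setIntegral_eq H.le i1 (fun s _ _ =>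
    integrable_condExp.integrableOn) (fun s hs _ => ?_)
    stronglyMeasurable_condExp.aestronglyMeasurable).symm
  rw [setIntegral_condExp H.le i2 hs]
  have hneg : sigmaAlg F₀ T (-(k : ℤ)) ≤ F₀ := by
    have := sigmaAlg_mono H.inv (by omega : -(k : ℤ) ≤ 0)
    rwa [sigmaAlg_zero] at this
  set s' := iter T (-(k : ℤ)) ⁻¹' s
  have hs' : MeasurableSet[F₀] s' := hneg _ ⟨s, hs, rfl⟩
  have hss : s = iter T k ⁻¹' s' := by
    ext ω
    simp [s', iter_iter, iter_zero]
  have key : ∀ g : Ω → ℝ, Integrable g μ → ∫ ω in s, (g ∘ iter T k) ω ∂μ = ∫ ω in s', g ω ∂μ := by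
    intro g hg
    conv_rhs => rw [← hk.map_eq]
    rw [setIntegral_map (H.le _ hs') (by rw [hk.map_eq]; exact hg.1) hk.measurable.aemeasurable,
      ← hss]
    rfl
  rw [key _ integrable_condExp, key _ hh, setIntegral_condExp H.le hh hs']

/-- Split the block at k; the second part is the shift of a block of length l - k, and the weight,
being F₀-measurable, passes through the outer conditional expectation. -/
lemma lintegral_mul_condExp_sqSum_le {w : Ω → ℝ≥0∞} (hw : Measurable[F₀] w) {k l : ℕ}
    (hkl : k ≤ l) :
    ∫⁻ ω, w ω * ‖(μ[sqSum T X₀ v l | F₀]) ω‖ₑ ∂μ ≤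
      ∫⁻ ω, w ω * ‖(μ[sqSum T X₀ v k | F₀]) ω‖ₑ ∂μ +
      ∫⁻ ω, w ω * ‖(μ[sqSum T X₀ v (l - k) | F₀]) (iter T k ω)‖ₑ ∂μ := by
  have hk := H.iter_pres k
  have i1 := H.integrable_sqSum (l - k)
  have e : sqSum T X₀ v l = sqSum T X₀ v k + sqSum T X₀ v (l - k) ∘ iter T k := by
    ext ω
    conv_lhs => rw [← Nat.add_sub_cancel' hkl]
    rw [sqSum_add]; rfl
  have h1 : μ[sqSum T X₀ v l | F₀] =ᵐ[μ] μ[sqSum T X₀ v k | F₀] +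
      μ[μ[sqSum T X₀ v (l - k) | F₀] ∘ iter T k | F₀] := by
    rw [e]
    exact (condExp_add (H.integrable_sqSum k) (hk.integrable_comp_of_integrable i1) F₀).trans
      ((ae_eq_refl _).add (H.condExp_comp_iter i1 k))
  have h2 := lintegral_mul_condExp_le (μ := μ) H.le
    (hk.integrable_comp_of_integrable (integrable_condExp (m := F₀) (f := sqSum T X₀ v (l - k)))) hw
  refine le_trans ?_ (add_le_add_right h2 _)
  rw [← lintegral_add_left]
  · refine lintegral_mono_ae ?_
    filter_upwards [h1] with ω hω
    rw [hω, ← mul_add]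
    exact mul_le_mul_right (enorm_add_le _ _) _
  · exact (hw.mono H.le le_rfl).mul (stronglyMeasurable_condExp.mono H.le).measurable.enorm

/-- Averaging the subadditivity of the conditional variances over the splitting point. -/
lemma mul_lintegral_condExp_sqSum_le {w : Ω → ℝ≥0∞} (hw : Measurable[F₀] w) {b : ℕ → ℝ≥0∞}
    (hb : ∀ k j : ℕ, 1 ≤ k → ∫⁻ ω, w ω * ‖(μ[sqSum T X₀ v k | F₀]) (iter T j ω)‖ₑ ∂μ ≤ b k)
    {l : ℕ} (hl : 1 ≤ l) :
    l * ∫⁻ ω, w ω * ‖(μ[sqSum T X₀ v l | F₀]) ω‖ₑ ∂μ ≤ 4 * ∑ k ∈ Finset.Icc 1 l, b k := by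
  set I := fun k => ∫⁻ ω, w ω * ‖(μ[sqSum T X₀ v k | F₀]) ω‖ₑ ∂μ
  have hI : ∀ k, 1 ≤ k → I k ≤ b k := fun k hk => by
    simpa [iter_zero] using hb k 0 hk
  rcases hl.eq_or_lt with h1 | h1
  · subst h1
    simp only [Nat.cast_one, one_mul, Finset.Icc_self, Finset.sum_singleton]
    calc I 1 ≤ b 1 := hI 1 le_rfl
      _ = 1 * b 1 := (one_mul _).symm
      _ ≤ 4 * b 1 := by gcongr; norm_num
  -- Summing over all l - 1 splitting points counts each b k twice by reflection, and l ≤ 2(l - 1)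
  -- supplies the other factor 2.
  · have hsum : ∑ k ∈ Finset.Icc 1 (l - 1), I l ≤
        ∑ k ∈ Finset.Icc 1 (l - 1), (b k + b (l - k)) := by
      refine Finset.sum_le_sum fun k hk => ?_
      rw [Finset.mem_Icc] at hk
      exact (H.lintegral_mul_condExp_sqSum_le hw (by omega : k ≤ l)).trans
        (add_le_add (hI k hk.1) (hb _ _ (by omega)))
    have hrefl : ∑ k ∈ Finset.Icc 1 (l - 1), b (l - k) = ∑ k ∈ Finset.Icc 1 (l - 1), b k := by
      refine Finset.sum_nbij' (fun k => l - k) (fun k => l - k) ?_ ?_ ?_ ?_ ?_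
      all_goals intro k hk; rw [Finset.mem_Icc] at hk
      · rw [Finset.mem_Icc]; omega
      · rw [Finset.mem_Icc]; omega
      · omega
      · omega
    rw [Finset.sum_const, Nat.card_Icc, Finset.sum_add_distrib, hrefl, ← two_mul, nsmul_eq_mul]
      at hsum
    have hle : (l : ℝ≥0∞) ≤ 2 * ((l - 1 + 1 - 1 : ℕ) : ℝ≥0∞) := by
      have : l ≤ 2 * (l - 1 + 1 - 1) := by omega
      exact_mod_cast this
    calc (l : ℝ≥0∞) * I l ≤ 2 * ((l - 1 + 1 - 1 : ℕ) : ℝ≥0∞) * I l := by gcongr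
      _ = 2 * (((l - 1 + 1 - 1 : ℕ) : ℝ≥0∞) * I l) := by ring
      _ ≤ 2 * (2 * ∑ k ∈ Finset.Icc 1 (l - 1), b k) := by gcongr
      _ = 4 * ∑ k ∈ Finset.Icc 1 (l - 1), b k := by ring
      _ ≤ 4 * ∑ k ∈ Finset.Icc 1 l, b k := by
        gcongr
        omega

end Stationary

end Dynamics

/-! ### Rearrangement inequality and the envelope norm -/

lemma volume_Ioo_lt (c : ℝ≥0∞) (hc : c ≤ 1) :
    volume.restrict (Ioo (0 : ℝ) 1) {u | ENNReal.ofReal u < c} = c := by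
  have hc' : c ≠ ∞ := ne_top_of_le_ne_top ENNReal.one_ne_top hc
  rw [Measure.restrict_apply' measurableSet_Ioo]
  have : {u : ℝ | ENNReal.ofReal u < c} ∩ Ioo 0 1 = Ioo 0 c.toReal := by
    have h1 : c.toReal ≤ 1 := ENNReal.toReal_mono ENNReal.one_ne_top hc
    ext u
    simp only [mem_inter_iff, mem_ofPred_eq, mem_Ioo]
    constructor
    · rintro ⟨h2, h3, -⟩
      exact ⟨h3, (ENNReal.ofReal_lt_iff_lt_toReal h3.le hc').1 h2⟩
    · rintro ⟨h2, h3⟩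
      exact ⟨(ENNReal.ofReal_lt_iff_lt_toReal h2.le hc').2 h3, h2, h3.trans_le h1⟩
  rw [this, Real.volume_Ioo, sub_zero, ENNReal.ofReal_toReal hc']

lemma le_absQuantile {Ω : Type*} [MeasurableSpace Ω] (μ : Measure Ω) [IsProbabilityMeasure μ]
    {D : Ω → ℝ} (hD : Measurable D) {u t : ℝ} (hu : 0 < u)
    (h : ENNReal.ofReal u < μ {ω | t < |D ω|}) : t ≤ absQuantile μ D u := by
  refine le_csInf ?_ ?_
  · have hanti : Antitone fun n : ℕ => {ω | (n : ℝ) < |D ω|} := by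
      intro i j hij ω hω
      exact lt_of_le_of_lt (show (i : ℝ) ≤ j by exact_mod_cast hij) (show (j : ℝ) < |D ω| from hω)
    have ht := tendsto_measure_iInter_atTop (μ := μ)
      (fun n : ℕ => (measurableSet_lt measurable_const
        (by fun_prop : Measurable fun ω => |D ω|)).nullMeasurableSet) hanti
      ⟨0, measure_ne_top _ _⟩
    have hempty : ⋂ n : ℕ, {ω | (n : ℝ) < |D ω|} = ∅ := by
      refine eq_empty_of_forall_notMem fun ω hω => ?_
      obtain ⟨n, hn⟩ := exists_nat_gt |D ω|
      exact absurd (mem_iInter.1 hω n) (not_lt.2 hn.le)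
    rw [hempty, measure_empty] at ht
    obtain ⟨n, hn⟩ := (ht.eventually (gt_mem_nhds (ENNReal.ofReal_pos.2 hu))).exists
    exact ⟨n, Nat.cast_nonneg n, hn.le⟩
  · rintro s ⟨-, hs⟩
    by_contra hst
    push Not at hst
    exact absurd (h.trans_le (measure_mono fun ω (hω : t < |D ω|) => hst.trans hω))
      (not_lt.2 hs)

/-- A Hardy-Littlewood inequality. -/
theorem lintegral_mul_le_quantile {Ω : Type*} [MeasurableSpace Ω] (μ : Measure Ω)
    [IsProbabilityMeasure μ] {A D : Ω → ℝ} (hA : Measurable A) (hA0 : ∀ ω, 0 ≤ A ω)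
    (hD : Measurable D) (qa : ℝ → ℝ)
    (hqa : ∀ u ∈ Ioo (0 : ℝ) 1, ∀ s, 0 < s → ENNReal.ofReal u < μ {ω | s < A ω} → s ≤ qa u) :
    ∫⁻ ω, ENNReal.ofReal (A ω) * ‖D ω‖ₑ ∂μ ≤
      ∫⁻ u in Ioo (0 : ℝ) 1, ENNReal.ofReal (qa u) * ENNReal.ofReal (absQuantile μ D u) := by
  set a : ℝ → ℝ≥0∞ := fun s => μ {ω | s < A ω}
  set b : ℝ → ℝ≥0∞ := fun t => μ {ω | t < |D ω|}
  have ha : Measurable a := Antitone.measurable fun s s' h =>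
    measure_mono fun ω (hω : s' < A ω) => h.trans_lt hω
  have hb : Measurable b := Antitone.measurable fun s s' h =>
    measure_mono fun ω (hω : s' < |D ω|) => h.trans_lt hω
  have hDm : Measurable fun ω => ‖D ω‖ₑ := hD.enorm
  set ν := volume.restrict (Ioo (0 : ℝ) 1)
  have h1 : ∫⁻ ω, ENNReal.ofReal (A ω) * ‖D ω‖ₑ ∂μ =
      ∫⁻ s in Ioi (0 : ℝ), (μ.withDensity fun ω => ‖D ω‖ₑ) {ω | s < A ω} := by
    rw [← lintegral_eq_lintegral_meas_lt _ (ae_of_all _ hA0) hA.aemeasurable,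
      lintegral_withDensity_eq_lintegral_mul _ hDm (by fun_prop)]
    refine lintegral_congr fun ω => ?_
    simp [mul_comm]
  -- Layer cake in both variables: the joint tail is at most the smaller of the two tails, which is
  -- the length of the set of u lying below both.
  have h2 : ∀ s, (μ.withDensity fun ω => ‖D ω‖ₑ) {ω | s < A ω} ≤
      ∫⁻ t in Ioi (0 : ℝ), ∫⁻ u, {u | ENNReal.ofReal u < a s}.indicator 1 u *
        {u | ENNReal.ofReal u < b t}.indicator 1 u ∂ν := by
    intro s
    rw [withDensity_apply _ (measurableSet_lt measurable_const hA)]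
    have e : ∀ ω, ‖D ω‖ₑ = ENNReal.ofReal |D ω| := fun ω => Real.enorm_eq_ofReal_abs _
    simp_rw [e]
    rw [lintegral_eq_lintegral_meas_lt _ (ae_of_all _ fun ω => abs_nonneg (D ω))
      (by fun_prop)]
    refine lintegral_mono fun t => ?_
    have e2 : ∀ u, {u | ENNReal.ofReal u < a s}.indicator (1 : ℝ → ℝ≥0∞) u *
        {u | ENNReal.ofReal u < b t}.indicator 1 u =
        {u | ENNReal.ofReal u < min (a s) (b t)}.indicator 1 u := by
      intro u
      by_cases p1 : ENNReal.ofReal u < a s <;> by_cases p2 : ENNReal.ofReal u < b t <;>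
        simp [p1, p2]
    simp_rw [e2]
    rw [lintegral_indicator_one (measurableSet_lt (by fun_prop) measurable_const),
      volume_Ioo_lt _ (min_le_of_left_le prob_le_one)]
    refine le_min ?_ (Measure.restrict_apply_le _ _)
    exact (measure_mono (subset_univ _)).trans (by simp)
  have m1 : Measurable fun z : ℝ × ℝ => {u | ENNReal.ofReal u < a z.1}.indicator
      (1 : ℝ → ℝ≥0∞) z.2 := by
    have : (fun z : ℝ × ℝ => {u | ENNReal.ofReal u < a z.1}.indicator (1 : ℝ → ℝ≥0∞) z.2) =
        {z : ℝ × ℝ | ENNReal.ofReal z.2 < a z.1}.indicator 1 := by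
      ext z; simp [indicator]
    rw [this]
    exact measurable_one.indicator (measurableSet_lt (by fun_prop) (by fun_prop))
  have m2 : Measurable fun z : ℝ × ℝ => {u | ENNReal.ofReal u < b z.1}.indicator
      (1 : ℝ → ℝ≥0∞) z.2 := by
    have : (fun z : ℝ × ℝ => {u | ENNReal.ofReal u < b z.1}.indicator (1 : ℝ → ℝ≥0∞) z.2) =
        {z : ℝ × ℝ | ENNReal.ofReal z.2 < b z.1}.indicator 1 := by
      ext z; simp [indicator]
    rw [this]
    exact measurable_one.indicator (measurableSet_lt (by fun_prop) (by fun_prop))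
  set α : ℝ → ℝ → ℝ≥0∞ := fun s u => {u | ENNReal.ofReal u < a s}.indicator 1 u with hα
  set β : ℝ → ℝ → ℝ≥0∞ := fun s u => {u | ENNReal.ofReal u < b s}.indicator 1 u with hβ
  have m1' : Measurable fun z : ℝ × ℝ => α z.1 z.2 := m1
  have m2' : Measurable fun z : ℝ × ℝ => β z.1 z.2 := m2
  have mβ : Measurable fun u => ∫⁻ t in Ioi (0 : ℝ), β t u :=
    (m2'.comp measurable_swap).lintegral_prod_right'
  have sα : ∀ s, Measurable (α s) := fun s => m1'.comp measurable_prodMk_left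
  have sα' : ∀ u, Measurable fun s => α s u := fun u => m1'.comp measurable_prodMk_right
  have sβ' : ∀ u, Measurable fun s => β s u := fun u => m2'.comp measurable_prodMk_right
  calc ∫⁻ ω, ENNReal.ofReal (A ω) * ‖D ω‖ₑ ∂μ
      ≤ ∫⁻ s in Ioi (0 : ℝ), ∫⁻ t in Ioi (0 : ℝ), ∫⁻ u, α s u * β t u ∂ν := by
        rw [h1]; exact lintegral_mono h2
    _ = ∫⁻ s in Ioi (0 : ℝ), ∫⁻ u, α s u * (∫⁻ t in Ioi (0 : ℝ), β t u) ∂ν := by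
        refine lintegral_congr fun s => ?_
        rw [lintegral_lintegral_swap]
        · refine lintegral_congr fun u => ?_
          rw [lintegral_const_mul _ (sβ' u)]
        · exact (((sα s).comp measurable_snd).mul m2').aemeasurable
    _ = ∫⁻ u, (∫⁻ s in Ioi (0 : ℝ), α s u) * (∫⁻ t in Ioi (0 : ℝ), β t u) ∂ν := by
        rw [lintegral_lintegral_swap]
        · refine lintegral_congr fun u => ?_
          rw [lintegral_mul_const _ (sα' u)]
        · exact (m1'.mul (mβ.comp measurable_snd)).aemeasurable
    _ ≤ _ := by
        -- For fixed u, the levels s at which the tail exceeds u lie in (0, qa u]; only an upper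
        -- bound for the quantile function of A is needed.
        refine setLIntegral_mono' measurableSet_Ioo fun u hu => ?_
        have gen : ∀ (S : Set ℝ) (c : ℝ), MeasurableSet S → (∀ s ∈ S, 0 < s → s ≤ c) →
            ∫⁻ s in Ioi (0 : ℝ), S.indicator 1 s ≤ ENNReal.ofReal c := by
          intro S c hS h
          rw [lintegral_indicator_one hS, Measure.restrict_apply' measurableSet_Ioi]
          refine (measure_mono (t := Ioc 0 c) fun s hs => ⟨hs.2, h s hs.1 hs.2⟩).trans ?_
          simp
        refine mul_le_mul' ?_ ?_
        · have : (fun s => α s u) = {s | ENNReal.ofReal u < a s}.indicator 1 := by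
            ext s; simp [hα, indicator]
          rw [this]
          exact gen _ _ (measurableSet_lt measurable_const ha) fun s hs h0 => hqa u hu s h0 hs
        · have : (fun s => β s u) = {s | ENNReal.ofReal u < b s}.indicator 1 := by
            ext s; simp [hβ, indicator]
          rw [this]
          exact gen _ _ (measurableSet_lt measurable_const hb) fun s hs _ =>
            le_absQuantile μ hD hu.1 hs

lemma one_le_envelope_weight {p : ℝ} (hp : 2 ≤ p) (u : ℝ) :
    1 ≤ (max 1 (normalQuantile (1 - u / 2))) ^ (p - 2) :=
  Real.one_le_rpow (le_max_left _ _) (by linarith)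

lemma lintegral_enorm_le_envelopeNorm {Ω : Type*} [MeasurableSpace Ω] (μ : Measure Ω)
    [IsProbabilityMeasure μ] {D : Ω → ℝ} (hD : Measurable D) {p : ℝ} (hp : 2 ≤ p) :
    ∫⁻ ω, ‖D ω‖ₑ ∂μ ≤ envelopeNorm p μ D := by
  have h := lintegral_mul_le_quantile μ (A := fun _ => 1) measurable_const
    (fun _ => zero_le_one) hD (fun _ => 1) (by
      intro u hu s _ h
      by_contra hs
      have he : {ω : Ω | s < (1 : ℝ)} = ∅ :=
        eq_empty_of_forall_notMem fun _ (hω : s < 1) => hs hω.le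
      rw [he, measure_empty] at h
      exact not_lt_zero h)
  simp only [ENNReal.ofReal_one, one_mul] at h
  refine h.trans (setLIntegral_mono' measurableSet_Ioo fun u hu => ?_)
  refine ENNReal.ofReal_le_ofReal ?_
  refine le_mul_of_one_le_left ?_ (one_le_envelope_weight hp u)
  exact Real.sInf_nonneg fun t ht => ht.1

/-- By symmetry the two-sided tail at s is 2(1 - Φ(s)), which explains the argument 1 - u/2 in the
envelope norm. -/
lemma gaussian_abs_tail {s u : ℝ} (hu : u ∈ Ioo (0 : ℝ) 1)
    (h : ENNReal.ofReal u < gaussianReal 0 1 {y | s < |y|}) : s ≤ normalQuantile (1 - u / 2) := by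
  by_contra hs
  push Not at hs
  have hu' : 1 - u / 2 ∈ Ioo (0 : ℝ) 1 := ⟨by linarith [hu.2], by linarith [hu.1]⟩
  have h1 : 1 - u / 2 ≤ cdf (gaussianReal 0 1) s :=
    (quantile_le_iff (gaussianReal 0 1) hu' s).1 hs.le
  have h2 : (gaussianReal 0 1).real (Ioi s) ≤ u / 2 := by
    have h3 := probReal_compl_eq_one_sub (μ := gaussianReal 0 1) (s := Iic s) measurableSet_Iic
    rw [compl_Iic, ← cdf_eq_real] at h3
    linarith
  have h3 : (gaussianReal 0 1).real (Iio (-s)) = (gaussianReal 0 1).real (Ioi s) := by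
    have h4 := gaussianReal_map_neg (μ := 0) (v := 1)
    rw [neg_zero] at h4
    conv_lhs => rw [← h4]
    rw [map_measureReal_apply (by fun_prop) measurableSet_Iio]
    congr 1
    ext y; simp
  have h5 : {y : ℝ | s < |y|} ⊆ Ioi s ∪ Iio (-s) := by
    intro y hy
    rcases lt_abs.1 (show s < |y| from hy) with h | h
    · exact Or.inl h
    · exact Or.inr (by simp only [mem_Iio]; linarith)
  have h6 : (gaussianReal 0 1).real {y | s < |y|} ≤ u := by
    refine (measureReal_mono h5).trans ((measureReal_union_le _ _).trans ?_)
    linarith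
  rw [← ofReal_measureReal] at h
  exact absurd h (not_lt.2 (ENNReal.ofReal_le_ofReal h6))

lemma gaussian_rpow_tail {w : ℝ≥0} (hw : w ≠ 0) {α : ℝ} (hα : 0 < α) {s u : ℝ} (hs : 0 < s)
    (hu : u ∈ Ioo (0 : ℝ) 1) (h : ENNReal.ofReal u < gaussianReal 0 w {y | s < |y| ^ α}) :
    s ≤ (w : ℝ) ^ (α / 2) * (max 1 (normalQuantile (1 - u / 2))) ^ α := by
  have hw0 : (0 : ℝ) < w := by exact_mod_cast pos_iff_ne_zero.2 hw
  have hsq : 0 < √(w : ℝ) := Real.sqrt_pos.2 hw0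
  rw [gaussianReal_eq_map_sqrt w, Measure.map_apply (by fun_prop)
    (measurableSet_lt measurable_const (by fun_prop))] at h
  have hset : (fun y => √(w : ℝ) * y) ⁻¹' {y | s < |y| ^ α} = {y | s ^ α⁻¹ / √(w : ℝ) < |y|} := by
    ext y
    simp only [mem_preimage, mem_ofPred_eq]
    rw [div_lt_iff₀ hsq, abs_mul, abs_of_pos hsq, mul_comm |y|,
      Real.rpow_inv_lt_iff_of_pos hs.le (by positivity) hα]
  rw [hset] at h
  have h1 := gaussian_abs_tail hu h
  have h2 : s ^ α⁻¹ ≤ √(w : ℝ) * max 1 (normalQuantile (1 - u / 2)) := by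
    rw [div_le_iff₀ hsq] at h1
    refine h1.trans ?_
    rw [mul_comm]
    exact mul_le_mul_of_nonneg_left (le_max_right _ _) hsq.le
  have h3 := Real.rpow_le_rpow (by positivity) h2 hα.le
  rw [Real.rpow_inv_rpow hs.le hα.ne', Real.mul_rpow hsq.le (by positivity), Real.sqrt_eq_rpow,
    ← Real.rpow_mul hw0.le] at h3
  refine h3.trans (le_of_eq ?_)
  congr 2; ring

/-- Comparison of a weight `|R| ^ (p - 2)` with the corresponding Gaussian weight. -/
theorem lintegral_rpow_mul_le {Ω : Type*} [MeasurableSpace Ω] (μ : Measure Ω)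
    [IsProbabilityMeasure μ] {R h : Ω → ℝ} (hR : Measurable R) (hh : Measurable h) {p : ℝ}
    (hp : p ∈ Ioc (2 : ℝ) 3) {w : ℝ≥0} (hw : w ≠ 0) {P : Measure (ℝ × ℝ)}
    (hP : P ∈ couplings (μ.map R) (gaussianReal 0 w)) :
    ∫⁻ ω, ENNReal.ofReal (|R ω| ^ (p - 2)) * ‖h ω‖ₑ ∂μ ≤
      ENNReal.ofReal ((w : ℝ) ^ ((p - 2) / 2)) * envelopeNorm p μ h +
      (∫⁻ z, ENNReal.ofReal (|z.1 - z.2| ^ p) ∂P) ^ ((p - 2) / p) *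
        eLpNorm h (ENNReal.ofReal (p / 2)) μ := by
  have hp0 : 0 < p := by linarith [hp.1]
  have hα : p - 2 ∈ Ioc (0 : ℝ) 1 := ⟨by linarith [hp.1], by linarith [hp.2]⟩
  have : IsProbabilityMeasure P := by
    refine ⟨?_⟩
    have h1 : P.map Prod.fst univ = 1 := by
      rw [hP.1]
      have : IsProbabilityMeasure (μ.map R) := Measure.isProbabilityMeasure_map hR.aemeasurable
      exact measure_univ
    rwa [Measure.map_apply measurable_fst MeasurableSet.univ, preimage_univ] at h1
  -- The Gaussian variable must live together with h, not only with R. It is drawn from the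
  -- conditional law of P given the value of R; under `Q` the pair formed with R then has law P.
  let κ : Kernel Ω ℝ := P.condKernel.comap R hR
  let Q : Measure (Ω × ℝ) := μ ⊗ₘ κ
  have hfst : ∀ f : Ω → ℝ≥0∞, Measurable f → ∫⁻ z, f z.1 ∂Q = ∫⁻ ω, f ω ∂μ := by
    intro f hf
    rw [Measure.lintegral_compProd (by fun_prop)]
    simp
  have hRg : ∀ f : ℝ × ℝ → ℝ≥0∞, Measurable f → ∫⁻ z, f (R z.1, z.2) ∂Q = ∫⁻ z, f z ∂P := by
    intro f hf
    rw [Measure.lintegral_compProd (by fun_prop)]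
    conv_rhs => rw [← P.disintegrate P.condKernel]
    rw [Measure.lintegral_compProd hf, Measure.fst, hP.1, lintegral_map _ hR]
    · rfl
    · exact hf.lintegral_kernel_prod_right'
  have hsnd : ∀ f : ℝ → ℝ≥0∞, Measurable f → ∫⁻ z, f z.2 ∂Q = ∫⁻ y, f y ∂gaussianReal 0 w := by
    intro f hf
    rw [hRg (fun z => f z.2) (by fun_prop), ← hP.2, lintegral_map hf measurable_snd]
  have hmeasfst : ∀ t, Q {z | t < |h z.1|} = μ {ω | t < |h ω|} := by
    intro t
    have hs : MeasurableSet {ω | t < |h ω|} := measurableSet_lt measurable_const (by fun_prop)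
    have := hfst ({ω | t < |h ω|}.indicator 1) (measurable_one.indicator hs)
    rw [lintegral_indicator_one hs] at this
    rw [← this, ← lintegral_indicator_one (measurableSet_lt measurable_const (by fun_prop))]
    rfl
  have hquant : absQuantile Q (fun z => h z.1) = absQuantile μ h := by
    ext u
    simp only [absQuantile, hmeasfst]
  have hmeassnd : ∀ s : ℝ, Q {z | s < |z.2| ^ (p - 2)} =
      gaussianReal 0 w {y | s < |y| ^ (p - 2)} := by
    intro s
    have hs : MeasurableSet {y : ℝ | s < |y| ^ (p - 2)} :=
      measurableSet_lt measurable_const (by fun_prop)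
    have := hsnd ({y : ℝ | s < |y| ^ (p - 2)}.indicator 1) (measurable_one.indicator hs)
    rw [lintegral_indicator_one hs] at this
    rw [← this, ← lintegral_indicator_one (measurableSet_lt measurable_const (by fun_prop))]
    rfl
  have step1 : ∫⁻ ω, ENNReal.ofReal (|R ω| ^ (p - 2)) * ‖h ω‖ₑ ∂μ ≤
      ∫⁻ z, ENNReal.ofReal (|z.2| ^ (p - 2)) * ‖h z.1‖ₑ ∂Q +
      ∫⁻ z, ENNReal.ofReal (|R z.1 - z.2| ^ (p - 2)) * ‖h z.1‖ₑ ∂Q := by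
    rw [← hfst (fun ω => ENNReal.ofReal (|R ω| ^ (p - 2)) * ‖h ω‖ₑ) (by fun_prop),
      ← lintegral_add_left (by fun_prop)]
    refine lintegral_mono fun z => ?_
    rw [← add_mul, ← ENNReal.ofReal_add (by positivity) (by positivity)]
    gcongr
    have := abs_rpow_le_add hα z.2 (R z.1 - z.2)
    rwa [add_sub_cancel] at this
  refine step1.trans (add_le_add ?_ ?_)
  · refine (lintegral_mul_le_quantile Q (A := fun z => |z.2| ^ (p - 2)) (by fun_prop)
      (fun z => by positivity) (D := fun z => h z.1) (by fun_prop)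
      (fun u => (w : ℝ) ^ ((p - 2) / 2) * (max 1 (normalQuantile (1 - u / 2))) ^ (p - 2))
      (fun u hu s hs hlt => ?_)).trans ?_
    · rw [hmeassnd] at hlt
      exact gaussian_rpow_tail hw hα.1 hs hu hlt
    · rw [hquant, envelopeNorm, ← lintegral_const_mul' _ _ ENNReal.ofReal_ne_top]
      refine lintegral_mono fun u => le_of_eq ?_
      rw [ENNReal.ofReal_mul (by positivity), mul_assoc, ← ENNReal.ofReal_mul (by positivity)]
  -- Hölder with these exponents turns |R - Y|^(p-2) into the p-cost and leaves h in L^(p/2).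
  · have hconj : (p / (p - 2)).HolderConjugate (p / 2) := by
      rw [Real.holderConjugate_iff]
      refine ⟨?_, ?_⟩
      · rw [lt_div_iff₀ hα.1]; linarith
      · rw [inv_div, inv_div]; field_simp; ring
    refine (ENNReal.lintegral_mul_le_Lp_mul_Lq Q hconj (by fun_prop) (by fun_prop)).trans ?_
    rw [one_div_div, one_div_div]
    have e1 : ∫⁻ z, ENNReal.ofReal (|R z.1 - z.2| ^ (p - 2)) ^ (p / (p - 2)) ∂Q =
        ∫⁻ z, ENNReal.ofReal (|z.1 - z.2| ^ p) ∂P := by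
      rw [← hRg (fun z => ENNReal.ofReal (|z.1 - z.2| ^ p)) (by fun_prop)]
      refine lintegral_congr fun z => ?_
      rw [ENNReal.ofReal_rpow_of_nonneg (by positivity) (by have := hα.1; positivity),
        ← Real.rpow_mul (abs_nonneg _), mul_div_cancel₀ _ hα.1.ne']
    have e2 : (∫⁻ z, ‖h z.1‖ₑ ^ (p / 2) ∂Q) ^ (2 / p) = eLpNorm h (ENNReal.ofReal (p / 2)) μ := by
      rw [hfst (fun ω => ‖h ω‖ₑ ^ (p / 2)) (by fun_prop),
        eLpNorm_eq_lintegral_rpow_enorm_toReal (by simpa using hp0) ENNReal.ofReal_ne_top,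
        ENNReal.toReal_ofReal (by positivity), one_div_div]
    rw [e1, e2]

/-! ### One step of the Lindeberg replacement -/

/-- The mean value inequality is applied twice along the segment; monotonicity of w bounds every
intermediate increment of φ'' by w |a|. -/
lemma taylor_two {φ φ1 φ2 w : ℝ → ℝ} (h1 : ∀ x, HasDerivAt φ (φ1 x) x)
    (h2 : ∀ x, HasDerivAt φ1 (φ2 x) x) (hw : MonotoneOn w (Ici 0))
    (hmod : ∀ x y, |φ2 x - φ2 y| ≤ w |x - y|) (x a : ℝ) :
    |φ (x + a) - (φ x + φ1 x * a + 1 / 2 * (φ2 x * a ^ 2))| ≤ w |a| * a ^ 2 := by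
  have hlin : ∀ t : ℝ, HasDerivAt (fun t : ℝ => x + t * a) a t := fun t => by
    simpa using ((hasDerivAt_id t).mul_const a).const_add x
  have hsmall : ∀ t ∈ Ico (0 : ℝ) 1, |φ2 (x + t * a) - φ2 x| ≤ w |a| := by
    intro t ht
    refine (hmod _ _).trans (hw (mem_Ici.2 (abs_nonneg _)) (mem_Ici.2 (abs_nonneg _)) ?_)
    rw [add_sub_cancel_left, abs_mul, abs_of_nonneg ht.1]
    exact mul_le_of_le_one_left (abs_nonneg _) ht.2.le
  have hw0 : 0 ≤ w |a| := (abs_nonneg _).trans (hsmall 0 ⟨le_rfl, one_pos⟩)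
  have first : ∀ t ∈ Icc (0 : ℝ) 1, |φ1 (x + t * a) - φ1 x - t * (φ2 x * a)| ≤ w |a| * |a| := by
    intro t ht
    have := norm_image_sub_le_of_norm_deriv_le_segment' (a := 0) (b := 1) (C := w |a| * |a|)
      (f := fun t => φ1 (x + t * a) - φ1 x - t * (φ2 x * a))
      (f' := fun t => φ2 (x + t * a) * a - φ2 x * a)
      (fun t _ => by
        have := (((h2 (x + t * a)).comp t (hlin t)).sub_const (φ1 x)).sub
          ((hasDerivAt_id t).mul_const (φ2 x * a))
        rw [one_mul] at this
        exact this.hasDerivWithinAt)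
      (fun t ht => by
        rw [← sub_mul, norm_mul, Real.norm_eq_abs, Real.norm_eq_abs]
        exact mul_le_mul_of_nonneg_right (hsmall t ht) (abs_nonneg _)) t ht
    simp only [Real.norm_eq_abs, zero_mul, add_zero, sub_self, sub_zero] at this
    refine this.trans (mul_le_of_le_one_right (by positivity) ht.2)
  have second := norm_image_sub_le_of_norm_deriv_le_segment_01' (C := w |a| * |a| * |a|)
      (f := fun t => φ (x + t * a) - t * (φ1 x * a) - t ^ 2 * (1 / 2 * (φ2 x * a ^ 2)))
      (f' := fun t => (φ1 (x + t * a) - φ1 x - t * (φ2 x * a)) * a)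
      (fun t _ => by
        have := (((h1 (x + t * a)).comp t (hlin t)).sub
          ((hasDerivAt_id t).mul_const (φ1 x * a))).sub
          ((hasDerivAt_pow 2 t).mul_const (1 / 2 * (φ2 x * a ^ 2)))
        refine (this.congr_deriv ?_).hasDerivWithinAt
        push_cast
        ring)
      (fun t ht => by
        rw [norm_mul, Real.norm_eq_abs, Real.norm_eq_abs]
        exact mul_le_mul_of_nonneg_right (first t ⟨ht.1, ht.2.le⟩) (abs_nonneg _))
  rw [Real.norm_eq_abs] at second
  rw [mul_assoc, abs_mul_abs_self, ← sq] at second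
  refine le_of_eq_of_le ?_ second
  congr 1
  norm_num
  ring

/-- A twice differentiable function whose derivatives have controlled growth. -/
structure TestTriple (p : ℝ) (h h1 h2 : ℝ → ℝ) : Prop where
  deriv_one : ∀ x, HasDerivAt h (h1 x) x
  deriv_two : ∀ x, HasDerivAt h1 (h2 x) x
  measurable_two : Measurable h2
  grows_zero : Grows p h
  grows_one : Grows (p - 1) h1
  grows_two : Grows (p - 2) h2

namespace TestTriple

variable {p : ℝ} {h h1 h2 : ℝ → ℝ}

lemma measurable_one (hh : TestTriple p h h1 h2) : Measurable h1 :=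
  (continuous_iff_continuousAt.2 fun x => (hh.deriv_two x).continuousAt).measurable

lemma measurable_zero (hh : TestTriple p h h1 h2) : Measurable h :=
  (continuous_iff_continuousAt.2 fun x => (hh.deriv_one x).continuousAt).measurable

lemma gsm (hh : TestTriple p h h1 h2) (hp : 2 < p) (t : ℝ≥0) :
    TestTriple p (gsm t h) (gsm t h1) (gsm t h2) where
  deriv_one := hasDerivAt_gsm (by linarith) (by linarith) hh.deriv_one hh.measurable_one
    hh.grows_zero hh.grows_one t
  deriv_two := hasDerivAt_gsm (by linarith) (by linarith) hh.deriv_two hh.measurable_two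
    hh.grows_one hh.grows_two t
  measurable_two := measurable_gsm hh.measurable_two t
  grows_zero := hh.grows_zero.gsm (by linarith) t
  grows_one := hh.grows_one.gsm (by linarith) t
  grows_two := hh.grows_two.gsm (by linarith) t

end TestTriple

/-- The bound is at most a multiple of (1 + |U| + |V|)^p. The form is tailored to products of a
second derivative at U with V². -/
lemma integrable_of_growth {Ω : Type*} [MeasurableSpace Ω] {μ : Measure Ω} [IsProbabilityMeasure μ]
    {p : ℝ} (hp : 2 < p) {U V F : Ω → ℝ} (hU : MemLp U (ENNReal.ofReal p) μ)
    (hV : MemLp V (ENNReal.ofReal p) μ) (hF : AEStronglyMeasurable F μ) (A : ℝ)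
    (h : ∀ ω, |F ω| ≤ A * ((1 + |U ω|) ^ (p - 2) * (1 + |V ω|) ^ 2)) : Integrable F μ := by
  have h0 : MemLp (fun _ : Ω => (1 : ℝ)) (ENNReal.ofReal p) μ := memLp_const 1
  have h1 : MemLp (fun ω => 1 + |U ω| + |V ω|) (ENNReal.ofReal p) μ := (h0.add hU.norm).add hV.norm
  have h2 := h1.integrable_norm_rpow'
  rw [ENNReal.toReal_ofReal (by linarith)] at h2
  refine (h2.const_mul |A|).mono' hF (ae_of_all _ fun ω => ?_)
  have h3 : 0 ≤ |U ω| := abs_nonneg _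
  have h4 : 0 ≤ |V ω| := abs_nonneg _
  rw [Real.norm_eq_abs, Real.norm_eq_abs, abs_of_nonneg (by positivity : 0 ≤ 1 + |U ω| + |V ω|)]
  refine (h ω).trans (mul_le_mul (le_abs_self A) ?_ (by positivity) (abs_nonneg _))
  have h5 : (1 + |U ω| + |V ω|) ^ p = (1 + |U ω| + |V ω|) ^ (p - 2) * (1 + |U ω| + |V ω|) ^ 2 := by
    rw [← Real.rpow_natCast, ← Real.rpow_add (by positivity)]
    norm_num
  rw [h5]
  exact mul_le_mul (Real.rpow_le_rpow (by positivity) (by linarith) (by linarith))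
    (pow_le_pow_left₀ (by positivity) (by linarith) 2) (by positivity) (by positivity)

lemma integral_sq_gaussianReal (v : ℝ≥0) : ∫ y, y ^ 2 ∂gaussianReal 0 v = v := by
  have h := variance_id_gaussianReal (μ := 0) (v := v)
  rw [variance_of_integral_eq_zero (by fun_prop) (by simp)] at h
  simpa using h

namespace Stationary

set_option linter.unusedSectionVars false

variable {Ω : Type*} {F₀ mΩ : MeasurableSpace Ω}
  {μ : Measure Ω} [IsProbabilityMeasure μ] {T : Ω ≃ᵐ Ω} {X₀ : Ω → ℝ} {v : ℝ≥0} {p : ℝ}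
  (H : Stationary F₀ μ T X₀ v p)

include H

/-- Both E φ(S + X) and E φ(S + Y), with Y independent Gaussian of variance v, are expanded to
second order at S. The linear terms vanish, one by the martingale property and the other by
centring, and the quadratic ones differ by the displayed covariance. The bound `hwB` serves
integrability only. -/
lemma lindeberg_step {φ φ1 φ2 w : ℝ → ℝ} {B : ℝ} (hφ : TestTriple p φ φ1 φ2) (hwm : Measurable w)
    (hwmono : MonotoneOn w (Ici 0)) (hwB : ∀ d, 0 ≤ d → w d ≤ B * d ^ (p - 2))
    (hmod : ∀ x y, |φ2 x - φ2 y| ≤ w |x - y|) (q : ℕ) :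
    |∫ ω, φ (partialSum T X₀ (q + 1) ω) ∂μ - ∫ ω, gsm v φ (partialSum T X₀ q ω) ∂μ -
      1 / 2 * ∫ ω, φ2 (partialSum T X₀ q ω) * (seq T X₀ ((q : ℤ) + 1) ω ^ 2 - v) ∂μ| ≤
    ∫ ω, w |X₀ ω| * X₀ ω ^ 2 ∂μ + ∫ y, w |y| * y ^ 2 ∂gaussianReal 0 v := by
  have hp := H.hp
  set S := partialSum T X₀ q
  set X := seq T X₀ ((q : ℤ) + 1)
  have hS : MemLp S (ENNReal.ofReal p) μ := H.memLp_partialSum q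
  have hX : MemLp X (ENNReal.ofReal p) μ := H.memLp_seq _
  have hSm : Measurable S := H.measurable_partialSum' q
  have hXm : Measurable X := H.measurable_seq _
  have hw0 : ∀ d, 0 ≤ d → 0 ≤ w d := fun d hd => by
    have := (abs_nonneg _).trans (hmod d 0)
    rwa [sub_zero, abs_of_nonneg hd] at this
  have hφm := hφ.measurable_zero
  have hφ1m := hφ.measurable_one
  have hφ2m := hφ.measurable_two
  obtain ⟨A1, hA1, g1⟩ := hφ.grows_one
  obtain ⟨A2, hA2, g2⟩ := hφ.grows_two
  have pw : ∀ x : ℝ, (1 + |x|) ^ p = (1 + |x|) ^ (p - 2) * (1 + |x|) ^ 2 := fun x => by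
    rw [← Real.rpow_natCast, ← Real.rpow_add (by positivity)]
    norm_num
  have pw1 : ∀ x : ℝ, (1 + |x|) ^ (p - 1) = (1 + |x|) ^ (p - 2) * (1 + |x|) := fun x => by
    nth_rw 3 [← Real.rpow_one (1 + |x|)]
    rw [← Real.rpow_add (by positivity)]
    ring_nf
  have hge : ∀ x : ℝ, 1 ≤ 1 + |x| := fun x => by linarith [abs_nonneg x]
  have iφ : ∀ (Y : Ω → ℝ) (ψ : ℝ → ℝ), Grows p ψ → Measurable ψ → Measurable Y →
      MemLp Y (ENNReal.ofReal p) μ → Integrable (fun ω => ψ (Y ω)) μ := by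
    rintro Y ψ ⟨A, hA, hg⟩ hψ hYm hY
    refine integrable_of_growth hp.1 hY hY (by fun_prop : Measurable _).aestronglyMeasurable A
      fun ω => ?_
    rw [← pw]; exact hg _
  have iS : Integrable (fun ω => φ (S ω)) μ := iφ S φ hφ.grows_zero hφm hSm hS
  have iS1 : Integrable (fun ω => φ (partialSum T X₀ (q + 1) ω)) μ :=
    iφ _ φ hφ.grows_zero hφm (H.measurable_partialSum' _) (H.memLp_partialSum _)
  have ig : Integrable (fun ω => gsm v φ (S ω)) μ :=
    iφ _ _ (hφ.grows_zero.gsm (by linarith [hp.1]) v) (measurable_gsm hφm v) hSm hS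
  have i1 : Integrable (fun ω => φ1 (S ω) * X ω) μ := by
    have hM : MemLp (fun ω => |S ω| + |X ω|) (ENNReal.ofReal p) μ := hS.norm.add hX.norm
    refine integrable_of_growth hp.1 hM hM
      (by fun_prop : Measurable _).aestronglyMeasurable A1 fun ω => ?_
    have h3 := abs_nonneg (S ω)
    have h4 := abs_nonneg (X ω)
    rw [abs_mul, abs_of_nonneg (by positivity : 0 ≤ |S ω| + |X ω|), sq, ← mul_assoc, ← mul_assoc]
    refine mul_le_mul ?_ (by linarith) h4 (by positivity)
    refine (g1 _).trans ?_
    rw [pw1, mul_assoc]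
    refine mul_le_mul_of_nonneg_left (mul_le_mul (Real.rpow_le_rpow (by positivity)
      (by linarith) (by linarith [hp.1])) (by linarith) (by positivity) (by positivity)) hA1
  have i2 : Integrable (fun ω => φ2 (S ω) * X ω ^ 2) μ := by
    refine integrable_of_growth hp.1 hS hX (by fun_prop : Measurable _).aestronglyMeasurable A2
      fun ω => ?_
    rw [abs_mul, ← mul_assoc]
    refine mul_le_mul (g2 _) ?_ (abs_nonneg _) (by positivity)
    rw [abs_pow]
    gcongr
    linarith
  have i3 : Integrable (fun ω => φ2 (S ω)) μ := by
    refine integrable_of_growth hp.1 hS hX (by fun_prop : Measurable _).aestronglyMeasurable A2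
      fun ω => (g2 _).trans ?_
    gcongr
    exact le_mul_of_one_le_right (by positivity) (one_le_pow₀ (hge _))
  have iw : ∀ Y : Ω → ℝ, MemLp Y (ENNReal.ofReal p) μ →
      Integrable (fun ω => w |Y ω| * Y ω ^ 2) μ := by
    intro Y hY
    refine integrable_of_growth hp.1 hY hY
      (((hwm.comp_aemeasurable hY.1.aemeasurable.abs)).mul
        (hY.1.aemeasurable.pow_const 2)).aestronglyMeasurable |B| fun ω => ?_
    rw [abs_mul, abs_of_nonneg (hw0 _ (abs_nonneg _)), ← mul_assoc, abs_pow]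
    refine mul_le_mul ((hwB _ (abs_nonneg _)).trans ?_) ?_ (by positivity) (by positivity)
    · refine mul_le_mul (le_abs_self _) ?_ (by positivity) (abs_nonneg _)
      exact Real.rpow_le_rpow (abs_nonneg _) (by linarith) (by linarith [hp.1])
    · gcongr
      linarith
  have hT : ∫ ω, w |X ω| * X ω ^ 2 ∂μ = ∫ ω, w |X₀ ω| * X₀ ω ^ 2 ∂μ := by
    have hi := iw X₀ H.memLp
    have hpr := H.iter_pres ((q : ℤ) + 1)
    conv_rhs => rw [← hpr.map_eq]
    rw [integral_map hpr.measurable.aemeasurable (by rw [hpr.map_eq]; exact hi.1)]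
    rfl
  have step1 : |∫ ω, φ (partialSum T X₀ (q + 1) ω) ∂μ -
      (∫ ω, φ (S ω) ∂μ + 1 / 2 * ∫ ω, φ2 (S ω) * X ω ^ 2 ∂μ)| ≤
      ∫ ω, w |X₀ ω| * X₀ ω ^ 2 ∂μ := by
    have h0 : ∫ ω, φ1 (S ω) * X ω ∂μ = 0 :=
      H.integral_mul_seq q (hφ1m.comp (H.measurable_partialSum q)) i1
    have iS01 : Integrable (fun ω => φ (S ω) + φ1 (S ω) * X ω) μ := iS.add i1
    have iS012 : Integrable (fun ω => φ (S ω) + φ1 (S ω) * X ω + 1 / 2 * (φ2 (S ω) * X ω ^ 2)) μ :=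
      iS01.add (i2.const_mul _)
    have e : ∫ ω, φ (S ω) ∂μ + 1 / 2 * ∫ ω, φ2 (S ω) * X ω ^ 2 ∂μ =
        ∫ ω, (φ (S ω) + φ1 (S ω) * X ω + 1 / 2 * (φ2 (S ω) * X ω ^ 2)) ∂μ := by
      rw [integral_add iS01 (i2.const_mul _), integral_add iS i1, h0, add_zero,
        integral_const_mul]
    rw [e, ← integral_sub iS1 iS012, ← hT]
    refine (abs_integral_le_integral_abs).trans (integral_mono
      ((iS1.sub iS012).abs) (iw X hX) fun ω => ?_)
    have := taylor_two hφ.deriv_one hφ.deriv_two hwmono hmod (S ω) (X ω)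
    simpa only [partialSum_succ] using this
  have step2 : ∀ x, |gsm v φ x - (φ x + 1 / 2 * (φ2 x * v))| ≤
      ∫ y, w |y| * y ^ 2 ∂gaussianReal 0 v := by
    intro x
    have j1 : Integrable (fun y : ℝ => y) (gaussianReal 0 v) :=
      (memLp_id_gaussianReal' (μ := 0) (v := v) 1 (by simp)).integrable le_rfl
    have j2 : Integrable (fun y : ℝ => y ^ 2) (gaussianReal 0 v) :=
      (memLp_id_gaussianReal' (μ := 0) (v := v) 2 (by simp)).integrable_sq
    have jw : Integrable (fun y : ℝ => w |y| * y ^ 2) (gaussianReal 0 v) := by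
      have hid := memLp_id_gaussianReal' (μ := 0) (v := v) (ENNReal.ofReal p)
        ENNReal.ofReal_ne_top
      refine integrable_of_growth hp.1 hid hid
        (by fun_prop : Measurable _).aestronglyMeasurable |B| fun ω => ?_
      rw [abs_mul, abs_of_nonneg (hw0 _ (abs_nonneg _)), ← mul_assoc, abs_pow]
      refine mul_le_mul ((hwB _ (abs_nonneg _)).trans ?_) ?_ (by positivity) (by positivity)
      · refine mul_le_mul (le_abs_self _) ?_ (by positivity) (abs_nonneg _)
        exact Real.rpow_le_rpow (abs_nonneg _) (by simp) (by linarith [hp.1])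
      · gcongr
        simp
    have jφ := hφ.grows_zero.integrable (by linarith [hp.1]) hφm v x
    have jb : Integrable (fun y : ℝ => φ x + φ1 x * y) (gaussianReal 0 v) :=
      (integrable_const _).add (j1.const_mul _)
    have jc : Integrable (fun y : ℝ => φ x + φ1 x * y + 1 / 2 * (φ2 x * y ^ 2)) (gaussianReal 0 v) :=
      jb.add ((j2.const_mul _).const_mul _)
    have e : φ x + 1 / 2 * (φ2 x * v) =
        ∫ y, (φ x + φ1 x * y + 1 / 2 * (φ2 x * y ^ 2)) ∂gaussianReal 0 v := by
      rw [integral_add jb ((j2.const_mul _).const_mul _),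
        integral_add (integrable_const _) (j1.const_mul _), integral_const_mul, integral_const_mul,
        integral_const_mul, integral_sq_gaussianReal]
      simp
    rw [e, gsm, ← integral_sub jφ jc]
    exact (abs_integral_le_integral_abs).trans (integral_mono (jφ.sub jc).abs jw fun y =>
      taylor_two hφ.deriv_one hφ.deriv_two hwmono hmod x y)
  have step3 : |∫ ω, gsm v φ (S ω) ∂μ - (∫ ω, φ (S ω) ∂μ + 1 / 2 * ∫ ω, φ2 (S ω) * v ∂μ)| ≤
      ∫ y, w |y| * y ^ 2 ∂gaussianReal 0 v := by
    have ii : Integrable (fun ω => φ (S ω) + 1 / 2 * (φ2 (S ω) * v)) μ :=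
      iS.add ((i3.mul_const _).const_mul _)
    rw [← integral_const_mul, ← integral_add iS ((i3.mul_const _).const_mul _),
      ← integral_sub ig ii]
    refine (abs_integral_le_integral_abs).trans ((integral_mono (ig.sub ii).abs
      (integrable_const _) fun ω => step2 (S ω)).trans ?_)
    simp
  have e3 : ∫ ω, φ2 (S ω) * (X ω ^ 2 - v) ∂μ =
      ∫ ω, φ2 (S ω) * X ω ^ 2 ∂μ - ∫ ω, φ2 (S ω) * v ∂μ := by
    rw [← integral_sub i2 (i3.mul_const _)]
    simp_rw [mul_sub]
  rw [e3]
  rw [abs_le] at *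
  constructor <;> linarith [step1.1, step1.2, step3.1, step3.2]

end Stationary

/-! ### Dyadic decompositions -/

/-- Summation by parts along the dyadic scales. -/
lemma sum_mul_eq_dyadic (a y : ℕ → ℝ) (N : ℕ) :
    ∑ s ∈ Finset.range (2 ^ N), a (s + 1) * y s =
      a (2 ^ N) * ∑ i ∈ Finset.range (2 ^ N), y i +
      ∑ j ∈ Finset.range N, ∑ m ∈ Finset.range (2 ^ (N - j - 1)),
        (a ((2 * m + 1) * 2 ^ j) - a ((2 * m + 2) * 2 ^ j)) *
          ∑ i ∈ Finset.range (2 ^ j), y (2 * m * 2 ^ j + i) := by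
  let Z : ℕ → ℕ → ℝ := fun j m => ∑ i ∈ Finset.range (2 ^ j), y (m * 2 ^ j + i)
  let L : ℕ → ℕ → ℝ := fun j M => ∑ m ∈ Finset.range M, a ((m + 1) * 2 ^ j) * Z j m
  have hZ : ∀ j m, Z (j + 1) m = Z j (2 * m) + Z j (2 * m + 1) := by
    intro j m
    simp only [Z, pow_succ, mul_two, Finset.sum_range_add]
    congr 1 <;> refine Finset.sum_congr rfl fun i _ => ?_ <;> congr 1 <;> ring
  -- Merging two neighbouring blocks replaces the weight of the left one by that of the right one;
  -- the correction is the increment of a times the left block sum.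
  have hL : ∀ j M, L j (2 * M) = L (j + 1) M + ∑ m ∈ Finset.range M,
      (a ((2 * m + 1) * 2 ^ j) - a ((2 * m + 2) * 2 ^ j)) * Z j (2 * m) := by
    intro j M
    induction M with
    | zero => simp [L]
    | succ M ih =>
      have e1 : L j (2 * (M + 1)) = L j (2 * M) + a ((2 * M + 1) * 2 ^ j) * Z j (2 * M) +
          a ((2 * M + 2) * 2 ^ j) * Z j (2 * M + 1) := by
        simp only [L, mul_add, mul_one, Finset.sum_range_succ]
      have e2 : L (j + 1) (M + 1) = L (j + 1) M +
          a ((2 * M + 2) * 2 ^ j) * (Z j (2 * M) + Z j (2 * M + 1)) := by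
        simp only [L, Finset.sum_range_succ, hZ]
        congr 3; ring
      rw [e1, ih, e2, Finset.sum_range_succ]
      ring
  have key : ∀ k ≤ N, L 0 (2 ^ N) = L k (2 ^ (N - k)) +
      ∑ j ∈ Finset.range k, ∑ m ∈ Finset.range (2 ^ (N - j - 1)),
        (a ((2 * m + 1) * 2 ^ j) - a ((2 * m + 2) * 2 ^ j)) * Z j (2 * m) := by
    intro k hk
    induction k with
    | zero => simp
    | succ k ih =>
      rw [ih (by omega), Finset.sum_range_succ]
      have : 2 ^ (N - k) = 2 * 2 ^ (N - (k + 1)) := by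
        rw [← pow_succ']; congr 1; omega
      rw [this, hL, Nat.sub_sub]
      ring
  have h0 : L 0 (2 ^ N) = ∑ s ∈ Finset.range (2 ^ N), a (s + 1) * y s := by
    simp [L, Z]
  rw [← h0, key N le_rfl]
  simp [L, Z]

/-- A geometric series of ratio at most 1/2 started at the first power of two not below m. The
induction carries twice the last scale as a reserve that pays for the next term. -/
lemma dyadic_tail_le {β : ℝ} (hβ : 1 ≤ β) {m : ℕ} (N : ℕ) :
    ∑ j ∈ Finset.range N, (if m ≤ 2 ^ j then ((2 : ℝ≥0∞) ^ j) ^ (-β) else 0) ≤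
      2 * (m : ℝ≥0∞) ^ (-β) := by
  have hhalf : ∀ N : ℕ, 2 * ((2 : ℝ≥0∞) ^ (N + 1)) ^ (-β) ≤ ((2 : ℝ≥0∞) ^ N) ^ (-β) := by
    intro N
    rw [pow_succ', ENNReal.mul_rpow_of_ne_top (by simp) (by simp), ← mul_assoc]
    refine mul_le_of_le_one_left' ?_
    calc (2 : ℝ≥0∞) * 2 ^ (-β) ≤ 2 * 2 ^ (-1 : ℝ) := by
          gcongr
          norm_num
      _ = 1 := by rw [ENNReal.rpow_neg_one, ENNReal.mul_inv_cancel (by simp) (by simp)]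
  have key : ∀ N : ℕ, m ≤ 2 ^ N →
      ∑ j ∈ Finset.range N, (if m ≤ 2 ^ j then ((2 : ℝ≥0∞) ^ j) ^ (-β) else 0) +
        2 * ((2 : ℝ≥0∞) ^ N) ^ (-β) ≤ 2 * (m : ℝ≥0∞) ^ (-β) := by
    intro N
    have base : ∀ N : ℕ, m ≤ 2 ^ N → (∀ j < N, ¬ m ≤ 2 ^ j) →
        ∑ j ∈ Finset.range N, (if m ≤ 2 ^ j then ((2 : ℝ≥0∞) ^ j) ^ (-β) else 0) +
        2 * ((2 : ℝ≥0∞) ^ N) ^ (-β) ≤ 2 * (m : ℝ≥0∞) ^ (-β) := by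
      intro N hN hlt
      rw [Finset.sum_eq_zero fun j hj => if_neg (hlt j (Finset.mem_range.1 hj)), zero_add]
      gcongr 2 * ?_
      rw [ENNReal.rpow_neg, ENNReal.rpow_neg, ENNReal.inv_le_inv]
      refine ENNReal.rpow_le_rpow ?_ (by linarith)
      exact_mod_cast hN
    induction N with
    | zero => exact fun h => base 0 h (by simp)
    | succ N ih =>
      intro h
      by_cases hm : m ≤ 2 ^ N
      · refine le_trans ?_ (ih hm)
        rw [Finset.sum_range_succ, if_pos hm, add_assoc, two_mul (((2 : ℝ≥0∞) ^ N) ^ (-β))]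
        gcongr
        exact hhalf N
      · refine base (N + 1) h fun j hj hle => hm (hle.trans ?_)
        exact Nat.pow_le_pow_right (by norm_num) (by omega)
  have hm : m ≤ 2 ^ (max N m) :=
    (Nat.lt_two_pow_self).le.trans (Nat.pow_le_pow_right (by norm_num) (le_max_right _ _))
  refine le_trans ?_ ((le_add_right le_rfl).trans (key (max N m) hm))
  exact Finset.sum_le_sum_of_subset (Finset.range_subset_range.2 (le_max_left _ _))

/-- Exchanging the sums, the index k is charged only by the scales 2^j ≥ k, which contribute k^(-β).
-/
lemma dyadic_series_le {β : ℝ} (hβ : 1 ≤ β) (e : ℕ → ℝ≥0∞) (N : ℕ) :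
    ∑ j ∈ Finset.range N, ((2 : ℝ≥0∞) ^ j) ^ (-β) * ∑ k ∈ Finset.Icc 1 (2 ^ j : ℕ), (k : ℝ≥0∞) * e k ≤
      2 * ∑' k : ℕ, ((k + 1 : ℕ) : ℝ≥0∞) ^ (1 - β) * e (k + 1) := by
  have h1 : ∀ j : ℕ, ((2 : ℝ≥0∞) ^ j) ^ (-β) * ∑ k ∈ Finset.Icc 1 (2 ^ j : ℕ), (k : ℝ≥0∞) * e k =
      ∑' k : ℕ, (if k + 1 ≤ 2 ^ j then ((2 : ℝ≥0∞) ^ j) ^ (-β) else 0) *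
        (((k + 1 : ℕ) : ℝ≥0∞) * e (k + 1)) := by
    intro j
    rw [tsum_eq_sum (s := Finset.range (2 ^ j)), Finset.mul_sum,
      ← Finset.Ico_add_one_right_eq_Icc, Finset.sum_Ico_eq_sum_range]
    · refine Finset.sum_congr (by simp) fun k hk => ?_
      rw [if_pos (by have := Finset.mem_range.1 hk; omega), add_comm 1 k]
    · intro k hk
      rw [if_neg (by rw [Finset.mem_range] at hk; omega), zero_mul]
  simp_rw [h1]
  rw [← Summable.tsum_finsetSum fun _ _ => ENNReal.summable, ← ENNReal.tsum_mul_left]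
  refine ENNReal.tsum_le_tsum fun k => ?_
  rw [← Finset.sum_mul]
  refine (mul_le_mul_left (dyadic_tail_le hβ N) _).trans (le_of_eq ?_)
  have h2 : ((k + 1 : ℕ) : ℝ≥0∞) ^ (1 - β) = ((k + 1 : ℕ) : ℝ≥0∞) ^ (-β) * ((k + 1 : ℕ) : ℝ≥0∞) := by
    nth_rw 3 [← ENNReal.rpow_one ((k + 1 : ℕ) : ℝ≥0∞)]
    rw [← ENNReal.rpow_add _ _ (by simp) (by simp)]
    congr 1; ring
  rw [h2]
  ring

lemma integral_abs_rpow_gaussianReal (t : ℝ≥0) (a : ℝ) :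
    ∫ y, |y| ^ a ∂gaussianReal 0 t = (t : ℝ) ^ (a / 2) * ∫ y, |y| ^ a ∂gaussianReal 0 1 := by
  rw [gaussianReal_eq_map_sqrt t, integral_map (by fun_prop)
    (Measurable.aestronglyMeasurable (by fun_prop)), ← integral_const_mul]
  refine integral_congr_ae (ae_of_all _ fun y => ?_)
  simp only
  rw [abs_mul, abs_of_nonneg (Real.sqrt_nonneg _), Real.mul_rpow (Real.sqrt_nonneg _)
    (abs_nonneg _), Real.sqrt_eq_rpow, ← Real.rpow_mul t.coe_nonneg]
  congr 2; ring

/-! ### Invariance properties of the norms -/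

section Norms

variable {Ω : Type*} [MeasurableSpace Ω] {μ : Measure Ω}

lemma envelopeNorm_congr_law {D D' : Ω → ℝ} (p : ℝ)
    (h : ∀ t, μ {ω | t < |D ω|} = μ {ω | t < |D' ω|}) : envelopeNorm p μ D = envelopeNorm p μ D' := by
  simp only [envelopeNorm, absQuantile, h]

lemma envelopeNorm_congr_ae {D D' : Ω → ℝ} (p : ℝ) (h : D =ᵐ[μ] D') :
    envelopeNorm p μ D = envelopeNorm p μ D' :=
  envelopeNorm_congr_law p fun t => measure_congr <| by
    filter_upwards [h] with ω hω
    exact congrArg (fun x => t < |x|) hω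

lemma envelopeNorm_comp {D : Ω → ℝ} (hD : Measurable D) {τ : Ω → Ω} (hτ : MeasurePreserving τ μ μ)
    (p : ℝ) : envelopeNorm p μ (D ∘ τ) = envelopeNorm p μ D :=
  envelopeNorm_congr_law p fun t => hτ.measure_preimage
    (measurableSet_lt measurable_const (by fun_prop : Measurable fun ω => |D ω|)).nullMeasurableSet

lemma absQuantile_const_mul (D : Ω → ℝ) {c : ℝ} (hc : 0 < c) (u : ℝ) :
    absQuantile μ (fun ω => c * D ω) u = c * absQuantile μ D u := by
  unfold absQuantile
  rw [← smul_eq_mul, ← Real.sInf_smul_of_nonneg hc.le]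
  congr 1
  ext t
  rw [Set.mem_smul_set_iff_inv_smul_mem₀ hc.ne']
  have h1 : ∀ ω, t < |c * D ω| ↔ c⁻¹ • t < |D ω| := fun ω => by
    rw [abs_mul, abs_of_pos hc, smul_eq_mul, inv_mul_lt_iff₀ hc]
  have h2 : 0 ≤ t ↔ 0 ≤ c⁻¹ • t := by
    rw [smul_eq_mul, mul_nonneg_iff_of_pos_left (by positivity)]
  simp only [mem_ofPred_eq, h1, h2]

lemma envelopeNorm_const_mul (D : Ω → ℝ) {c : ℝ} (hc : 0 < c) (p : ℝ) :
    envelopeNorm p μ (fun ω => c * D ω) = ENNReal.ofReal c * envelopeNorm p μ D := by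
  unfold envelopeNorm
  rw [← lintegral_const_mul' _ _ ENNReal.ofReal_ne_top]
  refine lintegral_congr fun u => ?_
  rw [absQuantile_const_mul D hc, ← ENNReal.ofReal_mul hc.le]
  congr 1; ring

end Norms

/-! ### Second order terms -/

namespace Stationary

set_option linter.unusedSectionVars false

variable {Ω : Type*} {F₀ mΩ : MeasurableSpace Ω}
  {μ : Measure Ω} [IsProbabilityMeasure μ] {T : Ω ≃ᵐ Ω} {X₀ : Ω → ℝ} {v : ℝ≥0} {p : ℝ}
  (H : Stationary F₀ μ T X₀ v p)

include H

lemma memLp_pastSum (l : ℕ) : MemLp (pastSum T X₀ l) (ENNReal.ofReal p) μ := by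
  have : pastSum T X₀ l = ∑ i ∈ Finset.range l, seq T X₀ (-(i : ℤ)) := by
    ext ω; rw [pastSum, Finset.sum_apply]
  rw [this]
  exact memLp_finsetSum' _ fun i _ => H.memLp_seq _

lemma integrable_mul_sq {D R : Ω → ℝ} (hD : Measurable D) (hR : MemLp R (ENNReal.ofReal p) μ)
    {A : ℝ} (hA : 0 ≤ A) (h : ∀ ω, |D ω| ≤ A * (1 + |R ω|) ^ (p - 2)) (i : ℤ) :
    Integrable (fun ω => D ω * (seq T X₀ i ω ^ 2 - v)) μ := by
  have hm := H.measurable_seq i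
  refine integrable_of_growth H.hp.1 hR (H.memLp_seq i)
    (by fun_prop : Measurable _).aestronglyMeasurable (A * (1 + v)) fun ω => ?_
  rw [abs_mul]
  calc |D ω| * |seq T X₀ i ω ^ 2 - v|
      ≤ (A * (1 + |R ω|) ^ (p - 2)) * ((1 + v) * (1 + |seq T X₀ i ω|) ^ 2) := by
        refine mul_le_mul (h ω) ?_ (abs_nonneg _) (by positivity)
        refine (abs_sub _ _).trans ?_
        rw [abs_pow, NNReal.abs_eq]
        have h1 := abs_nonneg (seq T X₀ i ω)
        have h2 := v.coe_nonneg
        nlinarith [mul_nonneg h2 h1, mul_nonneg h2 (sq_nonneg |seq T X₀ i ω|)]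
    _ = _ := by ring

lemma integrable_mul_sqSum {D R : Ω → ℝ} (hD : Measurable D) (hR : MemLp R (ENNReal.ofReal p) μ)
    {A : ℝ} (hA : 0 ≤ A) (h : ∀ ω, |D ω| ≤ A * (1 + |R ω|) ^ (p - 2)) (L : ℕ) :
    Integrable (fun ω => D ω * sqSum T X₀ v L ω) μ := by
  simp only [sqSum, Finset.mul_sum]
  exact integrable_finsetSum _ fun i _ => H.integrable_mul_sq hD hR hA h _

lemma measurable_comp_iter_neg {f : Ω → ℝ} {q : ℕ} (hf : Measurable[sigmaAlg F₀ T q] f) :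
    Measurable[F₀] (f ∘ iter T (-(q : ℤ))) := by
  have h1 : F₀ = (sigmaAlg F₀ T q).comap (iter T (-(q : ℤ))) := by
    rw [← sigmaAlg_add, add_neg_cancel, sigmaAlg_zero]
  have h2 := hf.comp (comap_measurable (m := sigmaAlg F₀ T q) (iter T (-(q : ℤ))))
  rwa [← h1] at h2

/-- The covariance of a second derivative increment with the following block of squares. -/
lemma enorm_block_le {φ w : ℝ → ℝ} {B : ℝ} (hφm : Measurable φ) (hφ : Grows (p - 2) φ)
    (hwm : Measurable w) (hwB : ∀ d, 0 ≤ d → w d ≤ B * d ^ (p - 2))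
    (hmod : ∀ x y, |φ x - φ y| ≤ w |x - y|) {q l : ℕ} (hl : l ≤ q) (L : ℕ) :
    ‖∫ ω, (φ (partialSum T X₀ q ω) - gsm (l * v) φ (partialSum T X₀ (q - l) ω)) *
      sqSum T X₀ v L (iter T q ω) ∂μ‖ₑ ≤
    ∫⁻ ω, ENNReal.ofReal (w |pastSum T X₀ l ω| + ∫ y, w |y| ∂gaussianReal 0 (l * v)) *
      ‖(μ[sqSum T X₀ v L | F₀]) ω‖ₑ ∂μ := by
  have hp := H.hp
  have hw0 : ∀ d, 0 ≤ d → 0 ≤ w d := fun d hd => by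
    have := (abs_nonneg _).trans (hmod d 0)
    rwa [sub_zero, abs_of_nonneg hd] at this
  set κ := ∫ y, w |y| ∂gaussianReal 0 (l * v) with hκ
  have hκ0 : 0 ≤ κ := integral_nonneg fun y => hw0 _ (abs_nonneg _)
  have iw : Integrable (fun y : ℝ => w |y|) (gaussianReal 0 (l * v)) := by
    refine ((integrable_abs_rpow_gaussian (l * v) (by linarith [hp.1] : 0 ≤ p - 2)).const_mul B).mono'
      (by fun_prop : Measurable _).aestronglyMeasurable (ae_of_all _ fun y => ?_)
    rw [Real.norm_eq_abs, abs_of_nonneg (hw0 _ (abs_nonneg _))]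
    exact hwB _ (abs_nonneg _)
  set E : Ω → ℝ := fun ω => φ (partialSum T X₀ q ω) - gsm (l * v) φ (partialSum T X₀ (q - l) ω)
  -- The smoothing is an average over an independent Gaussian substitute for the last l variables;
  -- the passage from S_q to the average goes through the common point S_{q-l}.
  have hE : ∀ ω, |E ω| ≤ w |pastSum T X₀ l (iter T q ω)| + κ := by
    intro ω
    rw [pastSum_iter T X₀ hl]
    set a := partialSum T X₀ q ω
    set b := partialSum T X₀ (q - l) ω
    have hi := hφ.integrable (by linarith [hp.1]) hφm (l * v) b
    have e : φ a - gsm (l * v) φ b = ∫ y, (φ a - φ (b + y)) ∂gaussianReal 0 (l * v) := by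
      rw [integral_sub (integrable_const _) hi]
      simp [gsm]
    change |φ a - gsm (l * v) φ b| ≤ _
    rw [e]
    have hs : w |a - b| + κ = ∫ y, (w |a - b| + w |y|) ∂gaussianReal 0 (l * v) := by
      rw [integral_add (integrable_const _) iw]
      simp [hκ]
    rw [hs]
    refine (abs_integral_le_integral_abs).trans (integral_mono
      ((integrable_const _).sub hi).abs ((integrable_const _).add iw) fun y => ?_)
    calc |φ a - φ (b + y)| ≤ |φ a - φ b| + |φ b - φ (b + y)| := abs_sub_le _ _ _
      _ ≤ w |a - b| + w |y| := by
        refine add_le_add (hmod _ _) ((hmod _ _).trans (le_of_eq ?_))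
        rw [sub_add_cancel_left, abs_neg]
  have hEm : Measurable[sigmaAlg F₀ T q] E := by
    refine (hφm.comp (H.measurable_partialSum q)).sub ((measurable_gsm hφm _).comp
      ((H.measurable_partialSum (q - l)).mono (sigmaAlg_mono H.inv ?_) le_rfl))
    exact_mod_cast Nat.sub_le q l
  -- Shifting back by q makes the increment F₀-measurable and lets the next block start at time 1,
  -- so it may be replaced by its conditional expectation given F₀.
  set D : Ω → ℝ := E ∘ iter T (-(q : ℤ))
  have hDm : Measurable[F₀] D := H.measurable_comp_iter_neg hEm
  have hD : ∀ ω, |D ω| ≤ w |pastSum T X₀ l ω| + κ := by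
    intro ω
    have := hE (iter T (-(q : ℤ)) ω)
    rwa [iter_iter, add_neg_cancel, iter_zero, id] at this
  have hDE : ∀ ω, D (iter T q ω) = E ω := by
    intro ω
    simp [D, iter_iter, iter_zero]
  have hint : Integrable (fun ω => D ω * sqSum T X₀ v L ω) μ := by
    refine H.integrable_mul_sqSum (hDm.mono H.le le_rfl) (H.memLp_pastSum l) (A := |B| + κ)
      (by positivity) (fun ω => (hD ω).trans ?_) L
    have h1 : (1 : ℝ) ≤ (1 + |pastSum T X₀ l ω|) ^ (p - 2) :=
      Real.one_le_rpow (by linarith [abs_nonneg (pastSum T X₀ l ω)]) (by linarith [hp.1])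
    have h2 : |pastSum T X₀ l ω| ^ (p - 2) ≤ (1 + |pastSum T X₀ l ω|) ^ (p - 2) :=
      Real.rpow_le_rpow (abs_nonneg _) (by linarith) (by linarith [hp.1])
    rw [add_mul]
    refine add_le_add ((hwB _ (abs_nonneg _)).trans ?_) (le_mul_of_one_le_right hκ0 h1)
    exact mul_le_mul (le_abs_self _) h2 (by positivity) (abs_nonneg _)
  have e1 : ∫ ω, E ω * sqSum T X₀ v L (iter T q ω) ∂μ = ∫ ω, D ω * sqSum T X₀ v L ω ∂μ := by
    have hpr := H.iter_pres q
    conv_rhs => rw [← hpr.map_eq]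
    rw [integral_map hpr.measurable.aemeasurable (by rw [hpr.map_eq]; exact hint.1)]
    simp_rw [hDE]
  rw [e1, integral_mul_condExp H.le (H.integrable_sqSum L) hDm.stronglyMeasurable hint]
  refine (enorm_integral_le_lintegral_enorm _).trans (lintegral_mono fun ω => ?_)
  rw [enorm_mul, Real.enorm_eq_ofReal_abs]
  gcongr
  exact hD ω

/-- The weighted size of the conditional variance over a dyadic block. -/
lemma lintegral_weight_le (hv : v ≠ 0) {σ : ℝ} (hσ : σ ^ 2 = v) {j l : ℕ} (hl : l ∈ Icc 1 (2 ^ j))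
    {K : ℝ≥0∞} (hK : monoCost p (μ.map (partialSum T X₀ l)) (gaussianReal 0 (l * v)) ≤ K * 2 ^ j) :
    2 ^ j * ∫⁻ ω, ENNReal.ofReal (|pastSum T X₀ l ω| ^ (p - 2) +
        ∫ y, |y| ^ (p - 2) ∂gaussianReal 0 (l * v)) * ‖(μ[sqSum T X₀ v (2 ^ j) | F₀]) ω‖ₑ ∂μ ≤
      4 * ∑ k ∈ Finset.Icc 1 (2 ^ j : ℕ), (k : ℝ≥0∞) *
        (ENNReal.ofReal ((v : ℝ) ^ ((p - 2) / 2) * (1 + ∫ y, |y| ^ (p - 2) ∂gaussianReal 0 1)) *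
          (2 ^ j) ^ ((p - 2) / 2) * envelopeNorm p μ (condVarDev F₀ μ T X₀ σ k) +
        (K * 2 ^ j) ^ ((p - 2) / p) *
          eLpNorm (condVarDev F₀ μ T X₀ σ k) (ENNReal.ofReal (p / 2)) μ) := by
  have hp := H.hp
  have hα : 0 < p - 2 := by linarith [hp.1]
  have hp0 : 0 < p := by linarith [hp.1]
  have hmR := H.measurable_pastSum l
  have hlv : (l * v : ℝ≥0) ≠ 0 := mul_ne_zero (by have := hl.1; positivity) hv
  set m := ∫ y, |y| ^ (p - 2) ∂gaussianReal 0 1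
  have hm0 : 0 ≤ m := integral_nonneg fun y => by positivity
  have h := H.mul_lintegral_condExp_sqSum_le (w := fun ω => ENNReal.ofReal
      (|pastSum T X₀ l ω| ^ (p - 2) + ∫ y, |y| ^ (p - 2) ∂gaussianReal 0 (l * v)))
    (ENNReal.measurable_ofReal.comp (((measurable_id.pow_const (p - 2)).comp
      (continuous_abs.measurable.comp hmR)).add_const _))
    (b := fun k => (k : ℝ≥0∞) *
        (ENNReal.ofReal ((v : ℝ) ^ ((p - 2) / 2) * (1 + m)) *
          (2 ^ j) ^ ((p - 2) / 2) * envelopeNorm p μ (condVarDev F₀ μ T X₀ σ k) +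
        (K * 2 ^ j) ^ ((p - 2) / p) *
          eLpNorm (condVarDev F₀ μ T X₀ σ k) (ENNReal.ofReal (p / 2)) μ)) ?_
    (l := 2 ^ j) Nat.one_le_two_pow
  · exact_mod_cast h
  intro k i hk
  have hk0 : (0 : ℝ) < k := by exact_mod_cast hk
  set c : Ω → ℝ := μ[sqSum T X₀ v k | F₀]
  have hcm : Measurable c := (stronglyMeasurable_condExp.mono H.le).measurable
  -- The shift changes the joint law with the weight but not the law of c. The comparison with the
  -- Gaussian weight uses only the two norms of h, so its bound is uniform in i, as the averaging
  -- requires.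
  set h : Ω → ℝ := c ∘ iter T i
  have hhm : Measurable h := hcm.comp (H.iter_pres i).measurable
  have hae : c =ᵐ[μ] fun ω => (k : ℝ) * condVarDev F₀ μ T X₀ σ k ω := H.condVarDev_eq hσ hk
  have henv : envelopeNorm p μ h = k * envelopeNorm p μ (condVarDev F₀ μ T X₀ σ k) := by
    rw [envelopeNorm_comp hcm (H.iter_pres i), envelopeNorm_congr_ae p hae,
      envelopeNorm_const_mul _ hk0, ENNReal.ofReal_natCast]
  have hLp : eLpNorm h (ENNReal.ofReal (p / 2)) μ =
      k * eLpNorm (condVarDev F₀ μ T X₀ σ k) (ENNReal.ofReal (p / 2)) μ := by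
    rw [eLpNorm_comp_measurePreserving hcm.aestronglyMeasurable (H.iter_pres i),
      eLpNorm_congr_ae hae]
    have := eLpNorm_const_smul (k : ℝ) (condVarDev F₀ μ T X₀ σ k) (ENNReal.ofReal (p / 2)) μ
    rw [Real.enorm_natCast] at this
    exact this
  have hwt := lintegral_rpow_mul_le μ (H.measurable_pastSum' l) hhm hp hlv
    (P := monoCoupling (μ.map (partialSum T X₀ l)) (gaussianReal 0 (l * v))) (by
      rw [H.map_pastSum]
      have : IsProbabilityMeasure (μ.map (partialSum T X₀ l)) :=
        Measure.isProbabilityMeasure_map (H.measurable_partialSum' l).aemeasurable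
      exact monoCoupling_mem _ _)
  have : IsProbabilityMeasure (μ.map (partialSum T X₀ l)) :=
        Measure.isProbabilityMeasure_map (H.measurable_partialSum' l).aemeasurable
  rw [lintegral_monoCoupling] at hwt
  have hmean := lintegral_enorm_le_envelopeNorm μ hhm hp.1.le
  have hmR' := H.measurable_pastSum' l
  have hlv' : ((l * v : ℝ≥0) : ℝ) ^ ((p - 2) / 2) ≤ (v : ℝ) ^ ((p - 2) / 2) * (2 ^ j) ^ ((p - 2) / 2) := by
    rw [← Real.mul_rpow (by positivity) (by positivity)]
    refine Real.rpow_le_rpow (by positivity) ?_ (by positivity)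
    push_cast
    rw [mul_comm]
    gcongr
    exact_mod_cast hl.2
  have hof : ENNReal.ofReal ((2 ^ j : ℝ) ^ ((p - 2) / 2)) = ((2 : ℝ≥0∞) ^ j) ^ ((p - 2) / 2) := by
    rw [← ENNReal.ofReal_rpow_of_nonneg (by positivity) (by positivity),
      ENNReal.ofReal_pow (by positivity), ENNReal.ofReal_ofNat]
  have hnn : 0 ≤ ∫ y, |y| ^ (p - 2) ∂gaussianReal 0 (l * v) := integral_nonneg fun y => by positivity
  calc ∫⁻ ω, ENNReal.ofReal (|pastSum T X₀ l ω| ^ (p - 2) +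
          ∫ y, |y| ^ (p - 2) ∂gaussianReal 0 (l * v)) * ‖h ω‖ₑ ∂μ
      = ∫⁻ ω, ENNReal.ofReal (|pastSum T X₀ l ω| ^ (p - 2)) * ‖h ω‖ₑ ∂μ +
        ENNReal.ofReal (∫ y, |y| ^ (p - 2) ∂gaussianReal 0 (l * v)) * ∫⁻ ω, ‖h ω‖ₑ ∂μ := by
        rw [← lintegral_const_mul _ hhm.enorm, ← lintegral_add_left (by fun_prop)]
        refine lintegral_congr fun ω => ?_
        rw [ENNReal.ofReal_add (by positivity) hnn, add_mul]
    _ ≤ (ENNReal.ofReal (((l * v : ℝ≥0) : ℝ) ^ ((p - 2) / 2)) * envelopeNorm p μ h +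
        (K * 2 ^ j) ^ ((p - 2) / p) * eLpNorm h (ENNReal.ofReal (p / 2)) μ) +
        ENNReal.ofReal (((l * v : ℝ≥0) : ℝ) ^ ((p - 2) / 2) * m) * envelopeNorm p μ h := by
        rw [← integral_abs_rpow_gaussianReal (l * v) (p - 2)]
        refine add_le_add (hwt.trans ?_) (by gcongr)
        gcongr
    _ = ENNReal.ofReal (((l * v : ℝ≥0) : ℝ) ^ ((p - 2) / 2) * (1 + m)) * envelopeNorm p μ h +
        (K * 2 ^ j) ^ ((p - 2) / p) * eLpNorm h (ENNReal.ofReal (p / 2)) μ := by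
        rw [mul_add, mul_one, ENNReal.ofReal_add (by positivity) (by positivity)]
        ring
    _ ≤ ENNReal.ofReal ((v : ℝ) ^ ((p - 2) / 2) * (2 ^ j) ^ ((p - 2) / 2) * (1 + m)) *
          envelopeNorm p μ h +
        (K * 2 ^ j) ^ ((p - 2) / p) * eLpNorm h (ENNReal.ofReal (p / 2)) μ := by gcongr
    _ = _ := by
        rw [henv, hLp, ← hof, ← ENNReal.ofReal_mul (by positivity)]
        ring_nf

end Stationary

/-! ### Families of moduli and the second order terms summed over dyadic scales -/

lemma sum_odd_le_sum_Icc {f : ℕ → ℝ} (hf : ∀ i, 0 ≤ f i) (M : ℕ) :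
    ∑ m ∈ Finset.range M, f (2 * m + 1) ≤ ∑ i ∈ Finset.Icc 1 (2 * M), f i := by
  rw [← Finset.sum_image (f := f) (g := fun m => 2 * m + 1) (fun a _ b _ h => by simpa using h)]
  refine Finset.sum_le_sum_of_subset_of_nonneg (fun i hi => ?_) fun i _ _ => hf i
  obtain ⟨m, hm, rfl⟩ := Finset.mem_image.1 hi
  rw [Finset.mem_range] at hm
  rw [Finset.mem_Icc]
  omega

lemma sum_reflect_le_sum_Icc {f : ℕ → ℝ} (hf : ∀ i, 0 ≤ f i) {n M : ℕ} (h : n ≤ M) :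
    ∑ q ∈ Finset.range n, f (n - q) ≤ ∑ i ∈ Finset.Icc 1 M, f i := by
  have : ∑ q ∈ Finset.range n, f (n - q) = ∑ i ∈ Finset.Icc 1 n, f i := by
    refine Finset.sum_nbij' (fun q => n - q) (fun i => n - i) ?_ ?_ ?_ ?_ ?_
    all_goals intro q hq; simp only [Finset.mem_range, Finset.mem_Icc] at hq ⊢
    all_goals omega
  rw [this]
  exact Finset.sum_le_sum_of_subset_of_nonneg (Finset.Icc_subset_Icc_right h) fun i _ _ => hf i

/-- A family of moduli of continuity, with summable behaviour at every dyadic scale. -/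
structure Moduli (p : ℝ) (N : ℕ) (B : ℝ) (w : ℕ → ℝ → ℝ) : Prop where
  nonneg_const : 0 ≤ B
  measurable : ∀ s, Measurable (w s)
  mono : ∀ s, MonotoneOn (w s) (Ici 0)
  nonneg : ∀ s d, 0 ≤ d → 0 ≤ w s d
  -- Only the multiples of 2^j occur at level j, hence the gain 2^(-j) over the full sum at level 0.
  sum_le : ∀ j ≤ N, ∀ d, 0 ≤ d →
    ∑ i ∈ Finset.Icc 1 (2 ^ (N - j)), w (i * 2 ^ j) d ≤ B * (2 ^ j)⁻¹ * d ^ (p - 2)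

lemma Moduli.le {p : ℝ} {N : ℕ} {B : ℝ} {w : ℕ → ℝ → ℝ} (hw : Moduli p N B w) {s : ℕ}
    (hs : s ∈ Icc 1 (2 ^ N)) {d : ℝ} (hd : 0 ≤ d) : w s d ≤ B * d ^ (p - 2) := by
  have h := hw.sum_le 0 (Nat.zero_le _) d hd
  simp only [pow_zero, mul_one, Nat.sub_zero, inv_one] at h
  refine le_trans ?_ h
  exact Finset.single_le_sum (f := fun i => w i d) (fun i _ => hw.nonneg i d hd)
    (Finset.mem_Icc.2 hs)

namespace Stationary

set_option linter.unusedSectionVars false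

variable {Ω : Type*} {F₀ mΩ : MeasurableSpace Ω}
  {μ : Measure Ω} [IsProbabilityMeasure μ] {T : Ω ≃ᵐ Ω} {X₀ : Ω → ℝ} {v : ℝ≥0} {p : ℝ}
  (H : Stationary F₀ μ T X₀ v p)

include H

/-- Summing the moduli before integrating and using level 0 of `Moduli.sum_le` bounds all the Taylor
remainders by a single p-th moment. -/
lemma sum_remainder_le {N n : ℕ} (hn : n ≤ 2 ^ N) {w : ℕ → ℝ → ℝ} {B : ℝ} (hw : Moduli p N B w)
    {Ω' : Type*} [MeasurableSpace Ω'] {ν : Measure Ω'} [IsProbabilityMeasure ν] {Y : Ω' → ℝ}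
    (hY : MemLp Y (ENNReal.ofReal p) ν) :
    ∑ q ∈ Finset.range n, ∫ y, w (n - q) |Y y| * Y y ^ 2 ∂ν ≤ B * ∫ y, |Y y| ^ p ∂ν := by
  have hp := H.hp
  have hYm := hY.1.aemeasurable
  have e : ∀ x : ℝ, |x| ^ p = |x| ^ (p - 2) * x ^ 2 := by
    intro x
    rw [← sq_abs, ← Real.rpow_natCast |x| 2, ← Real.rpow_add' (abs_nonneg _)]
    · norm_num
    · push_cast; linarith [hp.1]
  have hi : Integrable (fun y => |Y y| ^ p) ν := by
    have := hY.integrable_norm_rpow'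
    rwa [ENNReal.toReal_ofReal (by linarith [hp.1])] at this
  have hq : ∀ q ∈ Finset.range n, Integrable (fun y => w (n - q) |Y y| * Y y ^ 2) ν := by
    intro q hq
    rw [Finset.mem_range] at hq
    refine (hi.const_mul B).mono' (((hw.measurable _).comp_aemeasurable hYm.abs).mul
      (hYm.pow_const 2)).aestronglyMeasurable (ae_of_all _ fun y => ?_)
    rw [Real.norm_eq_abs, abs_mul, abs_of_nonneg (hw.nonneg _ _ (abs_nonneg _)),
      abs_of_nonneg (sq_nonneg (Y y)), e, ← mul_assoc]
    exact mul_le_mul_of_nonneg_right (hw.le ⟨by omega, by omega⟩ (abs_nonneg _)) (sq_nonneg _)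
  rw [← integral_finsetSum _ hq, ← integral_const_mul]
  refine integral_mono (integrable_finsetSum _ hq) (hi.const_mul B) fun y => ?_
  simp only
  rw [← Finset.sum_mul, e, ← mul_assoc]
  refine mul_le_mul_of_nonneg_right ?_ (sq_nonneg _)
  refine (sum_reflect_le_sum_Icc (f := fun i => w i |Y y|)
    (fun i => hw.nonneg i _ (abs_nonneg _)) hn).trans ?_
  simpa using hw.sum_le 0 (Nat.zero_le _) |Y y| (abs_nonneg _)

/-- At level j only odd multiples of 2^j occur, and neither the block length l nor c depends on m,
so the moduli can be summed inside the integral. -/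
lemma sum_block_weight_le {N j : ℕ} (hj : j < N) {w : ℕ → ℝ → ℝ} {B : ℝ} (hw : Moduli p N B w)
    (l : ℕ) (c : Ω → ℝ) (hc : Measurable c) :
    ∑ m ∈ Finset.range (2 ^ (N - j - 1)),
      ∫⁻ ω, ENNReal.ofReal (w ((2 * m + 1) * 2 ^ j) |pastSum T X₀ l ω| +
        ∫ y, w ((2 * m + 1) * 2 ^ j) |y| ∂gaussianReal 0 (l * v)) * ‖c ω‖ₑ ∂μ ≤
    ENNReal.ofReal (B * (2 ^ j)⁻¹) * ∫⁻ ω, ENNReal.ofReal (|pastSum T X₀ l ω| ^ (p - 2) +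
        ∫ y, |y| ^ (p - 2) ∂gaussianReal 0 (l * v)) * ‖c ω‖ₑ ∂μ := by
  have hp := H.hp
  have hRm := H.measurable_pastSum' l
  have hwm := hw.measurable
  have hB := hw.nonneg_const
  have hpow : 2 * 2 ^ (N - j - 1) = 2 ^ (N - j) := by rw [← pow_succ']; congr 1; omega
  have hsum : ∀ d, 0 ≤ d → ∑ m ∈ Finset.range (2 ^ (N - j - 1)), w ((2 * m + 1) * 2 ^ j) d ≤
      B * (2 ^ j)⁻¹ * d ^ (p - 2) := by
    intro d hd
    refine (sum_odd_le_sum_Icc (f := fun i => w (i * 2 ^ j) d) (fun i => hw.nonneg _ d hd) _).trans ?_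
    rw [hpow]
    exact hw.sum_le j hj.le d hd
  have hle : ∀ m ∈ Finset.range (2 ^ (N - j - 1)), (2 * m + 1) * 2 ^ j ∈ Icc 1 (2 ^ N) := by
    intro m hm
    rw [Finset.mem_range] at hm
    refine ⟨Nat.mul_pos (by omega) (by positivity), ?_⟩
    calc (2 * m + 1) * 2 ^ j ≤ 2 ^ (N - j) * 2 ^ j := Nat.mul_le_mul_right _ (by omega)
      _ = 2 ^ N := by rw [← pow_add]; congr 1; omega
  have hi := integrable_abs_rpow_gaussian (l * v) (by linarith [hp.1] : 0 ≤ p - 2)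
  have iw : ∀ m ∈ Finset.range (2 ^ (N - j - 1)),
      Integrable (fun y => w ((2 * m + 1) * 2 ^ j) |y|) (gaussianReal 0 (l * v)) := by
    intro m hm
    refine (hi.const_mul B).mono' ((hwm _).comp (by fun_prop)).aestronglyMeasurable
      (ae_of_all _ fun y => ?_)
    rw [Real.norm_eq_abs, abs_of_nonneg (hw.nonneg _ _ (abs_nonneg _))]
    exact hw.le (hle m hm) (abs_nonneg _)
  have hm1 : ∀ m, Measurable fun ω => w ((2 * m + 1) * 2 ^ j) |pastSum T X₀ l ω| :=
    fun m => (hwm _).comp (by fun_prop)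
  rw [← lintegral_finsetSum _ fun m _ => by
      have := hm1 m
      fun_prop,
    ← lintegral_const_mul' _ _ ENNReal.ofReal_ne_top]
  refine lintegral_mono fun ω => ?_
  rw [← Finset.sum_mul, ← mul_assoc, ← ENNReal.ofReal_mul (by positivity),
    ← ENNReal.ofReal_sum_of_nonneg fun m _ => add_nonneg (hw.nonneg _ _ (abs_nonneg _))
      (integral_nonneg fun y => hw.nonneg _ _ (abs_nonneg _))]
  gcongr
  rw [Finset.sum_add_distrib, mul_add]
  refine add_le_add (hsum _ (abs_nonneg _)) ?_
  rw [← integral_finsetSum _ iw, ← integral_const_mul]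
  exact integral_mono (integrable_finsetSum _ iw) (hi.const_mul _) fun y => hsum _ (abs_nonneg _)

/-- The frozen second derivatives in reversed time. -/
lemma sum_second_order {n N : ℕ} (hn : n ∈ Icc 1 (2 ^ N)) {h2 : ℝ → ℝ}
    (h2m : Measurable h2) (h2g : Grows (p - 2) h2) :
    ∑ q ∈ Finset.range n, ∫ ω, gsm ((n - (q + 1) : ℕ) * v) h2 (partialSum T X₀ q ω) *
        (seq T X₀ ((q : ℤ) + 1) ω ^ 2 - v) ∂μ =
      ∑ j ∈ Finset.range N, ∑ m ∈ Finset.range (2 ^ (N - j - 1)),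
        ∫ ω, (gsm ((min ((2 * m + 1) * 2 ^ j) n - 1 : ℕ) * v) h2
            (partialSum T X₀ (n - (2 * m + 1) * 2 ^ j) ω) -
          gsm ((min ((2 * m + 2) * 2 ^ j) n - 1 : ℕ) * v) h2
            (partialSum T X₀ (n - (2 * m + 2) * 2 ^ j) ω)) *
          ∑ i ∈ Finset.range (2 ^ j), (seq T X₀ ((n : ℤ) - (2 * m * 2 ^ j + i : ℕ)) ω ^ 2 - v) ∂μ := by
  have hp := H.hp
  -- The index s counts time backwards from n. Truncation at n extends the sequence by a
  -- deterministic constant, which is orthogonal to the centred squares, so the sum may be padded to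
  -- length 2^N.
  set a : ℕ → Ω → ℝ := fun s ω => gsm ((min s n - 1 : ℕ) * v) h2 (partialSum T X₀ (n - s) ω)
  set y : ℕ → Ω → ℝ := fun i ω => seq T X₀ ((n : ℤ) - i) ω ^ 2 - v
  have ia : ∀ s i, Integrable (fun ω => a s ω * y i ω) μ := by
    intro s i
    obtain ⟨A, hA, hg⟩ := h2g.gsm (by linarith [hp.1]) ((min s n - 1 : ℕ) * v)
    exact H.integrable_mul_sq ((measurable_gsm h2m _).comp (H.measurable_partialSum' _))
      (H.memLp_partialSum (n - s)) hA (fun ω => hg _) _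
  have iblock : ∀ (s s' : ℕ) (I : Finset ℕ) (f : ℕ → ℕ),
      Integrable (fun ω => (a s ω - a s' ω) * ∑ i ∈ I, y (f i) ω) μ := by
    intro s s' I f
    simp only [Finset.mul_sum, sub_mul]
    exact integrable_finsetSum _ fun i _ => (ia s _).sub (ia s' _)
  have hconst : ∀ s, n ≤ s → ∀ ω, a s ω = gsm ((n - 1 : ℕ) * v) h2 0 := by
    intro s hs ω
    simp only [a, min_eq_right hs, Nat.sub_eq_zero_of_le hs, partialSum_zero]
  have hy : ∀ i, ∫ ω, y i ω ∂μ = 0 := by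
    intro i
    simp only [y]
    rw [integral_sub (H.integrable_sq _) (integrable_const _), H.integral_sq]
    simp
  have iy : ∀ i, Integrable (y i) μ := fun i => (H.integrable_sq _).sub (integrable_const _)
  have hay : ∀ s i, n ≤ s → ∫ ω, a s ω * y i ω ∂μ = 0 := by
    intro s i hs
    simp_rw [hconst s hs]
    rw [integral_const_mul, hy, mul_zero]
  have step1 : ∑ q ∈ Finset.range n, ∫ ω, gsm ((n - (q + 1) : ℕ) * v) h2 (partialSum T X₀ q ω) *
        (seq T X₀ ((q : ℤ) + 1) ω ^ 2 - v) ∂μ =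
      ∑ s ∈ Finset.range (2 ^ N), ∫ ω, a (s + 1) ω * y s ω ∂μ := by
    rw [← Finset.sum_subset (Finset.range_subset_range.2 hn.2) fun s _ hs => hay (s + 1) s (by
      rw [Finset.mem_range] at hs; omega), ← Finset.sum_range_reflect]
    refine Finset.sum_congr rfl fun s hs => ?_
    rw [Finset.mem_range] at hs
    simp only [a, y]
    have e1 : n - (n - 1 - s + 1) = min (s + 1) n - 1 := by omega
    have e2 : n - 1 - s = n - (s + 1) := by omega
    have e3 : ((n - 1 - s : ℕ) : ℤ) + 1 = (n : ℤ) - s := by omega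
    rw [e1, e3, e2]
  rw [step1, ← integral_finsetSum _ fun s _ => ia _ _]
  simp_rw [fun ω => sum_mul_eq_dyadic (fun s => a s ω) (fun i => y i ω) N]
  rw [integral_add, integral_finsetSum]
  · simp_rw [fun ω => hconst (2 ^ N) hn.2 ω]
    rw [integral_const_mul, integral_finsetSum _ fun i _ => iy i, Finset.sum_eq_zero fun i _ => hy i,
      mul_zero, zero_add]
    refine Finset.sum_congr rfl fun j _ => ?_
    rw [integral_finsetSum _ fun m _ => iblock _ _ _ _]
  · exact fun j _ => integrable_finsetSum _ fun m _ => iblock _ _ _ _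
  · simp only [Finset.mul_sum]
    exact integrable_finsetSum _ fun i _ => ia _ _
  · exact integrable_finsetSum _ fun j _ => integrable_finsetSum _ fun m _ => iblock _ _ _ _

end Stationary

namespace Stationary

set_option linter.unusedSectionVars false

variable {Ω : Type*} {F₀ mΩ : MeasurableSpace Ω}
  {μ : Measure Ω} [IsProbabilityMeasure μ] {T : Ω ≃ᵐ Ω} {X₀ : Ω → ℝ} {v : ℝ≥0} {p : ℝ}
  (H : Stationary F₀ μ T X₀ v p)

omit H in
lemma sum_sq_eq_sqSum (T : Ω ≃ᵐ Ω) (X₀ : Ω → ℝ) (v : ℝ≥0) (L q : ℕ) (t : ℤ) (h : t = q + L)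
    (ω : Ω) : ∑ i ∈ Finset.range L, (seq T X₀ (t - i) ω ^ 2 - v) = sqSum T X₀ v L (iter T q ω) := by
  rw [sqSum, ← Finset.sum_range_reflect]
  refine Finset.sum_congr rfl fun i hi => ?_
  rw [Finset.mem_range] at hi
  rw [seq_iter]
  congr 3
  omega

include H

/-- If the block starts before time 0 the increment vanishes. Otherwise the available past has
length 2^j, or n mod 2^j when it is cut off by the origin. Neither length depends on m, so bounding
by the sum of both contributions allows summation over m. -/
lemma enorm_dyadic_block_le {n j m l₁ : ℕ} {h2 w : ℝ → ℝ} {B : ℝ}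
    (h2m : Measurable h2) (h2g : Grows (p - 2) h2) (hwm : Measurable w)
    (hwB : ∀ d, 0 ≤ d → w d ≤ B * d ^ (p - 2))
    (hmod : ∀ x y, |gsm (((2 * m + 1) * 2 ^ j - 1 : ℕ) * v) h2 x -
      gsm (((2 * m + 1) * 2 ^ j - 1 : ℕ) * v) h2 y| ≤ w |x - y|)
    (hl₁ : l₁ = if n % 2 ^ j = 0 then 2 ^ j else n % 2 ^ j) :
    ‖∫ ω, (gsm ((min ((2 * m + 1) * 2 ^ j) n - 1 : ℕ) * v) h2
            (partialSum T X₀ (n - (2 * m + 1) * 2 ^ j) ω) -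
          gsm ((min ((2 * m + 2) * 2 ^ j) n - 1 : ℕ) * v) h2
            (partialSum T X₀ (n - (2 * m + 2) * 2 ^ j) ω)) *
          ∑ i ∈ Finset.range (2 ^ j), (seq T X₀ ((n : ℤ) - (2 * m * 2 ^ j + i : ℕ)) ω ^ 2 - v) ∂μ‖ₑ ≤
      ∫⁻ ω, ENNReal.ofReal (w |pastSum T X₀ (2 ^ j) ω| + ∫ y, w |y| ∂gaussianReal 0 ((2 ^ j : ℕ) * v)) *
        ‖(μ[sqSum T X₀ v (2 ^ j) | F₀]) ω‖ₑ ∂μ +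
      ∫⁻ ω, ENNReal.ofReal (w |pastSum T X₀ l₁ ω| + ∫ y, w |y| ∂gaussianReal 0 (l₁ * v)) *
        ‖(μ[sqSum T X₀ v (2 ^ j) | F₀]) ω‖ₑ ∂μ := by
  have hs' : (2 * m + 2) * 2 ^ j = (2 * m + 1) * 2 ^ j + 2 ^ j := by ring
  have hs0 : (2 * m + 1) * 2 ^ j = 2 * m * 2 ^ j + 2 ^ j := by ring
  have hj1 : 1 ≤ 2 ^ j := Nat.one_le_two_pow
  rw [hs']
  set s := (2 * m + 1) * 2 ^ j with hs
  by_cases hsn : n ≤ s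
  · have e1 : min s n = min (s + 2 ^ j) n := by omega
    have e2 : n - s = n - (s + 2 ^ j) := by omega
    rw [e1, e2]
    simp
  push Not at hsn
  set q := n - s with hq
  set l := min (2 ^ j) q with hl
  have e1 : (min s n - 1 : ℕ) = s - 1 := by omega
  have e2 : n - (s + 2 ^ j) = q - l := by omega
  have e3 : (min (s + 2 ^ j) n - 1 : ℕ) = l + (s - 1) := by omega
  have e4 : ∀ ω, ∑ i ∈ Finset.range (2 ^ j),
      (seq T X₀ ((n : ℤ) - (2 * m * 2 ^ j + i : ℕ)) ω ^ 2 - v) =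
      sqSum T X₀ v (2 ^ j) (iter T q ω) := by
    intro ω
    rw [← sum_sq_eq_sqSum T X₀ v (2 ^ j) q ((n : ℤ) - (2 * m * 2 ^ j : ℕ)) (by omega) ω]
    refine Finset.sum_congr rfl fun i _ => ?_
    congr 3
    omega
  have e5 : gsm ((l + (s - 1) : ℕ) * v) h2 = gsm (l * v) (gsm ((s - 1 : ℕ) * v) h2) := by
    rw [gsm_gsm (by linarith [H.hp.1]) h2m h2g, Nat.cast_add, add_mul]
  rw [e1, e2, e3, e5]
  simp_rw [e4]
  have key := H.enorm_block_le (measurable_gsm h2m ((s - 1 : ℕ) * v))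
    (h2g.gsm (by linarith [H.hp.1]) _) hwm hwB hmod (l := l)
    (min_le_right (2 ^ j) q) (2 ^ j)
  refine key.trans ?_
  by_cases hql : 2 ^ j ≤ q
  · have : l = 2 ^ j := min_eq_left hql
    rw [this]
    exact le_add_right le_rfl
  · push Not at hql
    have hmod' : n % 2 ^ j = q := by
      have : n = q + 2 ^ j * (2 * m + 1) := by rw [mul_comm, ← hs]; omega
      rw [this, Nat.add_mul_mod_self_left, Nat.mod_eq_of_lt hql]
    have : l = l₁ := by
      rw [hl₁, hmod', if_neg (by omega)]
      omega
    rw [this]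
    exact le_add_left le_rfl

/-- Comparison of the partial sums with Gaussian variables through smooth functions. -/
theorem lindeberg (hv : v ≠ 0) {σ : ℝ} (hσ : σ ^ 2 = v) {N n : ℕ} (hn : n ∈ Icc 1 (2 ^ N))
    {h h1 h2 : ℝ → ℝ} (hh : TestTriple p h h1 h2) {w : ℕ → ℝ → ℝ} {B : ℝ} (hw : Moduli p N B w)
    -- The shift s + 1 leaves room for moduli singular at time 0: the second derivative after s
    -- smoothings is controlled by the modulus at time s + 1.
    (hmod : ∀ (s : ℕ) (x y : ℝ), |gsm (s * v) h2 x - gsm (s * v) h2 y| ≤ w (s + 1) |x - y|)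
    {K : ℝ≥0∞} (hK : ∀ j < N, ∀ l ∈ Icc 1 (2 ^ j),
      monoCost p (μ.map (partialSum T X₀ l)) (gaussianReal 0 (l * v)) ≤ K * 2 ^ j) :
    ‖∫ ω, h (partialSum T X₀ n ω) ∂μ - ∫ y, h y ∂gaussianReal 0 (n * v)‖ₑ ≤
      ENNReal.ofReal B * (ENNReal.ofReal (∫ ω, |X₀ ω| ^ p ∂μ + ∫ y, |y| ^ p ∂gaussianReal 0 v) +
        16 * (ENNReal.ofReal ((v : ℝ) ^ ((p - 2) / 2) * (1 + ∫ y, |y| ^ (p - 2) ∂gaussianReal 0 1)) *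
          (∑' k : ℕ, ((k + 1 : ℕ) : ℝ≥0∞) ^ (p / 2 - 2) *
            envelopeNorm p μ (condVarDev F₀ μ T X₀ σ (k + 1))) +
          K ^ ((p - 2) / p) * ∑' k : ℕ, ((k + 1 : ℕ) : ℝ≥0∞) ^ (-(2 / p)) *
            eLpNorm (condVarDev F₀ μ T X₀ σ (k + 1)) (ENNReal.ofReal (p / 2)) μ)) := by
  have hp := H.hp
  have hp0 : 0 < p := by linarith [hp.1]
  have hα : 0 < p - 2 := by linarith [hp.1]
  have hB := hw.nonneg_const
  set e : ℕ → ℝ := fun q => ∫ ω, gsm ((n - (q + 1) : ℕ) * v) h2 (partialSum T X₀ q ω) *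
        (seq T X₀ ((q : ℤ) + 1) ω ^ 2 - v) ∂μ
  set G : ℕ → ℝ → ℝ := fun q => gsm ((n - q : ℕ) * v) h
  -- `G q` averages h over Gaussian substitutes for the last n - q variables; q = n gives S_n and q
  -- = 0 the full Gaussian.
  have tele : ∫ ω, h (partialSum T X₀ n ω) ∂μ - ∫ y, h y ∂gaussianReal 0 (n * v) =
      ∑ q ∈ Finset.range n, (∫ ω, G (q + 1) (partialSum T X₀ (q + 1) ω) ∂μ -
        ∫ ω, G q (partialSum T X₀ q ω) ∂μ) := by
    rw [Finset.sum_range_sub (fun q => ∫ ω, G q (partialSum T X₀ q ω) ∂μ)]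
    simp [G, partialSum_zero, gsm]
  have hstep : ∀ q ∈ Finset.range n, |∫ ω, G (q + 1) (partialSum T X₀ (q + 1) ω) ∂μ -
      ∫ ω, G q (partialSum T X₀ q ω) ∂μ - 1 / 2 * e q| ≤
      ∫ ω, w (n - q) |X₀ ω| * X₀ ω ^ 2 ∂μ + ∫ y, w (n - q) |y| * y ^ 2 ∂gaussianReal 0 v := by
    intro q hq
    rw [Finset.mem_range] at hq
    have hnq : n - q = n - (q + 1) + 1 := by omega
    have hG : G q = gsm v (G (q + 1)) := by
      simp only [G]
      rw [gsm_gsm hp0.le hh.measurable_zero hh.grows_zero, hnq]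
      congr 1
      push_cast
      ring
    rw [hG]
    refine H.lindeberg_step (hh.gsm hp.1 _) (hw.measurable _) (hw.mono _)
      (fun d hd => hw.le ⟨by omega, ?_⟩ hd) (fun x y => ?_) q
    · have := hn.2; omega
    · rw [hnq]; exact hmod _ x y
  have hrem : |∫ ω, h (partialSum T X₀ n ω) ∂μ - ∫ y, h y ∂gaussianReal 0 (n * v)| ≤
      B * (∫ ω, |X₀ ω| ^ p ∂μ + ∫ y, |y| ^ p ∂gaussianReal 0 v) +
        |∑ q ∈ Finset.range n, e q| := by
    have hX := H.sum_remainder_le hn.2 hw H.memLp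
    have hY := H.sum_remainder_le hn.2 hw
      (memLp_id_gaussianReal' (μ := 0) (v := v) (ENNReal.ofReal p) ENNReal.ofReal_ne_top)
    simp only [id] at hY
    have hs := (Finset.abs_sum_le_sum_abs _ _).trans (Finset.sum_le_sum hstep)
    rw [Finset.sum_sub_distrib, ← tele, ← Finset.mul_sum, Finset.sum_add_distrib] at hs
    have h3 := abs_sub_abs_le_abs_sub (∫ ω, h (partialSum T X₀ n ω) ∂μ -
      ∫ y, h y ∂gaussianReal 0 (n * v)) (1 / 2 * ∑ q ∈ Finset.range n, e q)
    rw [abs_mul, abs_of_pos (by norm_num : (0 : ℝ) < 1 / 2)] at h3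
    linarith [abs_nonneg (∑ q ∈ Finset.range n, e q)]
  set c : ℕ → ℝ≥0∞ := fun k => envelopeNorm p μ (condVarDev F₀ μ T X₀ σ k)
  set d : ℕ → ℝ≥0∞ := fun k => eLpNorm (condVarDev F₀ μ T X₀ σ k) (ENNReal.ofReal (p / 2)) μ
  set V := ENNReal.ofReal ((v : ℝ) ^ ((p - 2) / 2) * (1 + ∫ y, |y| ^ (p - 2) ∂gaussianReal 0 1))
  have hsec : ‖∑ q ∈ Finset.range n, e q‖ₑ ≤ ENNReal.ofReal B * (16 *
      (V * (∑' k : ℕ, ((k + 1 : ℕ) : ℝ≥0∞) ^ (p / 2 - 2) * c (k + 1)) +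
        K ^ ((p - 2) / p) * ∑' k : ℕ, ((k + 1 : ℕ) : ℝ≥0∞) ^ (-(2 / p)) * d (k + 1))) := by
    rw [H.sum_second_order hn hh.measurable_two hh.grows_two]
    refine (enorm_sum_le _ _).trans ?_
    have hlevel : ∀ j ∈ Finset.range N, ‖∑ m ∈ Finset.range (2 ^ (N - j - 1)),
        ∫ ω, (gsm ((min ((2 * m + 1) * 2 ^ j) n - 1 : ℕ) * v) h2
            (partialSum T X₀ (n - (2 * m + 1) * 2 ^ j) ω) -
          gsm ((min ((2 * m + 2) * 2 ^ j) n - 1 : ℕ) * v) h2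
            (partialSum T X₀ (n - (2 * m + 2) * 2 ^ j) ω)) *
          ∑ i ∈ Finset.range (2 ^ j),
            (seq T X₀ ((n : ℤ) - (2 * m * 2 ^ j + i : ℕ)) ω ^ 2 - v) ∂μ‖ₑ ≤
        ENNReal.ofReal B * (8 * (V * (((2 : ℝ≥0∞) ^ j) ^ (-(2 - (p - 2) / 2)) *
            ∑ k ∈ Finset.Icc 1 (2 ^ j : ℕ), (k : ℝ≥0∞) * c k) +
          K ^ ((p - 2) / p) * (((2 : ℝ≥0∞) ^ j) ^ (-(2 - (p - 2) / p)) *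
            ∑ k ∈ Finset.Icc 1 (2 ^ j : ℕ), (k : ℝ≥0∞) * d k))) := by
      intro j hj
      rw [Finset.mem_range] at hj
      set l₁ := if n % 2 ^ j = 0 then 2 ^ j else n % 2 ^ j with hl₁
      have hl₁' : l₁ ∈ Icc 1 (2 ^ j) := by
        have h1 : 1 ≤ 2 ^ j := Nat.one_le_two_pow
        rw [hl₁]
        split_ifs with h0
        · exact ⟨h1, le_rfl⟩
        · exact ⟨Nat.pos_of_ne_zero h0, (Nat.mod_lt _ (by positivity)).le⟩
      set cj : Ω → ℝ := μ[sqSum T X₀ v (2 ^ j) | F₀]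
      have hcm : Measurable cj := (stronglyMeasurable_condExp.mono H.le).measurable
      have hpow0 : (2 : ℝ≥0∞) ^ j ≠ 0 := by simp
      have hpowt : (2 : ℝ≥0∞) ^ j ≠ ∞ := by simp
      have hW : ∀ l ∈ Icc 1 (2 ^ j), ENNReal.ofReal (B * (2 ^ j)⁻¹) *
          ∫⁻ ω, ENNReal.ofReal (|pastSum T X₀ l ω| ^ (p - 2) +
            ∫ y, |y| ^ (p - 2) ∂gaussianReal 0 (l * v)) * ‖cj ω‖ₑ ∂μ ≤
          ENNReal.ofReal B * (4 * (V * (((2 : ℝ≥0∞) ^ j) ^ (-(2 - (p - 2) / 2)) *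
            ∑ k ∈ Finset.Icc 1 (2 ^ j : ℕ), (k : ℝ≥0∞) * c k) +
          K ^ ((p - 2) / p) * (((2 : ℝ≥0∞) ^ j) ^ (-(2 - (p - 2) / p)) *
            ∑ k ∈ Finset.Icc 1 (2 ^ j : ℕ), (k : ℝ≥0∞) * d k))) := by
        intro l hl
        have hwt := H.lintegral_weight_le hv hσ hl (hK j hj l hl)
        change _ ≤ 4 * ∑ k ∈ Finset.Icc 1 (2 ^ j : ℕ), (k : ℝ≥0∞) *
          (V * (2 ^ j) ^ ((p - 2) / 2) * c k + (K * 2 ^ j) ^ ((p - 2) / p) * d k) at hwt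
        have hE : ENNReal.ofReal (B * (2 ^ j)⁻¹) = ENNReal.ofReal B * ((2 : ℝ≥0∞) ^ j)⁻¹ := by
          rw [ENNReal.ofReal_mul hB, ENNReal.ofReal_inv_of_pos (by positivity),
            ENNReal.ofReal_pow (by norm_num), ENNReal.ofReal_ofNat]
        have hinv : ∀ x y : ℝ≥0∞, 2 ^ j * x ≤ y → x ≤ ((2 : ℝ≥0∞) ^ j)⁻¹ * y := by
          intro x y hxy
          rw [← ENNReal.div_eq_inv_mul, ENNReal.le_div_iff_mul_le (Or.inl hpow0) (Or.inl hpowt),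
            mul_comm]
          exact hxy
        -- One factor 2^(-j) comes from the sparse moduli, the other from averaging the splitting
        -- point, and 2^(jb) from the weight.
        have hexp : ∀ b : ℝ, ((2 : ℝ≥0∞) ^ j) ^ (-(2 - b)) =
            ((2 : ℝ≥0∞) ^ j)⁻¹ * ((2 : ℝ≥0∞) ^ j)⁻¹ * ((2 : ℝ≥0∞) ^ j) ^ b := by
          intro b
          rw [← ENNReal.rpow_neg_one, ← ENNReal.rpow_add _ _ hpow0 hpowt,
            ← ENNReal.rpow_add _ _ hpow0 hpowt]
          congr 1; ring
        rw [hE, mul_assoc]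
        refine mul_le_mul_right ?_ _
        refine (mul_le_mul_right (hinv _ _ hwt) _).trans (le_of_eq ?_)
        rw [ENNReal.mul_rpow_of_nonneg _ _ (by positivity), hexp, hexp]
        simp only [Finset.mul_sum, mul_add, ← Finset.sum_add_distrib]
        refine Finset.sum_congr rfl fun k _ => ?_
        generalize ((2 : ℝ≥0∞) ^ j)⁻¹ = x
        generalize ((2 : ℝ≥0∞) ^ j) ^ ((p - 2) / 2) = y
        generalize ((2 : ℝ≥0∞) ^ j) ^ ((p - 2) / p) = z
        generalize K ^ ((p - 2) / p) = K'
        ring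
      refine (enorm_sum_le _ _).trans ((Finset.sum_le_sum fun m hm =>
        H.enorm_dyadic_block_le hh.measurable_two hh.grows_two
          (hw.measurable ((2 * m + 1) * 2 ^ j)) (B := B)
          (fun x hx => hw.le ?_ hx) (fun x y => ?_) hl₁).trans ?_)
      · rw [Finset.mem_range] at hm
        refine ⟨Nat.mul_pos (by omega) (by positivity), ?_⟩
        have hpow : 2 * 2 ^ (N - j - 1) = 2 ^ (N - j) := by rw [← pow_succ']; congr 1; omega
        calc (2 * m + 1) * 2 ^ j ≤ 2 ^ (N - j) * 2 ^ j := Nat.mul_le_mul_right _ (by omega)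
          _ = 2 ^ N := by rw [← pow_add]; congr 1; omega
      · have hpos : 0 < (2 * m + 1) * 2 ^ j := Nat.mul_pos (by omega) (by positivity)
        have := hmod ((2 * m + 1) * 2 ^ j - 1) x y
        rwa [Nat.sub_add_cancel hpos] at this
      · rw [Finset.sum_add_distrib]
        refine (add_le_add ((H.sum_block_weight_le hj hw (2 ^ j) cj hcm).trans
          (hW (2 ^ j) ⟨Nat.one_le_two_pow, le_rfl⟩))
          ((H.sum_block_weight_le hj hw l₁ cj hcm).trans (hW l₁ hl₁'))).trans (le_of_eq ?_)
        ring
    refine (Finset.sum_le_sum hlevel).trans ?_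
    rw [← Finset.mul_sum, ← Finset.mul_sum, Finset.sum_add_distrib, ← Finset.mul_sum,
      ← Finset.mul_sum]
    have s1 := dyadic_series_le (β := 2 - (p - 2) / 2) (by linarith [hp.2]) c N
    -- The two values of β turn 1 - β into p/2 - 2 and -2/p, the exponents of the two hypotheses.
    have s2 := dyadic_series_le (β := 2 - (p - 2) / p) (by
      have : (p - 2) / p ≤ 1 := by rw [div_le_one hp0]; linarith
      linarith) d N
    have x1 : 1 - (2 - (p - 2) / 2) = p / 2 - 2 := by ring
    have x2 : 1 - (2 - (p - 2) / p) = -(2 / p) := by field_simp; ring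
    rw [x1] at s1
    rw [x2] at s2
    refine (mul_le_mul_right (mul_le_mul_right (add_le_add (mul_le_mul_right s1 _)
      (mul_le_mul_right s2 _)) _) _).trans (le_of_eq ?_)
    ring
  have hfin := ENNReal.ofReal_le_ofReal hrem
  have hnn : 0 ≤ ∫ ω, |X₀ ω| ^ p ∂μ + ∫ y, |y| ^ p ∂gaussianReal 0 v :=
    add_nonneg (integral_nonneg fun _ => by positivity) (integral_nonneg fun _ => by positivity)
  rw [ENNReal.ofReal_add (by positivity) (abs_nonneg _), ← Real.enorm_eq_ofReal_abs,
    ← Real.enorm_eq_ofReal_abs, ENNReal.ofReal_mul hB] at hfin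
  refine hfin.trans ?_
  rw [mul_add]
  exact add_le_add le_rfl hsec

end Stationary

/-! ### The rate for the cost of order `p` -/

/-- Both integrals are transported to the uniform law by the quantile functions, where the
domination of the cost holds pointwise. -/
lemma monoCost_le_of_test {r c : ℝ} (hc : 0 ≤ c) {μ ν : Measure ℝ} [IsProbabilityMeasure μ]
    [IsProbabilityMeasure ν] {f : ℝ → ℝ} (hf : Measurable f) (hμ : Integrable f μ)
    (hν : Integrable f ν) (h : ∀ u ∈ Ioo (0 : ℝ) 1, c * |quantile μ u - quantile ν u| ^ r ≤
      f (quantile μ u) - f (quantile ν u)) :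
    ENNReal.ofReal c * monoCost r μ ν ≤ ‖∫ x, f x ∂μ - ∫ x, f x ∂ν‖ₑ := by
  have key : ∀ (ρ : Measure ℝ) [IsProbabilityMeasure ρ], Integrable f ρ →
      Integrable (fun u => f (quantile ρ u)) unif ∧
        ∫ u, f (quantile ρ u) ∂unif = ∫ x, f x ∂ρ := by
    intro ρ _ hρ
    have hq := aemeasurable_quantile ρ
    have hm := map_quantile ρ
    constructor
    · have h' := hρ
      rw [← hm] at h'
      exact h'.comp_aemeasurable hq
    · conv_rhs => rw [← hm]
      rw [integral_map hq hf.aestronglyMeasurable]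
  obtain ⟨i1, e1⟩ := key μ hμ
  obtain ⟨i2, e2⟩ := key ν hν
  have hae : ∀ᵐ u ∂unif, c * |quantile μ u - quantile ν u| ^ r ≤
      f (quantile μ u) - f (quantile ν u) := by
    rw [unif, ae_restrict_iff' measurableSet_Ioo]
    exact ae_of_all _ h
  rw [← e1, ← e2, ← integral_sub i1 i2, monoCost, ← lintegral_const_mul' _ _ ENNReal.ofReal_ne_top]
  calc ∫⁻ u, ENNReal.ofReal c * ENNReal.ofReal (|quantile μ u - quantile ν u| ^ r) ∂unif
      ≤ ∫⁻ u, ENNReal.ofReal (f (quantile μ u) - f (quantile ν u)) ∂unif := by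
        refine lintegral_mono_ae ?_
        filter_upwards [hae] with u hu
        rw [← ENNReal.ofReal_mul hc]
        exact ENNReal.ofReal_le_ofReal hu
    _ = ENNReal.ofReal (∫ u, (f (quantile μ u) - f (quantile ν u)) ∂unif) := by
        refine (ofReal_integral_eq_lintegral_ofReal (i1.sub i2) ?_).symm
        filter_upwards [hae] with u hu
        exact le_trans (b := c * |quantile μ u - quantile ν u| ^ r) (by positivity) hu
    _ ≤ _ := by
        rw [Real.enorm_eq_ofReal_abs]
        exact ENNReal.ofReal_le_ofReal (le_abs_self _)

lemma gsm_modulus {a : ℝ} (ha : 0 ≤ a) {φ w : ℝ → ℝ} (hφm : Measurable φ) (hφ : Grows a φ)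
    (h : ∀ x y, |φ x - φ y| ≤ w |x - y|) (t : ℝ≥0) (x y : ℝ) :
    |gsm t φ x - gsm t φ y| ≤ w |x - y| := by
  have i1 := hφ.integrable ha hφm t x
  have i2 := hφ.integrable ha hφm t y
  rw [gsm, gsm, ← integral_sub i1 i2]
  refine (abs_integral_le_integral_abs).trans ((integral_mono (i1.sub i2).abs
    (integrable_const (w |x - y|)) fun z => ?_).trans (by simp))
  refine (h _ _).trans (le_of_eq ?_)
  rw [add_sub_add_right_eq_sub]

/-- Second derivatives that are already (p-2)-Hölder keep their modulus under smoothing, so each of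
the 2^N times contributes equally and B is of order 2^N. -/
lemma moduli_rpow {p C : ℝ} (hp : 2 < p) (hC : 0 ≤ C) (N : ℕ) :
    Moduli p N (C * 2 ^ N) fun _ d => C * d ^ (p - 2) where
  nonneg_const := by positivity
  measurable _ := by fun_prop
  mono _ x hx y _ hxy := mul_le_mul_of_nonneg_left
    (Real.rpow_le_rpow hx hxy (by linarith)) hC
  nonneg _ d hd := by positivity
  sum_le j hj d _ := by
    rw [Finset.sum_const, Nat.card_Icc, nsmul_eq_mul]
    refine le_of_eq ?_
    have : (2 : ℝ) ^ N = 2 ^ (N - j) * 2 ^ j := by rw [← pow_add]; congr 1; omega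
    rw [this]
    rw [Nat.add_sub_cancel]
    push_cast
    field_simp

/-- The right side grows at most like √K. Taking K = D² with D = max(1, 2C) gives C(1 + K^θ) ≤ 2CD ≤
D². -/
lemma exists_fixed_bound {C : ℝ≥0∞} (hC : C ≠ ∞) {θ : ℝ} (hθ : θ ∈ Icc (0 : ℝ) (1 / 2)) :
    ∃ K : ℝ≥0∞, K ≠ ∞ ∧ C * (1 + K ^ θ) ≤ K := by
  set D := max 1 (2 * C) with hD
  have hDt : D ≠ ∞ := by
    rw [hD]
    exact (max_lt ENNReal.one_lt_top (ENNReal.mul_lt_top (by simp) hC.lt_top)).ne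
  have hD1 : 1 ≤ D := le_max_left _ _
  refine ⟨D ^ (2 : ℝ), ENNReal.rpow_ne_top_of_nonneg (by norm_num) hDt, ?_⟩
  have h1 : (D ^ (2 : ℝ)) ^ θ ≤ D := by
    rw [← ENNReal.rpow_mul]
    calc D ^ (2 * θ) ≤ D ^ (1 : ℝ) := ENNReal.rpow_le_rpow_of_exponent_le hD1 (by linarith [hθ.2])
      _ = D := ENNReal.rpow_one D
  calc C * (1 + (D ^ (2 : ℝ)) ^ θ) ≤ C * (D + D) := by gcongr
    _ = (2 * C) * D := by ring
    _ ≤ D * D := by gcongr; exact le_max_right _ _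
    _ = D ^ (2 : ℝ) := by rw [← sq, ← ENNReal.rpow_natCast]; norm_num

namespace Stationary

set_option linter.unusedSectionVars false

variable {Ω : Type*} {F₀ mΩ : MeasurableSpace Ω}
  {μ : Measure Ω} [IsProbabilityMeasure μ] {T : Ω ≃ᵐ Ω} {X₀ : Ω → ℝ} {v : ℝ≥0} {p : ℝ}
  (H : Stationary F₀ μ T X₀ v p)

include H

lemma isProbabilityMeasure_map (n : ℕ) : IsProbabilityMeasure (μ.map (partialSum T X₀ n)) :=
  Measure.isProbabilityMeasure_map (H.measurable_partialSum' n).aemeasurable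

lemma integrable_of_grows (n : ℕ) {f : ℝ → ℝ} (hf : Measurable f) (hg : Grows p f) :
    Integrable f (μ.map (partialSum T X₀ n)) := by
  have hm := H.measurable_partialSum' n
  rw [integrable_map_measure hf.aestronglyMeasurable hm.aemeasurable]
  obtain ⟨A, hA, hg⟩ := hg
  have hS := H.memLp_partialSum n
  refine integrable_of_growth H.hp.1 hS hS (hf.comp hm).aestronglyMeasurable A fun ω => ?_
  refine (hg _).trans (le_of_eq ?_)
  rw [← Real.rpow_natCast, ← Real.rpow_add (by positivity)]
  norm_num

lemma integral_map_partialSum (n : ℕ) {f : ℝ → ℝ} (hf : Measurable f) :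
    ∫ x, f x ∂(μ.map (partialSum T X₀ n)) = ∫ ω, f (partialSum T X₀ n ω) ∂μ :=
  integral_map (H.measurable_partialSum' n).aemeasurable hf.aestronglyMeasurable

/-- The rate of convergence for the cost of order `p`, together with the resulting comparison
for smooth functions. -/
theorem exists_bound (hv : v ≠ 0) {σ : ℝ} (hσ : σ ^ 2 = v)
    (hC1 : ∑' k : ℕ, ((k + 1 : ℕ) : ℝ≥0∞) ^ (p / 2 - 2) *
      envelopeNorm p μ (condVarDev F₀ μ T X₀ σ (k + 1)) ≠ ∞)
    (hC2 : ∑' k : ℕ, ((k + 1 : ℕ) : ℝ≥0∞) ^ (-(2 / p)) *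
      eLpNorm (condVarDev F₀ μ T X₀ σ (k + 1)) (ENNReal.ofReal (p / 2)) μ ≠ ∞) :
    ∃ K C : ℝ≥0∞, K ≠ ∞ ∧ C ≠ ∞ ∧
      (∀ N : ℕ, ∀ n ∈ Icc 1 (2 ^ N),
        monoCost p (μ.map (partialSum T X₀ n)) (gaussianReal 0 (n * v)) ≤ K * 2 ^ N) ∧
      ∀ N : ℕ, ∀ n ∈ Icc 1 (2 ^ N), ∀ (h h1 h2 : ℝ → ℝ) (w : ℕ → ℝ → ℝ) (B : ℝ),
        TestTriple p h h1 h2 → Moduli p N B w →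
        (∀ (s : ℕ) (x y : ℝ), |gsm (s * v) h2 x - gsm (s * v) h2 y| ≤ w (s + 1) |x - y|) →
        ‖∫ ω, h (partialSum T X₀ n ω) ∂μ - ∫ y, h y ∂gaussianReal 0 (n * v)‖ₑ ≤
          ENNReal.ofReal B * C := by
  have hp := H.hp
  have hp0 : 0 < p := by linarith [hp.1]
  set θ := (p - 2) / p
  have hθ : θ ∈ Icc (0 : ℝ) (1 / 2) :=
    ⟨div_nonneg (by linarith [hp.1]) hp0.le, by
      rw [div_le_iff₀ hp0]; linarith [hp.2]⟩
  obtain ⟨C₀, hC₀, hlin⟩ : ∃ C₀ : ℝ≥0∞, C₀ ≠ ∞ ∧ ∀ (K : ℝ≥0∞) (N : ℕ), ∀ n ∈ Icc 1 (2 ^ N),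
      ∀ (h h1 h2 : ℝ → ℝ) (w : ℕ → ℝ → ℝ) (B : ℝ),
        TestTriple p h h1 h2 → Moduli p N B w →
        (∀ (s : ℕ) (x y : ℝ), |gsm (s * v) h2 x - gsm (s * v) h2 y| ≤ w (s + 1) |x - y|) →
        (∀ j < N, ∀ l ∈ Icc 1 (2 ^ j),
          monoCost p (μ.map (partialSum T X₀ l)) (gaussianReal 0 (l * v)) ≤ K * 2 ^ j) →
        ‖∫ ω, h (partialSum T X₀ n ω) ∂μ - ∫ y, h y ∂gaussianReal 0 (n * v)‖ₑ ≤
          ENNReal.ofReal B * (C₀ * (1 + K ^ θ)) := by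
    refine ⟨ENNReal.ofReal (∫ ω, |X₀ ω| ^ p ∂μ + ∫ y, |y| ^ p ∂gaussianReal 0 v) +
        16 * (ENNReal.ofReal ((v : ℝ) ^ ((p - 2) / 2) *
          (1 + ∫ y, |y| ^ (p - 2) ∂gaussianReal 0 1)) *
          (∑' k : ℕ, ((k + 1 : ℕ) : ℝ≥0∞) ^ (p / 2 - 2) *
            envelopeNorm p μ (condVarDev F₀ μ T X₀ σ (k + 1))) +
          ∑' k : ℕ, ((k + 1 : ℕ) : ℝ≥0∞) ^ (-(2 / p)) *
            eLpNorm (condVarDev F₀ μ T X₀ σ (k + 1)) (ENNReal.ofReal (p / 2)) μ), ?_, ?_⟩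
    · exact ENNReal.add_ne_top.2 ⟨ENNReal.ofReal_ne_top, ENNReal.mul_ne_top (by simp)
        (ENNReal.add_ne_top.2 ⟨ENNReal.mul_ne_top ENNReal.ofReal_ne_top hC1, hC2⟩)⟩
    · intro K N n hn h h1 h2 w B hh hw hmod hK
      refine (H.lindeberg hv hσ hn hh hw hmod hK).trans (mul_le_mul_right ?_ _)
      have gen : ∀ A V S x : ℝ≥0∞, A + 16 * (V + x * S) ≤ (A + 16 * (V + S)) * (1 + x) := by
        intro A V S x
        calc A + 16 * (V + x * S) ≤ A + 16 * (V + x * S) + (16 * S + A * x + 16 * V * x) :=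
              le_add_right le_rfl
          _ = _ := by ring
      exact gen _ _ _ _
  set c : ℝ := 1 / 16 * (1 / 3) ^ p
  have hc : 0 < c := by positivity
  have hc0 : ENNReal.ofReal c ≠ 0 := by simpa using hc
  set C' := (ENNReal.ofReal c)⁻¹ * ENNReal.ofReal 384 * C₀
  have hC' : C' ≠ ∞ := ENNReal.mul_ne_top (ENNReal.mul_ne_top (ENNReal.inv_ne_top.2 hc0)
    ENNReal.ofReal_ne_top) hC₀
  obtain ⟨K, hK, hfix⟩ := exists_fixed_bound hC' hθ
  -- K is fixed before the induction. The estimate at scale 2^N uses costs only at strictly smaller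
  -- dyadic scales and returns C'(1 + K^θ) 2^N ≤ K 2^N.
  have hcost : ∀ N : ℕ, ∀ n ∈ Icc 1 (2 ^ N),
      monoCost p (μ.map (partialSum T X₀ n)) (gaussianReal 0 (n * v)) ≤ K * 2 ^ N := by
    intro N
    induction N using Nat.strong_induction_on with
    | _ N ih =>
      intro n hn
      have hnv : (n * v : ℝ≥0) ≠ 0 := mul_ne_zero (by have := hn.1; positivity) hv
      have := H.isProbabilityMeasure_map n
      have hα : p - 2 ∈ Ioc (0 : ℝ) 1 := ⟨by linarith [hp.1], by linarith [hp.2]⟩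
      obtain ⟨f, g, k, hfg, hgk, hk, htest⟩ := exists_holder_deriv_two_test hα
        (μ.map (partialSum T X₀ n)) (gaussianReal 0 (n * v))
        (fun z => cdf_gaussianReal_mem_Ioo hnv 0 z)
      have hkg : Grows (p - 2) k := Grows.of_holder hα.1.le (by norm_num) hk
      have hgg : Grows (p - 1) g := by
        have := Grows.of_deriv hα.1.le hgk hkg
        rwa [show p - 2 + 1 = p - 1 by ring] at this
      have hfG : Grows p f := by
        have := Grows.of_deriv (by linarith [hp.1]) hfg hgg
        rwa [show p - 1 + 1 = p by ring] at this
      have hkm : Measurable k := (continuous_of_holder hα.1 hk).measurable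
      have htr : TestTriple p f g k := ⟨hfg, hgk, hkm, hfG, hgg, hkg⟩
      have hfm := htr.measurable_zero
      have hbd := hlin K N n hn f g k _ _ htr (moduli_rpow hp.1 (by norm_num : (0 : ℝ) ≤ 384) N)
        (fun s x y => gsm_modulus (w := fun d => 384 * d ^ (p - 2)) hα.1.le hkm hkg hk _ x y) ih
      have hle := monoCost_le_of_test (r := p) hc.le hfm (H.integrable_of_grows n hfm hfG)
        (by simpa using hfG.integrable hp0.le hfm (n * v) 0) (fun u hu => by
          refine le_trans (le_of_eq ?_) (htest u hu)
          rw [show p - 2 + 2 = p by ring, Real.div_rpow (abs_nonneg _) (by norm_num)]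
          simp only [c]
          rw [Real.div_rpow (by norm_num) (by norm_num), Real.one_rpow]
          ring)
      rw [H.integral_map_partialSum n hfm] at hle
      have h3 := hle.trans hbd
      rw [mul_comm, ← ENNReal.le_div_iff_mul_le (Or.inl hc0) (Or.inl ENNReal.ofReal_ne_top)] at h3
      refine h3.trans ?_
      have e : ENNReal.ofReal (384 * 2 ^ N) = ENNReal.ofReal 384 * 2 ^ N := by
        rw [ENNReal.ofReal_mul (by norm_num), ENNReal.ofReal_pow (by norm_num),
          ENNReal.ofReal_ofNat 2]
      rw [ENNReal.div_eq_inv_mul, e]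
      calc (ENNReal.ofReal c)⁻¹ * (ENNReal.ofReal 384 * 2 ^ N * (C₀ * (1 + K ^ θ)))
          = C' * (1 + K ^ θ) * 2 ^ N := by simp only [C']; ring
        _ ≤ K * 2 ^ N := by gcongr
  refine ⟨K, C₀ * (1 + K ^ θ), hK, ?_, hcost, fun N n hn h h1 h2 w B hh hw hmod =>
    hlin K N n hn h h1 h2 w B hh hw hmod fun j _ => hcost j⟩
  exact ENNReal.mul_ne_top hC₀ (ENNReal.add_ne_top.2 ⟨by simp,
    ENNReal.rpow_ne_top_of_nonneg hθ.1 hK⟩)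

end Stationary

/-! ### Power sums -/

/-- Bernoulli's inequality for the concave power b gives b (M+1)^(b-1) ≤ (M+1)^b - M^b, and the sum
telescopes. -/
lemma sum_rpow_sub_one_le {b : ℝ} (hb : b ∈ Ioc (0 : ℝ) 1) (M : ℕ) :
    ∑ i ∈ Finset.Icc 1 M, (i : ℝ) ^ (b - 1) ≤ b⁻¹ * (M : ℝ) ^ b := by
  induction M with
  | zero => simp [Real.zero_rpow hb.1.ne']
  | succ M ih =>
    rw [Finset.sum_Icc_succ_top (by omega)]
    have hM : (0 : ℝ) < (M : ℝ) + 1 := by positivity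
    have key : (M : ℝ) ^ b ≤ ((M : ℝ) + 1) ^ b - b * ((M : ℝ) + 1) ^ (b - 1) := by
      have h1 := rpow_one_add_le_one_add_mul_self (s := -1 / ((M : ℝ) + 1)) (p := b)
        (by rw [le_div_iff₀ hM]; linarith [(Nat.cast_nonneg M : (0 : ℝ) ≤ M)]) hb.1.le hb.2
      have h2 : (M : ℝ) = ((M : ℝ) + 1) * (1 + -1 / ((M : ℝ) + 1)) := by field_simp; ring
      have h3 : 0 ≤ 1 + -1 / ((M : ℝ) + 1) := by
        have : 1 + -1 / ((M : ℝ) + 1) = M / ((M : ℝ) + 1) := by field_simp; ring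
        rw [this]; positivity
      calc (M : ℝ) ^ b = ((M : ℝ) + 1) ^ b * (1 + -1 / ((M : ℝ) + 1)) ^ b := by
            rw [← Real.mul_rpow hM.le h3, ← h2]
        _ ≤ ((M : ℝ) + 1) ^ b * (1 + b * (-1 / ((M : ℝ) + 1))) := by gcongr
        _ = _ := by rw [Real.rpow_sub_one hM.ne']; field_simp; ring
    have hb' := hb.1
    push_cast
    calc ∑ i ∈ Finset.Icc 1 M, (i : ℝ) ^ (b - 1) + ((M : ℝ) + 1) ^ (b - 1)
        ≤ b⁻¹ * (M : ℝ) ^ b + ((M : ℝ) + 1) ^ (b - 1) := by gcongr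
      _ ≤ b⁻¹ * (((M : ℝ) + 1) ^ b - b * ((M : ℝ) + 1) ^ (b - 1)) + ((M : ℝ) + 1) ^ (b - 1) := by
          gcongr
      _ = _ := by field_simp; ring

/-- Telescoping again; the factor 2 is the price of replacing 1/(i+1) by 1/(2i) in Bernoulli's
inequality. -/
lemma sum_rpow_neg_sub_one_le {c : ℝ} (hc : c ∈ Ioc (0 : ℝ) 1) {m : ℕ} (hm : 1 ≤ m) (k : ℕ) :
    ∑ i ∈ Finset.Ico m (m + k), (i : ℝ) ^ (-c - 1) ≤ 2 / c * (m : ℝ) ^ (-c) := by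
  have hc' := hc.1
  suffices h : ∑ i ∈ Finset.Ico m (m + k), (i : ℝ) ^ (-c - 1) ≤
      2 / c * ((m : ℝ) ^ (-c) - ((m + k : ℕ) : ℝ) ^ (-c)) by
    refine h.trans ?_
    gcongr
    simp only [sub_le_self_iff]
    positivity
  induction k with
  | zero => simp
  | succ k ih =>
    rw [← add_assoc, Finset.sum_Ico_succ_top (by omega)]
    set i : ℝ := ((m + k : ℕ) : ℝ)
    have hi : (1 : ℝ) ≤ i := by
      simp only [i]
      exact_mod_cast (by omega : 1 ≤ m + k)
    have hi0 : 0 < i := by linarith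
    have key : (i + 1) ^ (-c) ≤ i ^ (-c) - c / 2 * i ^ (-c - 1) := by
      have h1 := rpow_one_add_le_one_add_mul_self (s := -1 / (i + 1)) (p := c)
        (by rw [le_div_iff₀ (by positivity)]; linarith) hc.1.le hc.2
      have h3 : 1 + -1 / (i + 1) = i / (i + 1) := by field_simp; ring
      rw [h3] at h1
      calc (i + 1) ^ (-c) = i ^ (-c) * (i / (i + 1)) ^ c := by
            rw [Real.div_rpow hi0.le (by positivity), Real.rpow_neg (by positivity),
              Real.rpow_neg hi0.le]
            have := Real.rpow_pos_of_pos hi0 c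
            field_simp
        _ ≤ i ^ (-c) * (1 + c * (-1 / (i + 1))) := by gcongr
        _ ≤ i ^ (-c) * (1 - c / 2 * i⁻¹) := by
            gcongr
            have : i⁻¹ / 2 ≤ 1 / (i + 1) := by
              rw [inv_eq_one_div, div_div, div_le_div_iff₀ (by positivity) (by positivity)]
              linarith
            have h5 := mul_le_mul_of_nonneg_left this hc.1.le
            have h6 : c * (-1 / (i + 1)) = -(c * (1 / (i + 1))) := by ring
            rw [h6]
            linarith
        _ = _ := by rw [Real.rpow_sub_one hi0.ne']; ring
    have e : ((m + k + 1 : ℕ) : ℝ) = i + 1 := by simp [i]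
    rw [e]
    calc ∑ x ∈ Finset.Ico m (m + k), (x : ℝ) ^ (-c - 1) + i ^ (-c - 1)
        ≤ 2 / c * ((m : ℝ) ^ (-c) - i ^ (-c)) + i ^ (-c - 1) := by gcongr
      _ = 2 / c * ((m : ℝ) ^ (-c) - (i ^ (-c) - c / 2 * i ^ (-c - 1))) := by field_simp; ring
      _ ≤ _ := by gcongr

lemma min_one_le_rpow {α y : ℝ} (hα : α ∈ Ioc (0 : ℝ) 1) (hy : 0 ≤ y) : min 1 y ≤ y ^ α := by
  rcases le_total y 1 with h | h
  · rw [min_eq_right h]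
    rcases hy.eq_or_lt with h0 | h0
    · rw [← h0]; positivity
    · calc y = y ^ (1 : ℝ) := (Real.rpow_one y).symm
        _ ≤ y ^ α := Real.rpow_le_rpow_of_exponent_ge h0 h hα.2
  · rw [min_eq_left h]
    exact Real.one_le_rpow h hα.1.le

/-- Sums of the moduli of continuity of smoothed functions. -/
lemma exists_sum_modulus_le {p r : ℝ} (hp : p ∈ Ioc (2 : ℝ) 3) (hr : r ∈ Icc (p - 2) 2)
    (hrp : (r, p) ≠ (1, 3)) :
    ∃ C : ℝ, 0 ≤ C ∧ ∀ (M : ℕ) (x : ℝ), 0 ≤ x →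
      ∑ i ∈ Finset.Icc 1 M, (i : ℝ) ^ ((r - 2) / 2) * min 1 (x / √(i : ℝ)) ≤
        C * (M : ℝ) ^ ((r - p + 2) / 2) * x ^ (p - 2) := by
  have hα : p - 2 ∈ Ioc (0 : ℝ) 1 := ⟨by linarith [hp.1], by linarith [hp.2]⟩
  rcases hr.1.eq_or_lt with h0 | h0
  -- Here r = p - 2, so p = 3 would force the excluded pair (1, 3); there the terms beyond x² are of
  -- order x/i, and their sum is not bounded uniformly in M.
  · have hα1 : p - 2 < 1 := by
      refine lt_of_le_of_ne hα.2 fun h => hrp ?_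
      rw [Prod.mk.injEq]
      exact ⟨by linarith, by linarith⟩
    set b := (p - 2) / 2
    set c := (1 - (p - 2)) / 2
    have hb : b ∈ Ioc (0 : ℝ) 1 := ⟨by simp only [b]; linarith [hp.1], by simp only [b]; linarith⟩
    have hc : c ∈ Ioc (0 : ℝ) 1 := ⟨by simp only [c]; linarith, by simp only [c]; linarith [hp.1]⟩
    have hb0 := hb.1
    have hc0 := hc.1
    refine ⟨b⁻¹ + 2 / c, by positivity, fun M x hx => ?_⟩
    have e0 : (r - p + 2) / 2 = 0 := by rw [← h0]; ring
    rw [e0, Real.rpow_zero, mul_one]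
    rcases hx.eq_or_lt with hx0 | hx0
    · rw [← hx0, Real.zero_rpow hα.1.ne', mul_zero]
      exact (Finset.sum_eq_zero fun i _ => by simp).le
    -- The two arguments of the minimum cross at i = x²: the value 1 is used below, x/√i above, and
    -- both parts are of order x^(p-2).
    set m := ⌊x ^ 2⌋₊ + 1
    have hm1 : ((m - 1 : ℕ) : ℝ) ≤ x ^ 2 := by
      simp only [m, Nat.add_sub_cancel]
      exact Nat.floor_le (by positivity)
    have hm2 : x ^ 2 ≤ m := by
      simp only [m]; push_cast
      exact (Nat.lt_floor_add_one _).le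
    have hsub : Finset.Icc 1 M ⊆ Finset.Icc 1 (m - 1) ∪ Finset.Ico m (m + M) := by
      intro i hi
      rw [Finset.mem_Icc] at hi
      rw [Finset.mem_union, Finset.mem_Icc, Finset.mem_Ico]
      omega
    have hnn : ∀ i : ℕ, 0 ≤ (i : ℝ) ^ ((r - 2) / 2) * min 1 (x / √(i : ℝ)) := fun i => by positivity
    have hex : (r - 2) / 2 = b - 1 := by simp only [b]; rw [← h0]; ring
    have hdisj : Disjoint (Finset.Icc 1 (m - 1)) (Finset.Ico m (m + M)) := by
      rw [Finset.disjoint_left]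
      intro i hi hi'
      rw [Finset.mem_Icc] at hi
      rw [Finset.mem_Ico] at hi'
      omega
    have p1 : ∑ i ∈ Finset.Icc 1 (m - 1), (i : ℝ) ^ ((r - 2) / 2) * min 1 (x / √(i : ℝ)) ≤
        b⁻¹ * x ^ (p - 2) := by
      calc _ ≤ ∑ i ∈ Finset.Icc 1 (m - 1), (i : ℝ) ^ (b - 1) := by
            refine Finset.sum_le_sum fun i _ => ?_
            rw [hex]
            exact mul_le_of_le_one_right (by positivity) (min_le_left _ _)
        _ ≤ b⁻¹ * ((m - 1 : ℕ) : ℝ) ^ b := sum_rpow_sub_one_le hb _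
        _ ≤ b⁻¹ * (x ^ 2) ^ b := by gcongr
        _ = b⁻¹ * x ^ (p - 2) := by
            rw [← Real.rpow_natCast, ← Real.rpow_mul hx]
            congr 2; simp only [b]; push_cast; ring
    have p2 : ∑ i ∈ Finset.Ico m (m + M), (i : ℝ) ^ ((r - 2) / 2) * min 1 (x / √(i : ℝ)) ≤
        2 / c * x ^ (p - 2) := by
      calc _ ≤ ∑ i ∈ Finset.Ico m (m + M), x * (i : ℝ) ^ (-c - 1) := by
            refine Finset.sum_le_sum fun i hi => ?_
            have hi0 : (0 : ℝ) < i := by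
              rw [Finset.mem_Ico] at hi
              exact_mod_cast (by omega : 0 < i)
            calc (i : ℝ) ^ ((r - 2) / 2) * min 1 (x / √(i : ℝ))
                ≤ (i : ℝ) ^ ((r - 2) / 2) * (x / √(i : ℝ)) := by gcongr; exact min_le_right _ _
              _ = x * ((i : ℝ) ^ ((r - 2) / 2) / √(i : ℝ)) := by ring
              _ = x * (i : ℝ) ^ (-c - 1) := by
                  rw [Real.sqrt_eq_rpow, ← Real.rpow_sub hi0]
                  congr 2; simp only [c]; rw [← h0]; ring
        _ ≤ x * (2 / c * (m : ℝ) ^ (-c)) := by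
            rw [← Finset.mul_sum]
            gcongr
            exact sum_rpow_neg_sub_one_le hc (by omega) M
        _ ≤ x * (2 / c * (x ^ 2) ^ (-c)) := by
            exact mul_le_mul_of_nonneg_left (mul_le_mul_of_nonneg_left
              (Real.rpow_le_rpow_of_nonpos (by positivity) hm2 (by linarith)) (by positivity)) hx
        _ = 2 / c * x ^ (p - 2) := by
            rw [← Real.rpow_natCast, ← Real.rpow_mul hx]
            have : p - 2 = 1 + ((2 : ℕ) : ℝ) * (-c) := by simp only [c]; push_cast; ring
            rw [this, Real.rpow_add hx0, Real.rpow_one]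
            ring
    calc _ ≤ ∑ i ∈ Finset.Icc 1 (m - 1) ∪ Finset.Ico m (m + M),
            (i : ℝ) ^ ((r - 2) / 2) * min 1 (x / √(i : ℝ)) :=
          Finset.sum_le_sum_of_subset_of_nonneg hsub fun i _ _ => hnn i
      _ ≤ b⁻¹ * x ^ (p - 2) + 2 / c * x ^ (p - 2) := by
          rw [Finset.sum_union hdisj]
          exact add_le_add p1 p2
      _ = _ := by ring
  -- Away from the borderline min(1, y) ≤ y^(p-2) suffices, since the remaining exponent δ - 1 is
  -- greater than -1.
  · set δ := (r - p + 2) / 2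
    have hδ : δ ∈ Ioc (0 : ℝ) 1 :=
      ⟨by simp only [δ]; linarith, by simp only [δ]; linarith [hr.2, hp.1]⟩
    refine ⟨δ⁻¹, inv_nonneg.2 hδ.1.le, fun M x hx => ?_⟩
    calc _ ≤ ∑ i ∈ Finset.Icc 1 M, (i : ℝ) ^ (δ - 1) * x ^ (p - 2) := by
          refine Finset.sum_le_sum fun i hi => ?_
          have hi0 : (0 : ℝ) < i := by
            rw [Finset.mem_Icc] at hi
            exact_mod_cast hi.1
          calc (i : ℝ) ^ ((r - 2) / 2) * min 1 (x / √(i : ℝ))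
              ≤ (i : ℝ) ^ ((r - 2) / 2) * (x / √(i : ℝ)) ^ (p - 2) := by
                gcongr
                exact min_one_le_rpow hα (by positivity)
            _ = (i : ℝ) ^ (δ - 1) * x ^ (p - 2) := by
                rw [Real.div_rpow hx (by positivity), Real.sqrt_eq_rpow, ← Real.rpow_mul hi0.le,
                  mul_div_assoc', mul_div_right_comm, ← Real.rpow_sub hi0]
                congr 2; simp only [δ]; ring
      _ ≤ _ := by
          rw [← Finset.sum_mul]
          gcongr
          exact sum_rpow_sub_one_le hδ M

/-- Along the multiples i · 2^j the moduli are those at the times i, rescaled by t = 2^j v. The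
preceding sum is applied with x = d/√t, and the powers of 2^j recombine into (2^N)^((r-p+2)/2)
2^(-j). -/
lemma exists_moduli {p r : ℝ} (hp : p ∈ Ioc (2 : ℝ) 3) (hr : r ∈ Icc (p - 2) 2)
    (hrp : (r, p) ≠ (1, 3)) {v : ℝ≥0} (hv : v ≠ 0) {C : ℝ} (hC : 0 ≤ C) :
    ∃ D : ℝ, 0 ≤ D ∧ ∀ N : ℕ, Moduli p N (D * (2 ^ N) ^ ((r - p + 2) / 2))
      fun s d => C * ((s * v : ℝ≥0) : ℝ) ^ ((r - 2) / 2) * min 1 (d / √((s * v : ℝ≥0) : ℝ)) := by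
  obtain ⟨E, hE, h⟩ := exists_sum_modulus_le hp hr hrp
  have hv0 : (0 : ℝ) < v := by exact_mod_cast pos_iff_ne_zero.2 hv
  refine ⟨C * E * (v : ℝ) ^ ((r - p) / 2), by positivity, fun N => ?_⟩
  refine ⟨by positivity, fun s => by fun_prop, fun s x _ y _ hxy => ?_, fun s d hd => by positivity,
    fun j hj d hd => ?_⟩
  · gcongr
  · set t : ℝ := 2 ^ j * v
    have ht : 0 < t := by positivity
    have hterm : ∀ i : ℕ, C * (((i * 2 ^ j : ℕ) * v : ℝ≥0) : ℝ) ^ ((r - 2) / 2) *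
        min 1 (d / √(((i * 2 ^ j : ℕ) * v : ℝ≥0) : ℝ)) =
        C * t ^ ((r - 2) / 2) * ((i : ℝ) ^ ((r - 2) / 2) * min 1 (d / √t / √(i : ℝ))) := by
      intro i
      have e : (((i * 2 ^ j : ℕ) * v : ℝ≥0) : ℝ) = t * i := by simp only [t]; push_cast; ring
      rw [e, Real.mul_rpow ht.le (by positivity), Real.sqrt_mul ht.le, div_div]
      ring
    rw [Finset.sum_congr rfl fun i _ => hterm i, ← Finset.mul_sum]
    refine (mul_le_mul_of_nonneg_left (h (2 ^ (N - j)) (d / √t) (by positivity))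
      (by positivity)).trans (le_of_eq ?_)
    rw [Real.div_rpow hd (by positivity), Real.sqrt_eq_rpow, ← Real.rpow_mul ht.le]
    push_cast
    have e1 : (2 : ℝ) ^ N = 2 ^ (N - j) * 2 ^ j := by rw [← pow_add]; congr 1; omega
    have e2 : t ^ ((r - 2) / 2) / t ^ (1 / 2 * (p - 2)) = t ^ ((r - p) / 2) := by
      rw [← Real.rpow_sub ht]; congr 1; ring
    have e3 : t ^ ((r - p) / 2) = ((2 : ℝ) ^ j) ^ ((r - p) / 2) * (v : ℝ) ^ ((r - p) / 2) :=
      Real.mul_rpow (by positivity) hv0.le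
    have e4 : ((2 : ℝ) ^ N) ^ ((r - p + 2) / 2) * (2 ^ j)⁻¹ =
        ((2 : ℝ) ^ (N - j)) ^ ((r - p + 2) / 2) * ((2 : ℝ) ^ j) ^ ((r - p) / 2) := by
      rw [e1, Real.mul_rpow (by positivity) (by positivity), mul_assoc]
      congr 1
      rw [← Real.rpow_neg_one ((2 : ℝ) ^ j), ← Real.rpow_add (by positivity)]
      congr 1; ring
    calc C * t ^ ((r - 2) / 2) * (E * ((2 : ℝ) ^ (N - j)) ^ ((r - p + 2) / 2) *
          (d ^ (p - 2) / t ^ (1 / 2 * (p - 2))))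
        = C * E * ((2 : ℝ) ^ (N - j)) ^ ((r - p + 2) / 2) * d ^ (p - 2) *
          (t ^ ((r - 2) / 2) / t ^ (1 / 2 * (p - 2))) := by ring
      _ = C * E * (v : ℝ) ^ ((r - p) / 2) * (((2 : ℝ) ^ (N - j)) ^ ((r - p + 2) / 2) *
          ((2 : ℝ) ^ j) ^ ((r - p) / 2)) * d ^ (p - 2) := by rw [e2, e3]; ring
      _ = _ := by rw [← e4]; ring

/-! ### The rates for all orders -/

lemma Grows.of_bounded {f : ℝ → ℝ} {A : ℝ} (h : ∀ x, |f x| ≤ A) : Grows 0 f :=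
  ⟨A, (abs_nonneg _).trans (h 0), fun x => by rw [Real.rpow_zero, mul_one]; exact h x⟩

lemma exists_two_pow {n : ℕ} (hn : 1 ≤ n) : ∃ N : ℕ, n ∈ Icc 1 (2 ^ N) ∧ (2 : ℝ) ^ N ≤ 2 * n := by
  refine ⟨Nat.clog 2 n, ⟨hn, Nat.le_pow_clog (by norm_num) n⟩, ?_⟩
  rcases hn.eq_or_lt with h | h
  · rw [← h]; simp
  · have h1 := Nat.pow_pred_clog_lt_self (b := 2) (by norm_num) h
    have h2 : 0 < Nat.clog 2 n := Nat.clog_pos (by norm_num) h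
    have h3 : 2 ^ Nat.clog 2 n = 2 * 2 ^ (Nat.clog 2 n).pred := by
      rw [← pow_succ']; congr 1; simp only [Nat.pred_eq_sub_one]; omega
    have h4 : 2 ^ Nat.clog 2 n ≤ 2 * n := by rw [h3]; omega
    exact_mod_cast h4

namespace Smoothable

variable {r C : ℝ} {f : ℝ → ℝ}

/-- The smoothed function and its derivatives. -/
lemma exists_testTriple (hf : Smoothable r C f) {p : ℝ} (hp : 2 < p) {v : ℝ≥0} (hv : v ≠ 0) :
    ∃ h1 h2 : ℝ → ℝ, TestTriple p (gsm v f) h1 h2 ∧ ∀ (s : ℕ) (x y : ℝ),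
      |gsm (s * v) h2 x - gsm (s * v) h2 y| ≤ C * (((s + 1 : ℕ) * v : ℝ≥0) : ℝ) ^ ((r - 2) / 2) *
        min 1 (|x - y| / √(((s + 1 : ℕ) * v : ℝ≥0) : ℝ)) := by
  obtain ⟨h1, h2, d1, d2, b2, c2, -⟩ := hf.deriv v hv
  have g2 : Grows 0 h2 := Grows.of_bounded b2
  have g1 : Grows 1 h1 := by simpa using Grows.of_deriv le_rfl d2 g2
  have tr : TestTriple p (gsm v f) h1 h2 := ⟨d1, d2, c2.measurable,
    (hf.grows.gsm (by norm_num) v).mono hp.le, g1.mono (by linarith), g2.mono (by linarith)⟩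
  refine ⟨h1, h2, tr, fun s x y => ?_⟩
  obtain ⟨f1, f2, e1, e2, -, -, m2⟩ := hf.deriv ((s + 1 : ℕ) * v)
    (mul_ne_zero (by exact_mod_cast Nat.succ_ne_zero s) hv)
  have trs := tr.gsm hp (s * v)
  -- The preliminary smoothing by variance v shifts time by one unit, which avoids the singularity
  -- at time 0; uniqueness of derivatives then identifies f2 with the smoothed h2.
  have hg : gsm (s * v) (gsm v f) = gsm ((s + 1 : ℕ) * v) f := by
    rw [gsm_gsm (by norm_num) hf.measurable hf.grows]
    congr 1; push_cast; ring
  have hf1 : f1 = gsm (s * v) h1 := by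
    ext z
    have := trs.deriv_one z
    rw [hg] at this
    exact (e1 z).unique this
  have hf2 : f2 = gsm (s * v) h2 := by
    ext z
    have := e2 z
    rw [hf1] at this
    exact this.unique (trs.deriv_two z)
  rw [← hf2]
  exact m2 x y

end Smoothable

namespace Stationary

set_option linter.unusedSectionVars false

variable {Ω : Type*} {F₀ mΩ : MeasurableSpace Ω}
  {μ : Measure Ω} [IsProbabilityMeasure μ] {T : Ω ≃ᵐ Ω} {X₀ : Ω → ℝ} {v : ℝ≥0} {p : ℝ}
  (H : Stationary F₀ μ T X₀ v p)

include H

/-- Comparison through functions which can be smoothed. -/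
lemma exists_smoothable_bound (hv : v ≠ 0) {r C : ℝ} (hr : r ∈ Icc (p - 2) 2)
    (hrp : (r, p) ≠ (1, 3)) (hC : 0 ≤ C) {E : ℝ≥0∞} (hE : E ≠ ∞)
    (hbound : ∀ N : ℕ, ∀ n ∈ Icc 1 (2 ^ N), ∀ (h h1 h2 : ℝ → ℝ) (w : ℕ → ℝ → ℝ) (B : ℝ),
        TestTriple p h h1 h2 → Moduli p N B w →
        (∀ (s : ℕ) (x y : ℝ), |gsm (s * v) h2 x - gsm (s * v) h2 y| ≤ w (s + 1) |x - y|) →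
        ‖∫ ω, h (partialSum T X₀ n ω) ∂μ - ∫ y, h y ∂gaussianReal 0 (n * v)‖ₑ ≤
          ENNReal.ofReal B * E) :
    ∃ A : ℝ, 0 ≤ A ∧ ∀ n : ℕ, 1 ≤ n → ∀ f : ℝ → ℝ, Smoothable r C f →
      |∫ x, f x ∂(μ.map (partialSum T X₀ n)) - ∫ y, f y ∂gaussianReal 0 (n * v)| ≤
        A * (n : ℝ) ^ ((r - p + 2) / 2) := by
  have hp := H.hp
  set δ := (r - p + 2) / 2
  have hδ : 0 ≤ δ := by simp only [δ]; linarith [hr.1]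
  obtain ⟨D, hD, hmod⟩ := exists_moduli hp hr hrp hv hC
  set m := ∫ y, |y| ^ r ∂gaussianReal 0 v
  have hm : 0 ≤ m := integral_nonneg fun _ => by positivity
  have hE0 : 0 ≤ E.toReal := ENNReal.toReal_nonneg
  -- Replacing f by its smoothing costs at most 2m under each of the two laws; since δ ≥ 0, this is
  -- absorbed by n^δ ≥ 1.
  refine ⟨D * 2 ^ δ * E.toReal + 4 * m, by positivity, fun n hn f hf => ?_⟩
  obtain ⟨N, hN, hN2⟩ := exists_two_pow hn
  obtain ⟨h1, h2, tr, hm2⟩ := hf.exists_testTriple hp.1 hv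
  have hfg : Grows p f := hf.grows.mono hp.1.le
  have key := hbound N n hN (gsm v f) h1 h2 _ _ tr (hmod N) hm2
  have hmap := H.isProbabilityMeasure_map n
  rw [← H.integral_map_partialSum n tr.measurable_zero] at key
  have key' : |∫ x, gsm v f x ∂(μ.map (partialSum T X₀ n)) -
      ∫ y, gsm v f y ∂gaussianReal 0 (n * v)| ≤ D * 2 ^ δ * E.toReal * (n : ℝ) ^ δ := by
    have h := ENNReal.toReal_mono (ENNReal.mul_ne_top ENNReal.ofReal_ne_top hE) key
    rw [Real.enorm_eq_ofReal_abs, ENNReal.toReal_ofReal (abs_nonneg _), ENNReal.toReal_mul,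
      ENNReal.toReal_ofReal (by positivity)] at h
    refine h.trans ?_
    calc D * (2 ^ N) ^ δ * E.toReal ≤ D * (2 * n) ^ δ * E.toReal := by gcongr
      _ = _ := by rw [Real.mul_rpow (by norm_num) (by positivity)]; ring
  have gen : ∀ ρ : Measure ℝ, IsProbabilityMeasure ρ → Integrable f ρ → Integrable (gsm v f) ρ →
      |∫ x, f x ∂ρ - ∫ x, gsm v f x ∂ρ| ≤ 2 * m := by
    intro ρ _ i1 i2
    rw [← integral_sub i1 i2]
    refine (abs_integral_le_integral_abs).trans ((integral_mono (i1.sub i2).abs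
      (integrable_const (2 * m)) fun z => ?_).trans (by simp))
    rw [Pi.sub_apply, abs_sub_comm]
    exact hf.approx v z
  have a1 := gen _ hmap (H.integrable_of_grows n hf.measurable hfg)
    (H.integrable_of_grows n tr.measurable_zero tr.grows_zero)
  have a2 := gen (gaussianReal 0 (n * v)) inferInstance
    (by simpa using hfg.integrable (by linarith [hp.1]) hf.measurable (n * v) 0)
    (by simpa using tr.grows_zero.integrable (by linarith [hp.1]) tr.measurable_zero (n * v) 0)
  have hn1 : (1 : ℝ) ≤ (n : ℝ) ^ δ := Real.one_le_rpow (by exact_mod_cast hn) hδ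
  rw [add_mul]
  have h4 : 4 * m ≤ 4 * m * (n : ℝ) ^ δ := le_mul_of_one_le_right (by positivity) hn1
  rw [abs_le] at *
  constructor <;> linarith [a1.1, a1.2, a2.1, a2.2, key'.1, key'.2]

/-- Couplings of the partial sums with Gaussian variables. -/
theorem exists_coupling_rate (hv : v ≠ 0) {σ : ℝ} (hσ : σ ^ 2 = v)
    (hC1 : ∑' k : ℕ, ((k + 1 : ℕ) : ℝ≥0∞) ^ (p / 2 - 2) *
      envelopeNorm p μ (condVarDev F₀ μ T X₀ σ (k + 1)) ≠ ∞)
    (hC2 : ∑' k : ℕ, ((k + 1 : ℕ) : ℝ≥0∞) ^ (-(2 / p)) *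
      eLpNorm (condVarDev F₀ μ T X₀ σ (k + 1)) (ENNReal.ofReal (p / 2)) μ ≠ ∞)
    {r : ℝ} (hr : r ∈ Icc (p - 2) p) (hrp : (r, p) ≠ (1, 3)) :
    ∃ A : ℝ, 0 ≤ A ∧ ∀ n : ℕ, 1 ≤ n →
      ∃ P ∈ couplings (μ.map (partialSum T X₀ n)) (gaussianReal 0 (n * v)),
        ∫⁻ z, ENNReal.ofReal (|z.1 - z.2| ^ r) ∂P ≤
          ENNReal.ofReal (A * (n : ℝ) ^ ((r - p + 2) / 2)) := by
  have hp := H.hp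
  have hp0 : 0 < p := by linarith [hp.1]
  obtain ⟨K, E, hK, hE, hcost, hbound⟩ := H.exists_bound hv hσ hC1 hC2
  obtain ⟨C, hC, hsm1, hsm2⟩ := exists_smoothable
  have hmap := fun n => H.isProbabilityMeasure_map n
  have large : ∀ s ∈ Ioc (1 : ℝ) 2, s ∈ Icc (p - 2) 2 → (s, p) ≠ (1, 3) → ∃ A : ℝ, 0 ≤ A ∧
      ∀ n : ℕ, 1 ≤ n → monoCost s (μ.map (partialSum T X₀ n)) (gaussianReal 0 (n * v)) ≤
        ENNReal.ofReal (A * (n : ℝ) ^ ((s - p + 2) / 2)) := by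
    intro s hs hs' hsp
    obtain ⟨A, hA, h⟩ := H.exists_smoothable_bound hv hs' hsp hC hE hbound
    set c : ℝ := (1 / 3) ^ s
    have hc : 0 < c := by positivity
    refine ⟨c⁻¹ * A, by positivity, fun n hn => ?_⟩
    have hnv : (n * v : ℝ≥0) ≠ 0 := mul_ne_zero (by positivity) hv
    obtain ⟨f, g, hfg, hg, htest⟩ := exists_holder_deriv_test hs (μ.map (partialSum T X₀ n))
      (gaussianReal 0 (n * v)) (fun z => cdf_gaussianReal_mem_Ioo hnv 0 z)
    have hf := hsm2 s hs f g hfg hg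
    have hfG : Grows p f := hf.grows.mono hp.1.le
    have hle := monoCost_le_of_test (r := s) hc.le hf.measurable
      (H.integrable_of_grows n hf.measurable hfG)
      (by simpa using hfG.integrable hp0.le hf.measurable (n * v) 0) (fun u hu => by
        refine le_trans (le_of_eq ?_) (htest u hu)
        rw [Real.div_rpow (abs_nonneg _) (by norm_num)]
        simp only [c]
        rw [Real.div_rpow (by norm_num) (by norm_num), Real.one_rpow]
        ring)
    rw [Real.enorm_eq_ofReal_abs] at hle
    have h3 := hle.trans (ENNReal.ofReal_le_ofReal (h n hn f hf))
    rw [mul_comm, ← ENNReal.le_div_iff_mul_le (Or.inl (by simpa using hc))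
      (Or.inl ENNReal.ofReal_ne_top), ← ENNReal.ofReal_div_of_pos hc] at h3
    refine h3.trans (le_of_eq ?_)
    congr 1
    rw [div_eq_inv_mul, mul_assoc]
  have top : ∃ A : ℝ, 0 ≤ A ∧ ∀ n : ℕ, 1 ≤ n →
      monoCost p (μ.map (partialSum T X₀ n)) (gaussianReal 0 (n * v)) ≤
        ENNReal.ofReal (A * n) := by
    refine ⟨2 * K.toReal, by positivity, fun n hn => ?_⟩
    obtain ⟨N, hN, hN2⟩ := exists_two_pow hn
    refine (hcost N n hN).trans ?_
    have : K * 2 ^ N = ENNReal.ofReal (K.toReal * 2 ^ N) := by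
      rw [ENNReal.ofReal_mul ENNReal.toReal_nonneg, ENNReal.ofReal_toReal hK,
        ENNReal.ofReal_pow (by norm_num), ENNReal.ofReal_ofNat]
    rw [this]
    refine ENNReal.ofReal_le_ofReal ?_
    nlinarith [ENNReal.toReal_nonneg (a := K)]
  have mono : ∀ s A : ℝ, (∀ n : ℕ, 1 ≤ n →
      monoCost s (μ.map (partialSum T X₀ n)) (gaussianReal 0 (n * v)) ≤
        ENNReal.ofReal (A * (n : ℝ) ^ ((s - p + 2) / 2))) → ∀ n : ℕ, 1 ≤ n →
      ∃ P ∈ couplings (μ.map (partialSum T X₀ n)) (gaussianReal 0 (n * v)),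
        ∫⁻ z, ENNReal.ofReal (|z.1 - z.2| ^ s) ∂P ≤
          ENNReal.ofReal (A * (n : ℝ) ^ ((s - p + 2) / 2)) := by
    intro s A h n hn
    have := hmap n
    exact ⟨_, monoCoupling_mem _ _, by rw [lintegral_monoCoupling]; exact h n hn⟩
  rcases le_or_gt r 1 with h1 | h1
  · obtain ⟨A, hA, h⟩ := H.exists_smoothable_bound hv ⟨hr.1, by linarith⟩ hrp hC hE hbound
    have hr0 : 0 < r := by linarith [hr.1, hp.1]
    refine ⟨A + 1, by positivity, fun n hn => ?_⟩
    have := hmap n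
    have hg : Grows p fun x : ℝ => |x| ^ r := by
      refine ⟨1, zero_le_one, fun x => ?_⟩
      rw [one_mul, abs_of_nonneg (by positivity)]
      calc |x| ^ r ≤ (1 + |x|) ^ r := Real.rpow_le_rpow (abs_nonneg _) (by linarith) hr0.le
        _ ≤ (1 + |x|) ^ p := Real.rpow_le_rpow_of_exponent_le (by linarith [abs_nonneg x]) hr.2
    -- For r ≤ 1 duality only approaches the infimum; a slack of 1 is harmless because n^((r-p+2)/2)
    -- ≥ 1.
    obtain ⟨P, hP, hle⟩ := exists_coupling_lintegral_le ⟨hr0, h1⟩ (μ.map (partialSum T X₀ n))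
      (gaussianReal 0 (n * v)) (H.integrable_of_grows n (by fun_prop) hg)
      (integrable_abs_rpow_gaussian _ hr0.le) (A * (n : ℝ) ^ ((r - p + 2) / 2))
      (fun f hf => (le_abs_self _).trans (h n hn f (hsm1 r ⟨hr0, h1⟩ f hf))) one_pos
    refine ⟨P, hP, hle.trans (ENNReal.ofReal_le_ofReal ?_)⟩
    have hn1 : (1 : ℝ) ≤ (n : ℝ) ^ ((r - p + 2) / 2) :=
      Real.one_le_rpow (by exact_mod_cast hn) (by linarith [hr.1])
    linarith
  rcases le_or_gt r 2 with h2 | h2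
  · obtain ⟨A, hA, h⟩ := large r ⟨h1, h2⟩ ⟨hr.1, h2⟩ hrp
    exact ⟨A, hA, mono r A h⟩
  · obtain ⟨A, hA, hq⟩ := large 2 ⟨by norm_num, le_rfl⟩ ⟨by linarith [hp.2], le_rfl⟩
      (by rw [Ne, Prod.mk.injEq]; norm_num)
    obtain ⟨A', hA', ht⟩ := top
    refine ⟨A + A', by positivity, mono r _ fun n hn => ?_⟩
    have hn0 : (0 : ℝ) < n := by exact_mod_cast hn
    set x := quantile (μ.map (partialSum T X₀ n))
    set y := quantile (gaussianReal 0 (n * v))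
    -- Interpolation z^r ≤ z² + z^p at the natural scale z = d/√n, for which both terms give the
    -- order n^((r-p+2)/2).
    have hpt : ∀ d : ℝ, 0 ≤ d → d ^ r ≤
        (n : ℝ) ^ (r / 2 - 1) * d ^ (2 : ℝ) + (n : ℝ) ^ ((r - p) / 2) * d ^ p := by
      intro d hd
      set s := √(n : ℝ)
      have hs : 0 < s := Real.sqrt_pos.2 hn0
      have hz : (d / s) ^ r ≤ (d / s) ^ (2 : ℝ) + (d / s) ^ p := by
        have h0 : 0 ≤ d / s := by positivity
        rcases le_total (d / s) 1 with h | h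
        · rcases h0.eq_or_lt with h0 | h0
          · rw [← h0, Real.zero_rpow (by linarith)]; positivity
          · have := Real.rpow_le_rpow_of_exponent_ge h0 h h2.le
            have h5 : 0 ≤ (d / s) ^ p := by positivity
            linarith
        · have := Real.rpow_le_rpow_of_exponent_le h hr.2
          have h5 : 0 ≤ (d / s) ^ (2 : ℝ) := by positivity
          linarith
      have hsr : ∀ a : ℝ, s ^ r * (d / s) ^ a = (n : ℝ) ^ ((r - a) / 2) * d ^ a := by
        intro a
        rw [Real.div_rpow hd hs.le, mul_div_assoc', mul_div_right_comm, ← Real.rpow_sub hs]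
        simp only [s]
        rw [Real.sqrt_eq_rpow, ← Real.rpow_mul hn0.le]
        congr 2; ring
      have h6 := mul_le_mul_of_nonneg_left hz (by positivity : 0 ≤ s ^ r)
      rw [mul_add, hsr, hsr, hsr] at h6
      simp only [sub_self, zero_div, Real.rpow_zero, one_mul] at h6
      refine h6.trans (le_of_eq ?_)
      congr 3; ring
    have hm1 := aemeasurable_quantile (μ.map (partialSum T X₀ n))
    have hm2 := aemeasurable_quantile (gaussianReal 0 (n * v))
    calc monoCost r (μ.map (partialSum T X₀ n)) (gaussianReal 0 (n * v))
        ≤ ∫⁻ u, (ENNReal.ofReal ((n : ℝ) ^ (r / 2 - 1)) * ENNReal.ofReal (|x u - y u| ^ (2 : ℝ)) +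
          ENNReal.ofReal ((n : ℝ) ^ ((r - p) / 2)) * ENNReal.ofReal (|x u - y u| ^ p)) ∂unif := by
          refine lintegral_mono fun u => ?_
          rw [← ENNReal.ofReal_mul (by positivity), ← ENNReal.ofReal_mul (by positivity),
            ← ENNReal.ofReal_add (by positivity) (by positivity)]
          exact ENNReal.ofReal_le_ofReal (hpt _ (abs_nonneg _))
      _ = ENNReal.ofReal ((n : ℝ) ^ (r / 2 - 1)) *
            monoCost 2 (μ.map (partialSum T X₀ n)) (gaussianReal 0 (n * v)) +
          ENNReal.ofReal ((n : ℝ) ^ ((r - p) / 2)) *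
            monoCost p (μ.map (partialSum T X₀ n)) (gaussianReal 0 (n * v)) := by
          have hm : AEMeasurable (fun u => |x u - y u|) unif := (hm1.sub hm2).abs
          rw [lintegral_add_left' ((hm.pow_const _).ennreal_ofReal.const_mul _),
            lintegral_const_mul' _ _ ENNReal.ofReal_ne_top,
            lintegral_const_mul' _ _ ENNReal.ofReal_ne_top]
          rfl
      _ ≤ ENNReal.ofReal ((n : ℝ) ^ (r / 2 - 1)) *
            ENNReal.ofReal (A * (n : ℝ) ^ (((2 : ℝ) - p + 2) / 2)) +
          ENNReal.ofReal ((n : ℝ) ^ ((r - p) / 2)) * ENNReal.ofReal (A' * n) := by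
          gcongr
          · exact hq n hn
          · exact ht n hn
      _ = ENNReal.ofReal ((A + A') * (n : ℝ) ^ ((r - p + 2) / 2)) := by
          rw [← ENNReal.ofReal_mul (by positivity), ← ENNReal.ofReal_mul (by positivity),
            ← ENNReal.ofReal_add (by positivity) (by positivity)]
          congr 1
          have e1 : (n : ℝ) ^ (r / 2 - 1) * (n : ℝ) ^ (((2 : ℝ) - p + 2) / 2) =
              (n : ℝ) ^ ((r - p + 2) / 2) := by
            rw [← Real.rpow_add hn0]; congr 1; ring
          have e2 : (n : ℝ) ^ ((r - p) / 2) * n = (n : ℝ) ^ ((r - p + 2) / 2) := by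
            rw [← Real.rpow_add_one hn0.ne']; congr 1; ring
          rw [add_mul, ← e1]
          nth_rw 2 [e1]
          rw [← e2]
          ring

end Stationary

/-! ### Normalization -/

lemma ofReal_one_div_rpow (k : ℕ) (a : ℝ) :
    ENNReal.ofReal (1 / ((k + 1 : ℕ) : ℝ) ^ a) = ((k + 1 : ℕ) : ℝ≥0∞) ^ (-a) := by
  have h : (0 : ℝ) < ((k + 1 : ℕ) : ℝ) := by positivity
  rw [one_div, ← Real.rpow_neg h.le, ← ENNReal.ofReal_rpow_of_pos h, ENNReal.ofReal_natCast]

lemma map_scale_mem_couplings {μ ν : Measure ℝ} {P : Measure (ℝ × ℝ)} (hP : P ∈ couplings μ ν)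
    (c : ℝ) : P.map (fun z => (c * z.1, c * z.2)) ∈
      couplings (μ.map fun x => c * x) (ν.map fun x => c * x) := by
  constructor
  · rw [Measure.map_map (by fun_prop) (by fun_prop), ← hP.1,
      Measure.map_map (by fun_prop) (by fun_prop)]
    rfl
  · rw [Measure.map_map (by fun_prop) (by fun_prop), ← hP.2,
      Measure.map_map (by fun_prop) (by fun_prop)]
    rfl

lemma lintegral_map_scale (P : Measure (ℝ × ℝ)) {c : ℝ} (hc : 0 ≤ c) (r : ℝ) :
    ∫⁻ z, ENNReal.ofReal (|z.1 - z.2| ^ r) ∂(P.map fun z => (c * z.1, c * z.2)) =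
      ENNReal.ofReal (c ^ r) * ∫⁻ z, ENNReal.ofReal (|z.1 - z.2| ^ r) ∂P := by
  rw [lintegral_map (by fun_prop) (by fun_prop), ← lintegral_const_mul' _ _ ENNReal.ofReal_ne_top]
  refine lintegral_congr fun z => ?_
  rw [← mul_sub, abs_mul, abs_of_nonneg hc, Real.mul_rpow hc (abs_nonneg _),
    ENNReal.ofReal_mul (by positivity)]

lemma wasserstein_le_of_coupling {r : ℝ} (hr : 0 < r) {μ ν : Measure ℝ} {P : Measure (ℝ × ℝ)}
    (hP : P ∈ couplings μ ν) {a : ℝ} (ha : 0 ≤ a)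
    (h : ∫⁻ z, ENNReal.ofReal (|z.1 - z.2| ^ r) ∂P ≤ ENNReal.ofReal a) :
    wasserstein r μ ν ≤ ENNReal.ofReal (a ^ (1 / max 1 r)) := by
  unfold wasserstein
  split_ifs with h1
  · rw [max_eq_left h1.le, div_one, Real.rpow_one]
    exact (iInf₂_le P hP).trans h
  · push Not at h1
    rw [max_eq_right h1, ← ENNReal.ofReal_rpow_of_nonneg ha (by positivity)]
    exact (iInf₂_le P hP).trans (ENNReal.rpow_le_rpow h (by positivity))

lemma map_scale_gaussianReal {n : ℕ} (hn : 1 ≤ n) (v : ℝ≥0) :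
    (gaussianReal 0 (n * v)).map (fun x => (n : ℝ) ^ (-(1 / 2) : ℝ) * x) = gaussianReal 0 v := by
  have hn0 : (0 : ℝ) < n := by exact_mod_cast hn
  rw [gaussianReal_map_const_mul, mul_zero]
  congr 1
  ext
  push_cast
  rw [← mul_assoc, ← Real.rpow_natCast, ← Real.rpow_mul hn0.le]
  norm_num
  rw [Real.rpow_neg_one, inv_mul_cancel₀ hn0.ne', one_mul]

namespace Stationary

set_option linter.unusedSectionVars false

variable {Ω : Type*} {F₀ mΩ : MeasurableSpace Ω}
  {μ : Measure Ω} [IsProbabilityMeasure μ] {T : Ω ≃ᵐ Ω} {X₀ : Ω → ℝ} {v : ℝ≥0} {p : ℝ}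
  (H : Stationary F₀ μ T X₀ v p)

include H

lemma partialSum_ae_eq_zero (hv : v = 0) (n : ℕ) : partialSum T X₀ n =ᵐ[μ] 0 := by
  have hi : ∀ i : ℤ, ∀ᵐ ω ∂μ, seq T X₀ i ω = 0 := by
    intro i
    have h := H.integral_sq i
    rw [hv, NNReal.coe_zero, integral_eq_zero_iff_of_nonneg (fun _ => sq_nonneg _)
      (H.integrable_sq i)] at h
    filter_upwards [h] with ω hω
    simpa using hω
  filter_upwards [ae_all_iff.2 hi] with ω hω
  simp [partialSum, hω]

lemma exists_coupling_rate_zero (hv : v = 0) {r : ℝ} (hr : 0 < r) (n : ℕ) :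
    ∃ P ∈ couplings (μ.map (partialSum T X₀ n)) (gaussianReal 0 (n * v)),
        ∫⁻ z, ENNReal.ofReal (|z.1 - z.2| ^ r) ∂P = 0 := by
  refine ⟨Measure.dirac (0, 0), ⟨?_, ?_⟩, ?_⟩
  · rw [Measure.map_dirac' measurable_fst, Measure.map_congr (H.partialSum_ae_eq_zero hv n)]
    have : (0 : Ω → ℝ) = fun _ => 0 := rfl
    rw [this, Measure.map_const]
    simp
  · rw [Measure.map_dirac' measurable_snd, hv, mul_zero, gaussianReal_zero_var]
  · rw [lintegral_dirac' _ (by fun_prop)]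
    simp [Real.zero_rpow hr.ne']

/-- Scaling by n^(-1/2) multiplies the cost by n^(-r/2), leaving n^(-(p-2)/2); the power 1/max(1, r)
then gives the rate. -/
lemma wasserstein_normalizedLaw_le {r : ℝ} (hr : 0 < r) {A : ℝ} (hA : 0 ≤ A) {n : ℕ} (hn : 1 ≤ n)
    (h : ∃ P ∈ couplings (μ.map (partialSum T X₀ n)) (gaussianReal 0 (n * v)),
        ∫⁻ z, ENNReal.ofReal (|z.1 - z.2| ^ r) ∂P ≤
          ENNReal.ofReal (A * (n : ℝ) ^ ((r - p + 2) / 2))) :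
    wasserstein r (normalizedLaw μ T X₀ n) (gaussianReal 0 v) ≤
      ENNReal.ofReal (A ^ (1 / max 1 r) * (n : ℝ) ^ (-(p - 2) / (2 * max 1 r))) := by
  have hn0 : (0 : ℝ) < n := by exact_mod_cast hn
  obtain ⟨P, hP, hle⟩ := h
  set c : ℝ := (n : ℝ) ^ (-(1 / 2) : ℝ)
  have hc : 0 ≤ c := by positivity
  have hP' := map_scale_mem_couplings hP c
  rw [map_scale_gaussianReal hn, Measure.map_map (by fun_prop) (H.measurable_partialSum' n)] at hP'
  have h2 := wasserstein_le_of_coupling (r := r) hr (a := A * (n : ℝ) ^ (-(p - 2) / 2)) hP'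
    (by positivity) (by
      rw [lintegral_map_scale P hc]
      refine (mul_le_mul_right hle _).trans (le_of_eq ?_)
      rw [← ENNReal.ofReal_mul (by positivity)]
      congr 1
      simp only [c]
      rw [← Real.rpow_mul hn0.le, mul_left_comm, ← Real.rpow_add hn0]
      congr 2; ring)
  refine h2.trans (le_of_eq ?_)
  have hmax : 0 < max 1 r := lt_max_of_lt_left one_pos
  rw [Real.mul_rpow hA (by positivity), ← Real.rpow_mul hn0.le]
  congr 3
  field_simp

end Stationary

end MartCLT

end

/-! ### Proof of the theorem -/

theorem mainTheorem2 {Ω : Type*} {F₀ mΩ : MeasurableSpace Ω}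
    (μ : Measure Ω) [IsProbabilityMeasure μ]
    (T : Ω ≃ᵐ Ω) (hT : MeasurePreserving T μ μ)
    (hF₀ : F₀ ≤ mΩ) (hF₀T : F₀ ≤ F₀.comap T)
    (X₀ : Ω → ℝ)
    (hmart : MartCLT.IsMartingaleDiff μ (MartCLT.sigmaAlg F₀ T) (MartCLT.seq T X₀))
    (σ : ℝ≥0) (hσ : (σ : ℝ) ^ 2 = Var[X₀; μ])
    (p : ℝ) (hp : p ∈ Ioc (2 : ℝ) 3)
    (hX₀ : MemLp X₀ (ENNReal.ofReal p) μ)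
    (hC1 : ∑' k : ℕ, ENNReal.ofReal (1 / ((k + 1 : ℕ) : ℝ) ^ (2 - p / 2)) *
        MartCLT.envelopeNorm p μ (MartCLT.condVarDev F₀ μ T X₀ σ (k + 1)) < ∞)
    (hC2 : ∑' k : ℕ, ENNReal.ofReal (1 / ((k + 1 : ℕ) : ℝ) ^ (2 / p)) *
        eLpNorm (MartCLT.condVarDev F₀ μ T X₀ σ (k + 1)) (ENNReal.ofReal (p / 2)) μ < ∞)
    (r : ℝ) (hr : r ∈ Icc (p - 2) p) (hrp : (r, p) ≠ (1, 3)) :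
    (∀ n : ℕ, 1 ≤ n → MartCLT.wasserstein r (MartCLT.normalizedLaw μ T X₀ n)
        (gaussianReal 0 (σ ^ 2)) < ∞) ∧
      (fun n : ℕ => (MartCLT.wasserstein r (MartCLT.normalizedLaw μ T X₀ n)
        (gaussianReal 0 (σ ^ 2))).toReal) =O[atTop]
        (fun n : ℕ => (n : ℝ) ^ (-(p - 2) / (2 * max 1 r))) := by
  have hr0 : 0 < r := by linarith [hr.1, hp.1]
  have hseq : MartCLT.seq T X₀ 0 = X₀ := by
    rw [MartCLT.seq, MartCLT.iter_zero, Function.comp_id]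
  -- Martingale differences are centred, so the variance of X₀ is its second moment.
  have hmean : ∫ ω, X₀ ω ∂μ = 0 := by
    have h := hmart.condExp_eq_zero 0
    rw [hseq] at h
    have hle : MartCLT.sigmaAlg F₀ T (0 - 1) ≤ mΩ := (MeasurableSpace.comap_mono hF₀).trans
      (MartCLT.measurePreserving_iter hT _).measurable.comap_le
    rw [← integral_condExp hle, integral_congr_ae h]
    simp
  have hvar : ∫ ω, X₀ ω ^ 2 ∂μ = ((σ ^ 2 : ℝ≥0) : ℝ) := by
    rw [NNReal.coe_pow, hσ, variance_of_integral_eq_zero hX₀.1.aemeasurable hmean]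
  have H : MartCLT.Stationary F₀ μ T X₀ (σ ^ 2) p := ⟨hT, hF₀, hF₀T, hmart, hX₀, hp, hvar⟩
  obtain ⟨A, hA, hrate⟩ : ∃ A : ℝ, 0 ≤ A ∧ ∀ n : ℕ, 1 ≤ n →
      ∃ P ∈ MartCLT.couplings (μ.map (MartCLT.partialSum T X₀ n)) (gaussianReal 0 (n * σ ^ 2)),
        ∫⁻ z, ENNReal.ofReal (|z.1 - z.2| ^ r) ∂P ≤
          ENNReal.ofReal (A * (n : ℝ) ^ ((r - p + 2) / 2)) := by
    -- In the degenerate case the sums vanish almost surely and the Gaussian law is the Dirac mass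
    -- at 0, so the cost is zero.
    by_cases hv : σ ^ 2 = 0
    · refine ⟨0, le_rfl, fun n _ => ?_⟩
      obtain ⟨P, hP, h⟩ := H.exists_coupling_rate_zero hv hr0 n
      exact ⟨P, hP, h.trans_le zero_le⟩
    · refine H.exists_coupling_rate hv (NNReal.coe_pow σ 2).symm ?_ ?_ hr hrp
      · simp_rw [MartCLT.ofReal_one_div_rpow, neg_sub] at hC1
        exact hC1.ne
      · simp_rw [MartCLT.ofReal_one_div_rpow] at hC2
        exact hC2.ne
  have hW := fun (n : ℕ) (hn : 1 ≤ n) =>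
    H.wasserstein_normalizedLaw_le hr0 hA hn (hrate n hn)
  refine ⟨fun n hn => (hW n hn).trans_lt ENNReal.ofReal_lt_top, ?_⟩
  refine IsBigO.of_bound (A ^ (1 / max 1 r)) ?_
  filter_upwards [eventually_ge_atTop 1] with n hn
  rw [Real.norm_of_nonneg ENNReal.toReal_nonneg, Real.norm_of_nonneg (by positivity)]
  exact ENNReal.toReal_le_of_le_ofReal (by positivity) (hW n hn)
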